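/- Let $r\ge 3$ and let $p_1,\dots,p_r$ be positive pairwise coprime integers with $p_2,\dots,p_r$ odd. Put $P=p_1\cdots p_r$ and $\widehat p_j=P/p_j$. Let $\mathfrak L$ be the set of $\underline\ell\in\mathbb Z^r$ with $0\le \ell_j\le p_j$ for all $j$, $p_j\nmid \ell_j$ for at least three values of $j$, and $\ell_j$ even for all $j\ge 2$. For $\underline\ell\in\mathfrak L$ and $\underline\varepsilon\in\{\pm1\}^r$ put $\mathcal N^{\underline\ell}(\underline\varepsilon)=P+\sum_j\varepsilon_j\ell_j\widehat p_j$. For $J\subset\{1,\dots,r\}$ such that $p_j\nmid\ell_j$ for all $j\in J$, the generalized Hikami function $g_J^{\underline\ell}:\mathbb Z\to\{-1,0,1\}$ is given by $g_J^{\underline\ell}(n)=\prod_{j\in J}\varepsilon_j$ if $n\equiv\mathcal N^{\underline\ell}(\underline\varepsilon)\pmod{2P}$ for some $\underline\varepsilon$ (the product does not depend on the choice of $\underline\varepsilon$), and $g_J^{\underline\ell}(n)=0$ if there is no such $\underline\varepsilon$. For $0\le s\le r-3$ let $\mathcal V_s$ be the complex vector space spanned by the $g_J^{\underline\ell}$ with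 $\underline\ell\in\mathfrak L$, $|J|\ge r-s$, $|J|\equiv r-s\pmod 2$ and $p_j\nmid \ell_j$ for all $j\in J$. For a $2P$-periodic $g:\mathbb Z\to\mathbb C$ put $$\Theta(\tau;\nu,g,2P)=\sum_{n\ge1}n^\nu g(n)\,e^{i\pi n^2\tau/(2P)}\qquad(\operatorname{Im}\tau>0).$$ **Quantum modular forms.** For $\gamma=\begin{pmatrix}a&b\\c&d\end{pmatrix}\in SL(2,\mathbb Z)$ write $J_\gamma(\tau)=c\tau+d$ and $\gamma\tau=\frac{a\tau+b}{c\tau+d}$. At $\alpha\in\mathbb Q$ with $J_\gamma(\alpha)\ne0$ the branch of $J_\gamma^{1/2}$ near $\alpha$ is chosen so that $J_\gamma(\alpha)^{1/2}>0$ if $J_\gamma(\alpha)>0$, and, if $J_\gamma(\alpha)<0$, so that $J_\gamma(\alpha)^{1/2}\in -i\mathbb R_{>0}$ when $c>0$ and $J_\gamma(\alpha)^{1/2}\in i\mathbb R_{>0}$ when $c\le0$. Let $D\ge1$, $w\in\frac12\mathbb Z$, $\varepsilon:SL(2,\mathbb Z)\to GL(D,\mathbb C)$ be any map, and let $\widetilde\varphi=(\widetilde\varphi_{i,\alpha})_{1\le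 i\le D,\ \alpha\in\mathbb Q}$ be a family of formal power series in $\mathbb C[[T]]$. Then $\widetilde\varphi$ is a vector-valued strong quantum modular form on $SL(2,\mathbb Z)$ with quantum set $\mathbb Q$, weight $w$, multiplier $\varepsilon$ and depth $N\ge0$ if: * for $N=0$: $\widetilde\varphi_{i,\alpha}$ is a constant $v_i\in\mathbb C$ not depending on $\alpha$; * for $N\ge1$: there are finitely many triples $(N_j,w_j,\varepsilon^{(j)})$ with $0\le N_j<N$, $w_j\in\frac12\mathbb Z$ and $\varepsilon^{(j)}:SL(2,\mathbb Z)\to GL(D,\mathbb C)$ such that, for every $\gamma\in SL(2,\mathbb Z)$, there are finitely many functions $h_t$, each holomorphic in a neighbourhood of $\mathbb R\setminus\{-d/c\}$ (of $\mathbb R$ if $c=0$), and families $\psi^{(t)}$, each a vector-valued strong quantum modular form with quantum set $\mathbb Q$ and with the depth $N_j$, weight $w_j$ and multiplier $\varepsilon^{(j)}$ of one of the triples, with, for all $i$ and all $\alpha\in\mathbb Q$ with $c\alpha+d\neq0$, $$\widetilde\varphi_{i,\alpha}(T)-J_\gamma(\alpha+T)^{-w}\sum_{m=1}^D\varepsilon_{i,m}(\gamma)\,\widetilde\varphi_{m,\gamma\alpha}\big(\gamma(\alpha+T)-\gamma\alpha\big)=\sum_t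 h_t(\alpha+T)\,\psi^{(t)}_{i,\alpha}(T)\quad\text{in }\mathbb C[[T]],$$ where $J_\gamma(\alpha+T)^{-w}$, $\gamma(\alpha+T)-\gamma\alpha$ and $h_t(\alpha+T)$ are expanded in Taylor series at $T=0$. A $D$-tuple of holomorphic functions $\varphi_i$ on the upper half-plane is called a vector-valued strong quantum modular form of weight $w$ and depth $N$ on $SL(2,\mathbb Z)$ with quantum set $\mathbb Q$ if each $\varphi_i$ has at each $\alpha\in\mathbb Q$ an asymptotic expansion $\varphi_i(\tau)\sim\widetilde\varphi_{i,\alpha}(\tau-\alpha)$ as $\tau\to\alpha$ non-tangentially, and the family $(\widetilde\varphi_{i,\alpha})$ is one in the above sense, for some multiplier. **Proposition.** Let $s,\nu\ge0$ be integers with $\nu+s\le r-3$ and $\nu+s\equiv r-3\pmod 2$. Then, for every $g\in\mathcal V_s$, the function $\Theta(\cdot\,;\nu,g,2P)$ is a component of a vector-valued strong quantum modular form on the full modular group $SL(2,\mathbb Z)$ of depth $\lfloor\nu/2\rfloor+1$ and weight $\nu+\frac12$, with quantum set $\mathbb Q$. -/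

import Mathlib

open scoped PowerSeries MatrixGroups

noncomputable section

namespace SeifertQMF

/-! ### Generalized Hikami functions and partial theta series -/

/-- `P = p_1 ⋯ p_r`. -/
def bigP {r : ℕ} (p : Fin r → ℕ) : ℕ := ∏ j, p j

/-- `P / p_j`, written as the product of the other `p_i`. -/
def phat {r : ℕ} (p : Fin r → ℕ) (j : Fin r) : ℕ := ∏ i ∈ Finset.univ.erase j, p i

/-- `N^h(ε) = P + ∑_j ε_j h_j P / p_j` for a tuple of signs `ε`. -/
def hikamiN {r : ℕ} (p : Fin r → ℕ) (h : Fin r → ℤ) (e : Fin r → ℤˣ) : ℤ :=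
  (bigP p : ℤ) + ∑ j, (e j : ℤ) * h j * (phat p j : ℤ)

/-- The Hikami set of `h`: the range of `N^h` translated by `2Pℤ`. -/
def hikamiSet {r : ℕ} (p : Fin r → ℕ) (h : Fin r → ℤ) : Set ℤ :=
  {n | ∃ e : Fin r → ℤˣ, n ≡ hikamiN p h e [ZMOD 2 * (bigP p : ℤ)]}

open Classical in
/-- The generalized Hikami function: `∏_{j ∈ J} ε_j` at a point `n` of the Hikami set, where `ε` is
any tuple of signs with `N^h(ε) ≡ n` modulo `2P`, and `0` outside the Hikami set. It is used only
when no `h_j` with `j ∈ J` is a multiple of `p_j`; see `prod_sign_eq` for the independence of the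
choice of `ε`. -/
def genHikami {r : ℕ} (p : Fin r → ℕ) (J : Finset (Fin r)) (h : Fin r → ℤ) (n : ℤ) : ℂ :=
  if hn : n ∈ hikamiSet p h then ∏ j ∈ J, (((hn.choose j : ℤˣ) : ℤ) : ℂ) else 0

theorem sign_eq {r : ℕ} (p : Fin r → ℕ)
    (hcop : Pairwise fun i j => (p i).Coprime (p j)) (h : Fin r → ℤ) (e e' : Fin r → ℤˣ)
    (hee : hikamiN p h e ≡ hikamiN p h e' [ZMOD 2 * (bigP p : ℤ)])
    (j : Fin r) (hj : ¬ (p j : ℤ) ∣ h j) : e j = e' j := by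
  have hP : bigP p = p j * phat p j := by
    simp [bigP, phat, Finset.mul_prod_erase]
  have hcj : IsCoprime (p j : ℤ) (phat p j : ℤ) := by
    rw [Nat.isCoprime_iff_coprime]
    exact Nat.Coprime.prod_right fun i hi => hcop (Finset.ne_of_mem_erase hi).symm
  have key : (2 * (p j : ℤ)) ∣ ∑ i, (((e' i : ℤ) - (e i : ℤ)) * h i * (phat p i : ℤ)) := by
    have h1 := hee.dvd
    have h2 : hikamiN p h e' - hikamiN p h e
        = ∑ i, (((e' i : ℤ) - (e i : ℤ)) * h i * (phat p i : ℤ)) := by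
      simp only [hikamiN, sub_mul, Finset.sum_sub_distrib]; ring
    rw [h2] at h1
    exact dvd_trans ⟨(phat p j : ℤ), by rw [hP]; push_cast; ring⟩ h1
  have hrest : (2 * (p j : ℤ)) ∣
      ∑ i ∈ Finset.univ.erase j, (((e' i : ℤ) - (e i : ℤ)) * h i * (phat p i : ℤ)) := by
    refine Finset.dvd_sum fun i hi => ?_
    have hd : (p j : ℤ) ∣ (phat p i : ℤ) := by
      exact_mod_cast Finset.dvd_prod_of_mem p
        (Finset.mem_erase.2 ⟨(Finset.ne_of_mem_erase hi).symm, Finset.mem_univ _⟩)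
    have h2 : (2 : ℤ) ∣ (e' i : ℤ) - (e i : ℤ) := by
      rcases Int.units_eq_one_or (e i) with h | h <;>
        rcases Int.units_eq_one_or (e' i) with h' | h' <;> simp [h, h']
    exact mul_dvd_mul (Dvd.dvd.mul_right h2 _) hd
  rw [← Finset.add_sum_erase _ _ (Finset.mem_univ j)] at key
  have hjj : (2 * (p j : ℤ)) ∣ ((e' j : ℤ) - (e j : ℤ)) * h j * (phat p j : ℤ) :=
    (dvd_add_left hrest).1 key
  by_contra hne
  apply hj
  have h3 : (2 * (p j : ℤ)) ∣ 2 * (h j * (phat p j : ℤ)) := by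
    rcases Int.units_eq_one_or (e j) with h | h <;>
      rcases Int.units_eq_one_or (e' j) with h' | h'
    · exact absurd (h.trans h'.symm) hne
    · rw [h, h'] at hjj
      refine (dvd_neg.2 hjj).trans (dvd_of_eq ?_)
      push_cast; ring
    · rw [h, h'] at hjj
      refine hjj.trans (dvd_of_eq ?_)
      push_cast; ring
    · exact absurd (h.trans h'.symm) hne
  exact hcj.dvd_of_dvd_mul_right ((mul_dvd_mul_iff_left two_ne_zero).1 h3)

theorem prod_sign_eq {r : ℕ} (p : Fin r → ℕ)
    (hcop : Pairwise fun i j => (p i).Coprime (p j)) (J : Finset (Fin r)) (h : Fin r → ℤ)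
    (hJ : ∀ j ∈ J, ¬ (p j : ℤ) ∣ h j) (n : ℤ) (e : Fin r → ℤˣ)
    (he : n ≡ hikamiN p h e [ZMOD 2 * (bigP p : ℤ)]) :
    genHikami p J h n = ∏ j ∈ J, (((e j : ℤˣ) : ℤ) : ℂ) := by
  have hn : n ∈ hikamiSet p h := ⟨e, he⟩
  rw [genHikami, dif_pos hn]
  refine Finset.prod_congr rfl fun j hj => ?_
  rw [sign_eq p hcop h _ _ (hn.choose_spec.symm.trans he) j (hJ j hj)]

/-- The index set `𝔏(p_1, …, p_r)`; indices are numbered from `0`, so that `l_j` is even for all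
indices but the first. -/
def indexSet {r : ℕ} (p : Fin r → ℕ) : Set (Fin r → ℤ) :=
  {l | (∀ j, 0 ≤ l j ∧ l j ≤ (p j : ℤ)) ∧
    3 ≤ {j : Fin r | ¬ (p j : ℤ) ∣ l j}.ncard ∧
    ∀ j : Fin r, (j : ℕ) ≠ 0 → Even (l j)}

/-- The space `𝒱_s` spanned by the `g_J^l` with `|J| ≥ r - s`, `|J| ≡ r - s` modulo `2`, `l ∈ 𝔏`
and `l_j` not a multiple of `p_j` for `j ∈ J`. -/
def hikamiSpace {r : ℕ} (p : Fin r → ℕ) (s : ℕ) : Submodule ℂ (ℤ → ℂ) :=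
  Submodule.span ℂ {g | ∃ (J : Finset (Fin r)) (l : Fin r → ℤ),
    r ≤ J.card + s ∧ J.card + s ≡ r [MOD 2] ∧ l ∈ indexSet p ∧
    (∀ j ∈ J, ¬ (p j : ℤ) ∣ l j) ∧ g = genHikami p J l}

/-- The partial theta series `∑_{n ≥ 1} n^ν f(n) exp(iπ n² τ / M)`, meant for `Im τ > 0`. -/
def partialTheta (ν : ℕ) (f : ℤ → ℂ) (M : ℕ) (τ : ℂ) : ℂ :=
  ∑' n : ℕ+, ((n : ℕ) : ℂ) ^ ν * f ((n : ℕ) : ℤ) *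
    Complex.exp (Complex.I * Real.pi * ((n : ℕ) : ℂ) ^ 2 * τ / M)

/-! ### Vector-valued strong quantum modular forms with quantum set `ℚ` on `SL(2, ℤ)`

A weight `w ∈ ½ℤ` is recorded through the integer `k = 2w`. -/

/-- The Taylor series of `f` at `a`, in the variable `T = τ - a`. -/
def taylorSeries (f : ℂ → ℂ) (a : ℂ) : ℂ⟦X⟧ :=
  PowerSeries.mk fun n => iteratedDeriv n f a / (n.factorial : ℂ)

/-- `J_γ(α) = c α + d`. -/
def denomQ (γ : SL(2, ℤ)) (α : ℚ) : ℚ := (γ 1 0 : ℚ) * α + (γ 1 1 : ℚ)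

/-- `γ α = (a α + b) / (c α + d)`, used only for `c α + d ≠ 0`. -/
def actQ (γ : SL(2, ℤ)) (α : ℚ) : ℚ := ((γ 0 0 : ℚ) * α + (γ 0 1 : ℚ)) / denomQ γ α

/-- The chosen value of `J_γ(α)^{1/2}` at a rational point: positive if `J_γ(α) > 0`; if
`J_γ(α) < 0`, in `-i ℝ_{>0}` when `c > 0` and in `i ℝ_{>0}` when `c ≤ 0`. -/
def sqrtDenomAt (γ : SL(2, ℤ)) (α : ℚ) : ℂ :=
  if 0 < denomQ γ α then (Real.sqrt (denomQ γ α : ℝ) : ℂ)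
  else if 0 < γ 1 0 then -Complex.I * (Real.sqrt (-(denomQ γ α : ℝ)) : ℂ)
  else Complex.I * (Real.sqrt (-(denomQ γ α : ℝ)) : ℂ)

/-- The holomorphic branch of `J_γ^{1/2}` near the rational point `α` whose value at `α` is
`sqrtDenomAt γ α`. -/
def sqrtDenom (γ : SL(2, ℤ)) (α : ℚ) (τ : ℂ) : ℂ :=
  sqrtDenomAt γ α *
    ((((γ 1 0 : ℤ) : ℂ) * τ + ((γ 1 1 : ℤ) : ℂ)) / ((denomQ γ α : ℚ) : ℂ)) ^ (1 / 2 : ℂ)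

/-- The Taylor series at `α` of `J_γ^{-w}`, where `w = k / 2`. -/
def autFactor (γ : SL(2, ℤ)) (k : ℤ) (α : ℚ) : ℂ⟦X⟧ :=
  taylorSeries (fun τ => sqrtDenom γ α τ ^ (-k)) (α : ℂ)

/-- The Taylor series at `α` of `γ τ - γ α`; it has no constant term. -/
def actSeries (γ : SL(2, ℤ)) (α : ℚ) : ℂ⟦X⟧ :=
  taylorSeries (fun τ => (((γ 0 0 : ℤ) : ℂ) * τ + ((γ 0 1 : ℤ) : ℂ)) /
    (((γ 1 0 : ℤ) : ℂ) * τ + ((γ 1 1 : ℤ) : ℂ)) - ((actQ γ α : ℚ) : ℂ)) (α : ℂ)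

/-- The `i`-th component at `α` of the modularity defect of a `D`-tuple of families of formal
series: `φ_{i,α}(T) - J_γ(α+T)^{-w} ∑_m ε_{i,m}(γ) φ_{m,γα}(γ(α+T) - γα)`. -/
def modDefect {D : ℕ} (k : ℤ) (ε : SL(2, ℤ) → GL (Fin D) ℂ) (φ : Fin D → ℚ → ℂ⟦X⟧)
    (γ : SL(2, ℤ)) (i : Fin D) (α : ℚ) : ℂ⟦X⟧ :=
  φ i α - autFactor γ k α *
    ∑ m, PowerSeries.C ((ε γ : Matrix (Fin D) (Fin D) ℂ) i m) *
      (φ m (actQ γ α)).subst (actSeries γ α)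

/-- `h` is holomorphic in a neighbourhood of `ℝ ∖ {-d/c}` (of `ℝ` if `c = 0`). -/
def HolNearReals (γ : SL(2, ℤ)) (h : ℂ → ℂ) : Prop :=
  ∀ x : ℝ, ((γ 1 0 : ℤ) : ℝ) * x + ((γ 1 1 : ℤ) : ℝ) ≠ 0 → AnalyticAt ℂ h (x : ℂ)

/-- `IsStrongVVQMF N k ε φ`: the `D`-tuple `φ` of families of formal series indexed by `ℚ` is a
vector-valued strong quantum modular form on `SL(2, ℤ)` of depth `N`, weight `k / 2`, quantum set
`ℚ` and multiplier `ε`. In depth `0` these are the constant tuples. In depth `N ≥ 1` there are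
finitely many depths `N_j < N`, weights and multipliers such that each modularity defect is a
finite sum of products of a function holomorphic near `ℝ ∖ {-d/c}` with a form of depth `N_j`. -/
def IsStrongVVQMF {D : ℕ} : ℕ → ℤ → (SL(2, ℤ) → GL (Fin D) ℂ) → (Fin D → ℚ → ℂ⟦X⟧) → Prop
  | 0, _, _, φ => ∃ v : Fin D → ℂ, ∀ i α, φ i α = PowerSeries.C (v i)
  | N + 1, k, ε, φ =>
    ∃ (m : ℕ) (depth : Fin m → Fin (N + 1)) (wt : Fin m → ℤ)
      (mult : Fin m → SL(2, ℤ) → GL (Fin D) ℂ),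
      ∀ γ : SL(2, ℤ), ∃ (K : ℕ) (idx : Fin K → Fin m) (h : Fin K → ℂ → ℂ)
        (ψ : Fin K → Fin D → ℚ → ℂ⟦X⟧),
        (∀ t, HolNearReals γ (h t)) ∧
        (∀ t, IsStrongVVQMF (depth (idx t)).val (wt (idx t)) (mult (idx t)) (ψ t)) ∧
        ∀ (i : Fin D) (α : ℚ), denomQ γ α ≠ 0 →
          modDefect k ε φ γ i α = ∑ t, taylorSeries (h t) (α : ℂ) * ψ t i α
termination_by N => N
decreasing_by exact (depth (idx t)).isLt

/-- `f(τ) ∼ ∑ a_n (τ - α)^n` as `τ → α` non-tangentially from within the upper half-plane. -/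
def HasNontangentialExpansion (f : ℂ → ℂ) (α : ℚ) (a : ℂ⟦X⟧) : Prop :=
  ∀ δ : ℝ, 0 < δ → ∀ N : ℕ,
    Asymptotics.IsBigO
      (nhdsWithin (α : ℂ) {τ : ℂ | δ ≤ (τ - (α : ℂ)).arg ∧ (τ - (α : ℂ)).arg ≤ Real.pi - δ})
      (fun τ => f τ - ∑ n ∈ Finset.range N, PowerSeries.coeff n a * (τ - (α : ℂ)) ^ n)
      (fun τ => (τ - (α : ℂ)) ^ N)

/-- A tuple of functions on the upper half-plane is a vector-valued strong quantum modular form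
(depth `N`, weight `k / 2`, quantum set `ℚ`, group `SL(2, ℤ)`, some multiplier) if they are
holomorphic, have non-tangential asymptotic expansions at all rational points, and the family of
these expansions is such a form. -/
def IsStrongVVQMFOnUHP {D : ℕ} (N : ℕ) (k : ℤ) (Φ : Fin D → ℂ → ℂ) : Prop :=
  (∀ i, DifferentiableOn ℂ (Φ i) {τ : ℂ | 0 < τ.im}) ∧
  ∃ (φ : Fin D → ℚ → ℂ⟦X⟧) (ε : SL(2, ℤ) → GL (Fin D) ℂ),
    (∀ i α, HasNontangentialExpansion (Φ i) α (φ i α)) ∧ IsStrongVVQMF N k ε φ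

end SeifertQMF

end

open scoped PowerSeries MatrixGroups

noncomputable section

set_option linter.unusedSimpArgs false
set_option linter.unusedVariables false
set_option linter.unusedSectionVars false

namespace SeifertQMF

open Complex Filter Asymptotics Topology

/-! Put M = 2P and write ν = ν₀ + 2k with ν₀ ∈ {0, 1}, e = 1 - ν₀. Each spanning function g_J of 𝒱_s
is a function on ℤ/M with the parity of e. Since |J| ≥ 2, some j ∈ J has p_j odd, and the Chinese
remainder theorem gives a unit w with w² ≡ 1 modulo 2M that flips the sign ε_j, hence the sign of
g_J (`exists_mem_weilSpace`). The span `weilSpace M e` of all functions with these two symmetries is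
stable under the finite Fourier transform and under multiplication by exp(πi n²/M), and its members
vanish at 0. By Jacobi inversion its theta series of exponent e form a vector-valued modular form of
weight e + 1/2 without constant terms (`thetaTransforms`). The partial theta series of exponent ν₀
has the opposite parity and behaves like an Eichler integral.

The analytic core is the integral R_φ(u) of ϑ(z)(z - u)^{-1/2} over the ray arg z = φ, where ϑ
decays rapidly at 0 and at ∞ in cones. When the ray is turned onto u, it splits there into an outer
and an inner part. The square root changes sign across its cut on the inner part, so R_φ = outer +
i·inner for φ < arg u and R_φ = outer - i·inner for φ > arg u. Take for ϑ a theta series of exponent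
ν₀ + 1. Gaussian integration makes the outer part a constant times the partial theta series of
exponent ν₀. The inversion law of ϑ turns the inner part into an outer part at -1/(c²u), that is,
into an automorphy factor times a partial theta series at γτ. For ν₀ = 0 the function ϑ is modular
of weight 3/2 (`transform_zero`); for ν₀ = 1 it is up to a constant the derivative of a form of
weight 1/2, and the extra term is removed by integration by parts (`transform_one`).

Two choices of the ray give what is needed. The vertical ray integral is analytic at all nonzero
reals, hence so is the modularity defect; the prescribed branch of J_γ^{1/2} matches the sign ±i on
the two sides of -d/c (`defectHol_of_pos`). A ray below a given cone yields an asymptotic expansion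
at the vertex, where the inner part is flat (`exists_coneExp_zmodTheta`).

Differentiating k times leads from ν₀ to ν. Each derivative raises the weight by 2 and adds the
earlier members of the sequence to the defect (`HasDefects.succ`), which accounts for depth k + 1.
Uniqueness of expansions carries these identities over to formal series (`modDefect_eq`). A basis of
`weilSpace` containing the given function supplies the vector. -/

/-! ### Asymptotic expansions along a filter -/

/-- `f` has the asymptotic expansion `a` in powers of `z` along the filter `l`. -/
def HasExp (l : Filter ℂ) (f : ℂ → ℂ) (a : ℂ⟦X⟧) : Prop :=
  ∀ N : ℕ, (fun z => f z - (a.trunc N).eval z) =O[l] fun z => z ^ N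

theorem isBigO_polynomial_eval {l : Filter ℂ} (hl : l ≤ 𝓝 0) (p : Polynomial ℂ) :
    (fun z => p.eval z) =O[l] fun _ => (1 : ℂ) :=
  (p.continuous.tendsto 0).mono_left hl |>.isBigO_one ℂ

theorem isBigO_eval_of_coeff_eq_zero {l : Filter ℂ} (hl : l ≤ 𝓝 0) (p : Polynomial ℂ) (N : ℕ)
    (h : ∀ n < N, p.coeff n = 0) : (fun z => p.eval z) =O[l] fun z => z ^ N := by
  obtain ⟨q, rfl⟩ := Polynomial.X_pow_dvd_iff.2 h
  simpa using (isBigO_refl (fun z : ℂ => z ^ N) l).mul (isBigO_polynomial_eval hl q)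

/-- Polynomials that agree below degree N differ by O(z^N). Products and substitutions produce such
polynomials rather than truncations. -/
theorem hasExp_iff {l : Filter ℂ} (hl : l ≤ 𝓝 0) {f : ℂ → ℂ} {a : ℂ⟦X⟧} :
    HasExp l f a ↔ ∀ N : ℕ, ∃ p : Polynomial ℂ, (∀ n < N, p.coeff n = PowerSeries.coeff n a) ∧
      (fun z => f z - p.eval z) =O[l] fun z => z ^ N := by
  refine ⟨fun h N => ⟨a.trunc N, fun n hn => by simp [PowerSeries.coeff_trunc, hn], h N⟩,
    fun h N => ?_⟩
  obtain ⟨p, hp, hO⟩ := h N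
  have := hO.add (isBigO_eval_of_coeff_eq_zero hl (p - a.trunc N) N fun n hn => by
    simp [PowerSeries.coeff_trunc, hn, hp n hn])
  refine this.congr_left fun z => ?_
  simp

namespace HasExp

variable {l l' : Filter ℂ} {f g : ℂ → ℂ} {a b : ℂ⟦X⟧}

theorem mono (h : HasExp l f a) (hl : l' ≤ l) : HasExp l' f a := fun N => (h N).mono hl

theorem congr' (h : HasExp l f a) (hfg : f =ᶠ[l] g) : HasExp l g a := fun N =>
  (h N).congr' (hfg.mono fun z hz => by simp only [hz]) EventuallyEq.rfl

theorem add (hf : HasExp l f a) (hg : HasExp l g b) : HasExp l (fun z => f z + g z) (a + b) :=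
  fun N => ((hf N).add (hg N)).congr_left fun z => by
    simp only [map_add, Polynomial.eval_add]; ring

theorem polynomial (hl : l ≤ 𝓝 0) (p : Polynomial ℂ) : HasExp l (fun z => p.eval z) (p : ℂ⟦X⟧) :=
  (hasExp_iff hl).2 fun N => ⟨p, fun n _ => by simp, by simpa using isBigO_zero _ _⟩

theorem const (hl : l ≤ 𝓝 0) (c : ℂ) : HasExp l (fun _ => c) (PowerSeries.C c) := by
  simpa using polynomial hl (Polynomial.C c)

theorem isBigO_one (hf : HasExp l f a) : f =O[l] fun _ => (1 : ℂ) := by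
  simpa using hf 0

theorem mul (hl : l ≤ 𝓝 0) (hf : HasExp l f a) (hg : HasExp l g b) :
    HasExp l (fun z => f z * g z) (a * b) := by
  refine (hasExp_iff hl).2 fun N => ⟨a.trunc N * b.trunc N, fun n hn => ?_, ?_⟩
  · rw [PowerSeries.coeff_mul_eq_coeff_trunc_mul_trunc a b hn, ← Polynomial.coe_mul,
      Polynomial.coeff_coe]
  · have h1 := (hf N).mul (hg.isBigO_one)
    have h2 := (isBigO_polynomial_eval hl (a.trunc N)).mul (hg N)
    simp only [mul_one, one_mul] at h1 h2
    refine (h1.add h2).congr_left fun z => ?_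
    simp only [Polynomial.eval_mul]; ring

theorem neg (hf : HasExp l f a) : HasExp l (fun z => - f z) (-a) := fun N =>
  (hf N).neg_left.congr_left fun z => by
    simp only [map_neg, Polynomial.eval_neg]; ring

theorem sub (hf : HasExp l f a) (hg : HasExp l g b) : HasExp l (fun z => f z - g z) (a - b) := by
  simpa only [sub_eq_add_neg] using hf.add hg.neg

theorem const_mul (hl : l ≤ 𝓝 0) (c : ℂ) (hf : HasExp l f a) :
    HasExp l (fun z => c * f z) (PowerSeries.C c * a) := (const hl c).mul hl hf

theorem pow (hl : l ≤ 𝓝 0) (hf : HasExp l f a) (n : ℕ) : HasExp l (fun z => f z ^ n) (a ^ n) := by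
  induction n with
  | zero => simpa using const hl 1
  | succ n ih => simpa only [pow_succ] using ih.mul hl hf

theorem sum (hl : l ≤ 𝓝 0) {ι : Type*} (s : Finset ι) {F : ι → ℂ → ℂ} {A : ι → ℂ⟦X⟧}
    (h : ∀ i ∈ s, HasExp l (F i) (A i)) :
    HasExp l (fun z => ∑ i ∈ s, F i z) (∑ i ∈ s, A i) := by
  classical
  induction s using Finset.induction_on with
  | empty => simpa using const hl 0
  | insert i s hi ih =>
    simp only [Finset.sum_insert hi]
    exact (h i (Finset.mem_insert_self _ _)).add
      (ih fun j hj => h j (Finset.mem_insert_of_mem hj))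

/-- Composition of asymptotic expansions. -/
theorem comp (hl : l ≤ 𝓝 0) (hf : HasExp l' f a) {u : ℂ → ℂ} (hu : HasExp l u b)
    (hb : PowerSeries.constantCoeff b = 0) (hul : Tendsto u l l') :
    HasExp l (fun z => f (u z)) (a.subst b) := by
  have hsub : PowerSeries.HasSubst b := PowerSeries.HasSubst.of_constantCoeff_zero' hb
  refine (hasExp_iff hl).2 fun N => ?_
  have hpoly : HasExp l (fun z => (a.trunc N).eval (u z)) ((a.trunc N : ℂ⟦X⟧).subst b) := by
    have h1 : ∀ p : Polynomial ℂ, HasExp l (fun z => p.eval (u z)) ((p : ℂ⟦X⟧).subst b) := by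
      intro p
      rw [PowerSeries.subst_coe hsub, Polynomial.aeval_eq_sum_range]
      simp only [Polynomial.eval_eq_sum_range, PowerSeries.smul_eq_C_mul]
      exact sum hl _ fun i _ => (hu.pow hl i).const_mul hl _
    exact h1 _
  refine ⟨PowerSeries.trunc N ((a.trunc N : ℂ⟦X⟧).subst b), fun n hn => ?_, ?_⟩
  -- As b = X c, substituting b into the tail X^N(…) of a gives a multiple of X^N, so the
  -- coefficients below N come from the truncation alone.
  · have h2 := PowerSeries.eq_X_pow_mul_shift_add_trunc N a
    conv_rhs => rw [h2, PowerSeries.subst_add hsub, PowerSeries.subst_mul hsub,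
      PowerSeries.subst_pow hsub, PowerSeries.subst_X hsub]
    obtain ⟨c, rfl⟩ := PowerSeries.X_dvd_iff.2 hb
    rw [mul_pow, mul_assoc, map_add, PowerSeries.coeff_X_pow_mul', if_neg (by omega), zero_add,
      PowerSeries.coeff_trunc, if_pos hn]
  · have h3 : (fun z => f (u z) - (a.trunc N).eval (u z)) =O[l] fun z => u z ^ N :=
      (hf N).comp_tendsto hul
    have h4 : u =O[l] fun z => z := by
      have := hu 1
      simpa [PowerSeries.trunc_one_left, PowerSeries.coeff_zero_eq_constantCoeff_apply, hb]
        using this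
    exact ((h3.trans (h4.pow N)).add (hpoly N)).congr_left fun z => by ring

theorem of_isBigO_pow (h : ∀ N : ℕ, f =O[l] fun z => z ^ N) : HasExp l f 0 :=
  fun N => by simpa using h N

/-- The first nonzero coefficient of the difference, divided by z^n, would be a constant that is
O(z). The filter has to avoid 0 for the division and be nontrivial for the limit. This is the bridge
from identities of functions to identities of formal series. -/
theorem unique [l.NeBot] (hl : l ≤ 𝓝[≠] 0) (ha : HasExp l f a) (hb : HasExp l f b) : a = b := by
  have hl0 : l ≤ 𝓝 0 := hl.trans nhdsWithin_le_nhds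
  have key : ∀ c : ℂ⟦X⟧, HasExp l (fun _ => 0) c → c = 0 := by
    intro c hc
    ext n
    induction n using Nat.strong_induction_on with
    | _ n ih =>
      have h1 := hc (n + 1)
      have h2 : ∀ z : ℂ, (c.trunc (n + 1)).eval z = PowerSeries.coeff n c * z ^ n := by
        intro z
        have : c.trunc (n + 1) = Polynomial.monomial n (PowerSeries.coeff n c) := by
          ext k
          rw [PowerSeries.coeff_trunc, Polynomial.coeff_monomial]
          rcases lt_trichotomy k n with h | h | h
          · rw [if_pos (by omega), if_neg (by omega), ih k h, map_zero]
          · subst h; simp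
          · rw [if_neg (by omega), if_neg (by omega)]
        rw [this, Polynomial.eval_monomial]
      simp only [h2, zero_sub] at h1
      have h3 : (fun _ : ℂ => PowerSeries.coeff n c) =O[l] fun z => z := by
        have h4 := h1.neg_left.mul (isBigO_refl (fun z : ℂ => (z ^ n)⁻¹) l)
        refine h4.congr' ?_ ?_
        · filter_upwards [hl self_mem_nhdsWithin] with z hz
          have hz : z ≠ 0 := hz
          field_simp
        · filter_upwards [hl self_mem_nhdsWithin] with z hz
          have hz : z ≠ 0 := hz
          field_simp
          ring
      have h5 : Tendsto (fun _ : ℂ => PowerSeries.coeff n c) l (𝓝 0) :=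
        h3.trans_tendsto (hl0 : Tendsto id l (𝓝 0))
      simpa using tendsto_nhds_unique tendsto_const_nhds h5
  have := key (a - b) (by simpa using ha.sub hb)
  exact sub_eq_zero.1 this

end HasExp

theorem hasExp_taylorSeries {f : ℂ → ℂ} {x : ℂ} (hf : AnalyticAt ℂ f x) :
    HasExp (𝓝 0) (fun z => f (x + z)) (taylorSeries f x) := by
  intro N
  have h := hf.hasFPowerSeriesAt.isBigO_sub_partialSum_pow N
  have h' := h.trans (k := fun z : ℂ => z ^ N) (IsBigO.of_bound 1 (by simp))
  refine h'.congr_left fun z => ?_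
  congr 1
  rw [FormalMultilinearSeries.partialSum, Polynomial.eval, PowerSeries.eval₂_trunc_eq_sum_range]
  refine Finset.sum_congr rfl fun n _ => ?_
  simp [taylorSeries, mul_comm]

/-! ### Cones with vertex at the origin -/

/-- The cone of all `z ≠ 0` with `η |z| ≤ Im z`. -/
def cone (η : ℝ) : Set ℂ := {z | z ≠ 0 ∧ η * ‖z‖ ≤ z.im}

theorem cone_mono {η η' : ℝ} (h : η ≤ η') : cone η' ⊆ cone η := fun z hz =>
  ⟨hz.1, (mul_le_mul_of_nonneg_right h (norm_nonneg z)).trans hz.2⟩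

theorem im_pos_of_mem_cone {η : ℝ} (hη : 0 < η) {z : ℂ} (hz : z ∈ cone η) : 0 < z.im :=
  (mul_pos hη (norm_pos_iff.2 hz.1)).trans_le hz.2

theorem nhdsWithin_cone_le (η : ℝ) : 𝓝[cone η] (0 : ℂ) ≤ 𝓝[≠] 0 :=
  nhdsWithin_mono _ fun _ hz => hz.1

theorem nhdsWithin_cone_neBot {η : ℝ} (hη : η ≤ 1) : (𝓝[cone η] (0 : ℂ)).NeBot := by
  have h : Tendsto (fun y : ℝ => (y : ℂ) * I) (𝓝[>] 0) (𝓝[cone η] 0) := by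
    refine tendsto_nhdsWithin_iff.2 ⟨?_, ?_⟩
    · refine Tendsto.mono_left ?_ nhdsWithin_le_nhds
      have : Continuous fun y : ℝ => (y : ℂ) * I := by fun_prop
      simpa using this.tendsto 0
    · filter_upwards [self_mem_nhdsWithin] with y hy
      have hy : 0 < y := hy
      refine ⟨by simp [hy.ne'], ?_⟩
      simp only [norm_mul, norm_I, mul_one, mul_im, ofReal_re, I_im, ofReal_im, I_re, mul_zero,
        add_zero, Complex.norm_real, Real.norm_eq_abs, abs_of_pos hy]
      nlinarith
  exact h.neBot

/-- `f` has the expansion `a` at `x` in all cones. -/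
def ConeExp (f : ℂ → ℂ) (x : ℂ) (a : ℂ⟦X⟧) : Prop :=
  ∀ η : ℝ, 0 < η → HasExp (𝓝[cone η] 0) (fun z => f (x + z)) a

/-- Since Im z = |z| sin(arg z), the sector δ ≤ arg z ≤ π - δ lies in the cone with η = sin δ. For δ
> π/2 the sector is empty. -/
theorem ConeExp.hasNontangentialExpansion {f : ℂ → ℂ} {α : ℚ} {a : ℂ⟦X⟧}
    (h : ConeExp f (α : ℂ) a) : HasNontangentialExpansion f α a := by
  intro δ hδ N
  set S := {τ : ℂ | δ ≤ (τ - (α : ℂ)).arg ∧ (τ - (α : ℂ)).arg ≤ Real.pi - δ}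
  rcases lt_or_ge (Real.pi / 2) δ with hδ2 | hδ2
  · have : S = ∅ := by
      ext τ
      simp only [S, Set.mem_ofPred_eq, Set.mem_empty_iff_false, iff_false]
      rintro ⟨h1, h2⟩
      linarith
    rw [this, nhdsWithin_empty]
    exact IsBigO.of_bound 1 (by simp)
  have hsin : 0 < Real.sin δ := Real.sin_pos_of_pos_of_lt_pi hδ (by linarith [Real.pi_pos])
  have ht : Tendsto (fun τ : ℂ => τ - α) (𝓝[S] (α : ℂ)) (𝓝[cone (Real.sin δ)] 0) := by
    refine tendsto_nhdsWithin_iff.2 ⟨?_, ?_⟩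
    · refine Tendsto.mono_left ?_ nhdsWithin_le_nhds
      have : Continuous fun τ : ℂ => τ - α := by fun_prop
      simpa using this.tendsto (α : ℂ)
    · filter_upwards [self_mem_nhdsWithin] with τ hτ
      obtain ⟨h1, h2⟩ := hτ
      refine ⟨fun h0 => ?_, ?_⟩
      · rw [h0, arg_zero] at h1; linarith
      · have h0 := Complex.norm_mul_sin_arg (τ - (α : ℂ))
        rw [mul_comm, ← h0]
        refine mul_le_mul_of_nonneg_left ?_ (norm_nonneg (τ - (α : ℂ)))
        rcases le_total (τ - (α : ℂ)).arg (Real.pi / 2) with h3 | h3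
        · exact Real.sin_le_sin_of_le_of_le_pi_div_two (by linarith [Real.pi_pos]) h3 h1
        · rw [← Real.sin_pi_sub (τ - (α : ℂ)).arg]
          exact Real.sin_le_sin_of_le_of_le_pi_div_two (by linarith [Real.pi_pos]) (by linarith)
            (by linarith)
  refine ((h _ hsin N).comp_tendsto ht).congr (fun τ => ?_) fun τ => rfl
  simp only [Function.comp]
  rw [add_sub_cancel, Polynomial.eval, PowerSeries.eval₂_trunc_eq_sum_range]
  rfl

/-- Cones shrink as η grows, so the series of every η ≤ 1 is also an expansion in the cone with η =
1 and is unique there. -/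
theorem ConeExp.of_forall_exists {f : ℂ → ℂ} {x : ℂ}
    (h : ∀ η : ℝ, 0 < η → ∃ a, HasExp (𝓝[cone η] 0) (fun z => f (x + z)) a) :
    ∃ a, ConeExp f x a := by
  obtain ⟨a, ha⟩ := h 1 one_pos
  refine ⟨a, fun η hη => ?_⟩
  obtain ⟨b, hb⟩ := h η hη
  rcases le_total η 1 with h1 | h1
  · have := nhdsWithin_cone_neBot (le_refl 1)
    rwa [ha.unique (nhdsWithin_cone_le 1) (hb.mono (nhdsWithin_mono _ (cone_mono h1)))]
  · exact ha.mono (nhdsWithin_mono _ (cone_mono h1))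

/-- Cauchy's estimate on discs of radius proportional to |z| costs one power of |z|, so the
remainder of order N + 1 of f controls the remainder of order N of its derivative. -/
theorem ConeExp.deriv {f : ℂ → ℂ} {x : ℂ} {a : ℂ⟦X⟧} (h : ConeExp f x a) (hx : x.im = 0)
    (hf : DifferentiableOn ℂ f {τ | 0 < τ.im}) :
    ConeExp (deriv f) x (PowerSeries.derivative ℂ a) := by
  have aux : ∀ η : ℝ, 0 < η → η ≤ 1 →
      HasExp (𝓝[cone η] 0) (fun z => _root_.deriv f (x + z)) (PowerSeries.derivative ℂ a) := by
    intro η hη hη1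
    refine (hasExp_iff nhdsWithin_le_nhds).2 fun N => ?_
    refine ⟨Polynomial.derivative (a.trunc (N + 1)), fun n hn => ?_, ?_⟩
    · rw [Polynomial.coeff_derivative, PowerSeries.coeff_trunc, if_pos (by omega),
        PowerSeries.coeff_derivative]
    obtain ⟨C, hC⟩ := (h (η / 4) (by positivity) (N + 1)).bound
    obtain ⟨r, hr, hball⟩ := Metric.mem_nhdsWithin_iff.1 hC
    refine IsBigO.of_bound (C * (5 / 4) ^ (N + 1) / (η / 4)) ?_
    refine Metric.mem_nhdsWithin_iff.2 ⟨r / 2, by positivity, ?_⟩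
    rintro z ⟨hz1, hz2⟩
    have hz0 : 0 < ‖z‖ := norm_pos_iff.2 hz2.1
    have hzr : ‖z‖ < r / 2 := by simpa using hz1
    -- For η ≤ 1 the disc of this radius around a point of the cone for η stays in the cone for η/4,
    -- where the expansion of f is available, and in |w| ≤ (5/4)|z|.
    set ρ := ‖z‖ * (η / 4) with hρ
    have hρ0 : 0 < ρ := by positivity
    have hcl : ∀ w ∈ Metric.closedBall z ρ, w ∈ cone (η / 4) ∧ ‖w‖ ≤ 5 / 4 * ‖z‖ := by
      intro w hw
      have hwz : ‖w - z‖ ≤ ρ := by simpa [dist_eq_norm] using hw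
      have him : |(w - z).im| ≤ ρ := (Complex.abs_im_le_norm _).trans hwz
      have him' := (abs_le.1 him).1
      rw [Complex.sub_im] at him'
      have h5 : ‖w‖ ≤ 5 / 4 * ‖z‖ := by
        have : ‖w‖ ≤ ‖w - z‖ + ‖z‖ := by simpa using norm_add_le (w - z) z
        nlinarith
      have h6 := hz2.2
      have h7 : 0 < w.im := by nlinarith
      refine ⟨⟨fun h0 => ?_, ?_⟩, h5⟩
      · rw [h0] at h7; simp at h7
      · nlinarith
    set G : ℂ → ℂ := fun w => f (x + w) - (a.trunc (N + 1)).eval w with hG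
    have hfd : ∀ w : ℂ, 0 < w.im → DifferentiableAt ℂ f (x + w) := fun w hw =>
      (hf (x + w) (by simpa [hx] using hw)).differentiableAt
        ((isOpen_lt continuous_const Complex.continuous_im).mem_nhds (by simpa [hx] using hw))
    have hGd : ∀ w : ℂ, 0 < w.im → HasDerivAt G
        (_root_.deriv f (x + w) - (Polynomial.derivative (a.trunc (N + 1))).eval w) w := by
      intro w hw
      refine HasDerivAt.sub ?_ (Polynomial.hasDerivAt _ _)
      exact (hfd w hw).hasDerivAt.comp_const_add x w
    have hbound : ‖_root_.deriv G z‖ ≤ C * (5 / 4 * ‖z‖) ^ (N + 1) / ρ := by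
      refine Complex.norm_deriv_le_of_forall_mem_sphere_norm_le hρ0 ?_ ?_
      · refine DifferentiableOn.diffContOnCl fun w hw => ?_
        have hw' := hcl w (Metric.closure_ball_subset_closedBall hw)
        exact (hGd w (im_pos_of_mem_cone (by positivity) hw'.1)).differentiableAt.differentiableWithinAt
      · intro w hw
        have hw' := hcl w (Metric.sphere_subset_closedBall hw)
        have h8 : ‖G w‖ ≤ C * ‖w ^ (N + 1)‖ := hball ⟨by
          rw [Metric.mem_ball, dist_zero_right]; linarith [hw'.2], hw'.1⟩
        have hC0 : 0 ≤ C := by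
          by_contra hneg
          have : 0 < ‖w ^ (N + 1)‖ := norm_pos_iff.2 (pow_ne_zero _ hw'.1.1)
          nlinarith [norm_nonneg (G w)]
        refine h8.trans (mul_le_mul_of_nonneg_left ?_ hC0)
        rw [norm_pow]
        exact pow_le_pow_left₀ (norm_nonneg _) hw'.2 _
    rw [(hGd z (im_pos_of_mem_cone hη hz2)).deriv] at hbound
    show ‖_ - _‖ ≤ _
    refine hbound.trans (le_of_eq ?_)
    rw [hρ, norm_pow, mul_pow, pow_succ ‖z‖]
    field_simp
  intro η hη
  rcases le_total η 1 with h1 | h1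
  · exact aux η hη h1
  · exact (aux 1 one_pos le_rfl).mono (nhdsWithin_mono _ (cone_mono h1))

/-! ### Partial theta series with bounded coefficients -/

/-- The general term of a partial theta series. -/
def thetaTerm (ν : ℕ) (f : ℤ → ℂ) (M : ℕ) (n : ℕ+) (τ : ℂ) : ℂ :=
  ((n : ℕ) : ℂ) ^ ν * f ((n : ℕ) : ℤ) * cexp (I * Real.pi * ((n : ℕ) : ℂ) ^ 2 * τ / M)

theorem partialTheta_eq_tsum (ν : ℕ) (f : ℤ → ℂ) (M : ℕ) (τ : ℂ) :
    partialTheta ν f M τ = ∑' n : ℕ+, thetaTerm ν f M n τ := rfl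

theorem norm_cexp_theta (M : ℕ) (n : ℕ+) (τ : ℂ) :
    ‖cexp (I * Real.pi * ((n : ℕ) : ℂ) ^ 2 * τ / M)‖ =
      Real.exp (-(Real.pi * ((n : ℕ) : ℝ) ^ 2 * τ.im / M)) := by
  rw [Complex.norm_exp]
  congr 1
  have : I * Real.pi * ((n : ℕ) : ℂ) ^ 2 * τ / M =
      ((Real.pi * ((n : ℕ) : ℝ) ^ 2 / M : ℝ) : ℂ) * (I * τ) := by
    push_cast; ring
  rw [this, Complex.re_ofReal_mul, Complex.I_mul_re]
  ring

theorem summable_one_div_pnat_sq : Summable fun n : ℕ+ => 1 / ((n : ℕ) : ℝ) ^ 2 :=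
  (Real.summable_one_div_nat_pow.2 one_lt_two).comp_injective PNat.coe_injective

/-- The constant in the estimate of `thetaTerm`. -/
def thetaConst (C : ℝ) (M N : ℕ) : ℝ := C * N.factorial * (M / Real.pi) ^ N

theorem thetaConst_nonneg {C : ℝ} (hC : 0 ≤ C) (M N : ℕ) : 0 ≤ thetaConst C M N := by
  have := Real.pi_pos
  unfold thetaConst
  positivity

/-- The inequality e^{-x} ≤ N!/x^N trades exponential decay for any high power of 1/Im τ. The
condition 2N ≥ ν + 2 leaves a summable factor n^{-2}. -/
theorem norm_thetaTerm_le {f : ℤ → ℂ} {C : ℝ} (hC : 0 ≤ C) (hf : ∀ n, ‖f n‖ ≤ C) {M : ℕ}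
    (hM : 0 < M) {ν N : ℕ} (hN : ν + 2 ≤ 2 * N) (n : ℕ+) {τ : ℂ} (hτ : 0 < τ.im) :
    ‖thetaTerm ν f M n τ‖ ≤ thetaConst C M N * (τ.im ^ N)⁻¹ * (1 / ((n : ℕ) : ℝ) ^ 2) := by
  have hπ := Real.pi_pos
  have hM' : (0 : ℝ) < M := by exact_mod_cast hM
  have hn : (1 : ℝ) ≤ (n : ℕ) := by exact_mod_cast n.pos
  have hn0 : (0 : ℝ) < (n : ℕ) := by linarith
  rw [thetaTerm, norm_mul, norm_mul, norm_pow, norm_cexp_theta, Complex.norm_natCast]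
  set x := Real.pi * ((n : ℕ) : ℝ) ^ 2 * τ.im / M with hx
  have hx0 : 0 < x := by positivity
  have h1 : Real.exp (-x) ≤ N.factorial * (x ^ N)⁻¹ := by
    rw [Real.exp_neg, ← div_eq_mul_inv, inv_le_comm₀ (Real.exp_pos _) (by positivity), inv_div]
    exact Real.pow_div_factorial_le_exp x hx0.le N
  have h2 : ((n : ℕ) : ℝ) ^ ν * ((n : ℕ) : ℝ) ^ 2 ≤ (((n : ℕ) : ℝ) ^ 2) ^ N := by
    rw [← pow_add, ← pow_mul]
    exact pow_le_pow_right₀ hn hN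
  calc ((n : ℕ) : ℝ) ^ ν * ‖f (n : ℕ)‖ * Real.exp (-x)
      ≤ ((n : ℕ) : ℝ) ^ ν * C * (N.factorial * (x ^ N)⁻¹) := by
        gcongr; exact hf _
    _ = thetaConst C M N * (τ.im ^ N)⁻¹ *
        (((n : ℕ) : ℝ) ^ ν * ((((n : ℕ) : ℝ) ^ 2) ^ N)⁻¹) := by
        rw [hx, thetaConst, div_pow, div_pow, mul_pow, mul_pow]
        field_simp
    _ ≤ _ := by
        have := thetaConst_nonneg hC M N
        gcongr
        rw [← div_eq_mul_inv, div_le_div_iff₀ (by positivity) (by positivity), one_mul]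
        exact h2

section bounded

variable {f : ℤ → ℂ} {C : ℝ} {M : ℕ}

theorem summable_norm_thetaTerm (hC : 0 ≤ C) (hf : ∀ n, ‖f n‖ ≤ C) (hM : 0 < M) (ν : ℕ) {τ : ℂ}
    (hτ : 0 < τ.im) : Summable fun n => ‖thetaTerm ν f M n τ‖ :=
  (summable_one_div_pnat_sq.mul_left _).of_nonneg_of_le (fun _ => norm_nonneg _) fun n =>
    norm_thetaTerm_le hC hf hM (by omega : ν + 2 ≤ 2 * (ν + 2)) n hτ

theorem norm_partialTheta_le (hC : 0 ≤ C) (hf : ∀ n, ‖f n‖ ≤ C) (hM : 0 < M) {ν N : ℕ}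
    (hN : ν + 2 ≤ 2 * N) :
    ∃ K : ℝ, 0 ≤ K ∧ ∀ τ : ℂ, 0 < τ.im → ‖partialTheta ν f M τ‖ ≤ K * (τ.im ^ N)⁻¹ := by
  refine ⟨thetaConst C M N * ∑' n : ℕ+, 1 / ((n : ℕ) : ℝ) ^ 2,
    mul_nonneg (thetaConst_nonneg hC _ _) (tsum_nonneg fun _ => by positivity), fun τ hτ => ?_⟩
  have h1 := summable_norm_thetaTerm hC hf hM ν hτ
  refine (norm_tsum_le_tsum_norm h1).trans ?_
  refine (h1.tsum_le_tsum (fun n => norm_thetaTerm_le hC hf hM hN n hτ)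
    (summable_one_div_pnat_sq.mul_left _)).trans (le_of_eq ?_)
  rw [tsum_mul_left]
  ring

theorem hasDerivAt_thetaTerm (ν : ℕ) (f : ℤ → ℂ) (M : ℕ) (n : ℕ+) (τ : ℂ) :
    HasDerivAt (thetaTerm ν f M n) (I * Real.pi / M * thetaTerm (ν + 2) f M n τ) τ := by
  have h : HasDerivAt (fun τ : ℂ => I * Real.pi * ((n : ℕ) : ℂ) ^ 2 * τ / M)
      (I * Real.pi * ((n : ℕ) : ℂ) ^ 2 / M) τ := by
    simpa using ((hasDerivAt_id τ).const_mul (I * Real.pi * ((n : ℕ) : ℂ) ^ 2)).div_const (M : ℂ)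
  refine (h.cexp.const_mul (((n : ℕ) : ℂ) ^ ν * f ((n : ℕ) : ℤ))).congr_deriv ?_
  rw [thetaTerm]
  ring

/-- Termwise differentiation, justified by the uniform bound on the half-plane Im z > (Im τ)/2. Each
derivative raises the exponent ν by 2. -/
theorem hasDerivAt_partialTheta (hC : 0 ≤ C) (hf : ∀ n, ‖f n‖ ≤ C) (hM : 0 < M) (ν : ℕ) {τ : ℂ}
    (hτ : 0 < τ.im) :
    HasDerivAt (partialTheta ν f M) (I * Real.pi / M * partialTheta (ν + 2) f M τ) τ := by
  set U : Set ℂ := {z | τ.im / 2 < z.im}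
  have hU : IsOpen U := isOpen_lt continuous_const Complex.continuous_im
  have hτU : τ ∈ U := by show τ.im / 2 < τ.im; linarith
  have hN : ν + 2 ≤ 2 * (ν + 2) := by omega
  set u : ℕ+ → ℝ := fun n =>
    thetaConst C M (ν + 2) * ((τ.im / 2) ^ (ν + 2))⁻¹ * (1 / ((n : ℕ) : ℝ) ^ 2)
  have hu : Summable u := summable_one_div_pnat_sq.mul_left _
  have hd : ∀ n, DifferentiableOn ℂ (thetaTerm ν f M n) U := fun n z _ =>
    (hasDerivAt_thetaTerm ν f M n z).differentiableAt.differentiableWithinAt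
  have hle : ∀ n, ∀ z ∈ U, ‖thetaTerm ν f M n z‖ ≤ u n := by
    intro n z hz
    have hz : τ.im / 2 < z.im := hz
    refine (norm_thetaTerm_le hC hf hM hN n (by linarith)).trans ?_
    have := thetaConst_nonneg hC M (ν + 2)
    simp only [u]
    gcongr
  have h1 := hasSum_deriv_of_summable_norm hu hd hU hle hτU
  have h2 := (differentiableOn_tsum_of_summable_norm hu hd hU hle).differentiableAt
    (hU.mem_nhds hτU)
  have h3 : (fun n => deriv (thetaTerm ν f M n) τ) =
      fun n => I * Real.pi / M * thetaTerm (ν + 2) f M n τ :=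
    funext fun n => (hasDerivAt_thetaTerm ν f M n τ).deriv
  rw [h3] at h1
  have h4 := h2.hasDerivAt
  rw [← h1.tsum_eq, tsum_mul_left] at h4
  exact h4

theorem differentiableOn_partialTheta (hC : 0 ≤ C) (hf : ∀ n, ‖f n‖ ≤ C) (hM : 0 < M) (ν : ℕ) :
    DifferentiableOn ℂ (partialTheta ν f M) {τ | 0 < τ.im} := fun _ hτ =>
  (hasDerivAt_partialTheta hC hf hM ν hτ).differentiableAt.differentiableWithinAt

end bounded

section

open MeasureTheory

/-! ### Integrals along rays -/

/-- A function that decreases rapidly at `0` and at `∞` in all cones. -/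
def RapidDecay (ϑ : ℂ → ℂ) : Prop :=
  ∀ η : ℝ, 0 < η → ∀ N : ℕ, ∃ C : ℝ, ∀ u ∈ cone η, ‖ϑ u‖ ≤ C * ‖u‖ ^ N ∧ ‖ϑ u‖ * ‖u‖ ^ N ≤ C

theorem integrable_of_comp_abs {g : ℝ → ℝ} (hg : IntegrableOn g (Set.Ioi 0)) :
    Integrable fun r => g |r| := by
  have h1 : IntegrableOn (fun r => g |r|) (Set.Ioi 0) :=
    hg.congr_fun (fun r hr => by simp only [abs_of_pos hr.out]) measurableSet_Ioi
  have h2 : IntegrableOn (fun r => g |r|) (Set.Iio 0) := by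
    have h3 := ((Measure.measurePreserving_neg (volume : Measure ℝ)).integrableOn_comp_preimage
      (Homeomorph.neg ℝ).measurableEmbedding (f := fun r => g |r|) (s := Set.Ioi 0)).2 h1
    simpa [Function.comp_def] using h3
  rw [← integrableOn_univ, ← Set.Iic_union_Ioi (a := (0 : ℝ)), integrableOn_union,
    integrableOn_Iic_iff_integrableOn_Iio]
  exact ⟨h2, h1⟩

/-- The dominating function for the integrals along rays. -/
def rayBound (r : ℝ) : ℝ := Real.exp (-|r|) * (1 - Real.exp (-|r|)) ^ (-(1 / 2) : ℝ)

/-- For r > 0 the function is the derivative of 2(1 - e^{-r})^{1/2}; the singularity of order -1/2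
at r = 0 is integrable. -/
theorem integrable_rayBound : Integrable rayBound := by
  refine integrable_of_comp_abs (g := fun r => Real.exp (-r) * (1 - Real.exp (-r)) ^ (-(1 / 2) : ℝ)) ?_
  have hpos : ∀ r : ℝ, 0 < r → 0 < 1 - Real.exp (-r) := fun r hr => by
    rw [sub_pos, Real.exp_lt_one_iff]; linarith
  have h := integrableOn_Ioi_deriv_of_nonneg (a := 0) (l := 2 * (1 - 0) ^ (1 / 2 : ℝ))
    (g := fun r => 2 * (1 - Real.exp (-r)) ^ (1 / 2 : ℝ))
    (g' := fun r => Real.exp (-r) * (1 - Real.exp (-r)) ^ (-(1 / 2) : ℝ)) ?_ ?_ ?_ ?_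
  · exact h
  · refine Continuous.continuousWithinAt ?_
    refine continuous_const.mul (Continuous.rpow_const (by fun_prop) fun _ => Or.inr (by norm_num))
  · intro r hr
    have h1 : HasDerivAt (fun r => 1 - Real.exp (-r)) (Real.exp (-r)) r := by
      simpa using ((hasDerivAt_neg r).exp).const_sub 1
    refine ((h1.rpow_const (p := 1 / 2) (Or.inl (hpos r hr).ne')).const_mul 2).congr_deriv ?_
    norm_num
    ring
  · intro r hr
    have := hpos r hr
    positivity
  · refine Tendsto.const_mul 2 (Tendsto.rpow_const ?_ (Or.inl (by norm_num)))
    exact tendsto_const_nhds.sub (Real.tendsto_exp_neg_atTop_nhds_zero)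

theorem integrable_exp_neg_abs : Integrable fun r : ℝ => Real.exp (-|r|) :=
  integrable_of_comp_abs (g := fun r => Real.exp (-r)) (integrableOn_exp_neg_Ioi 0)

theorem tendsto_rayBound {l : Filter ℝ} (hl : Tendsto (fun r : ℝ => |r|) l atTop) :
    Tendsto rayBound l (𝓝 0) := by
  have h1 : Tendsto (fun r : ℝ => Real.exp (-|r|)) l (𝓝 0) :=
    Real.tendsto_exp_neg_atTop_nhds_zero.comp hl
  have h2 := h1.mul (((tendsto_const_nhds (x := (1 : ℝ))).sub h1).rpow_const
    (p := (-(1 / 2) : ℝ)) (Or.inl (by norm_num)))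
  rw [zero_mul] at h2
  exact h2

/-- The integrand of the ray integrals in the logarithmic coordinate `w = log z`. -/
def rayKernel (ϑ : ℂ → ℂ) (u w : ℂ) : ℂ :=
  ϑ (cexp w) * cexp (w / 2) * (1 - u * cexp (-w)) ^ (((-(1 / 2) : ℝ)) : ℂ)

/-- The integral of `ϑ(z) (z - u)^{-1/2}` over the ray of all `z` with argument `φ`. -/
def rayIntegral (ϑ : ℂ → ℂ) (φ : ℝ) (u : ℂ) : ℂ := ∫ t : ℝ, rayKernel ϑ u (t + φ * I)

theorem norm_cexp_add_mul_I (t φ : ℝ) : ‖cexp (t + φ * I)‖ = Real.exp t := by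
  simp [Complex.norm_exp]

theorem cexp_im_add_mul_I (t φ : ℝ) : (cexp (t + φ * I)).im = Real.exp t * Real.sin φ := by
  simp [Complex.exp_im]

theorem sin_le_sin_of_mem {ε φ : ℝ} (hε : 0 < ε) (h1 : ε ≤ φ) (h2 : φ ≤ Real.pi - ε) :
    Real.sin ε ≤ Real.sin φ := by
  rcases le_total φ (Real.pi / 2) with h3 | h3
  · exact Real.sin_le_sin_of_le_of_le_pi_div_two (by linarith [Real.pi_pos]) h3 h1
  · rw [← Real.sin_pi_sub φ]
    exact Real.sin_le_sin_of_le_of_le_pi_div_two (by linarith [Real.pi_pos]) (by linarith)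
      (by linarith)

/-- The points with argument in `[ε, π - ε]` lie in a cone. -/
theorem cexp_mem_cone {ε φ : ℝ} (hε : 0 < ε) (h1 : ε ≤ φ) (h2 : φ ≤ Real.pi - ε) (t : ℝ) :
    cexp (t + φ * I) ∈ cone (Real.sin ε) := by
  refine ⟨Complex.exp_ne_zero _, ?_⟩
  rw [norm_cexp_add_mul_I, cexp_im_add_mul_I, mul_comm]
  exact mul_le_mul_of_nonneg_left (sin_le_sin_of_mem hε h1 h2) (Real.exp_pos _).le

/-- Decay of order n + 2 at both ends absorbs e^{t/2} and e^{-nt} and still leaves e^{-|t|}. The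
factor e^{-nt} stands for |z|^{-n}, which occurs in derivatives and moments of ray integrals. -/
theorem RapidDecay.exists_bound {ϑ : ℂ → ℂ} (hr : RapidDecay ϑ) {ε : ℝ} (hε : 0 < ε)
    (hε' : ε < Real.pi) (n : ℕ) : ∃ C : ℝ, 0 ≤ C ∧ ∀ t φ : ℝ, ε ≤ φ → φ ≤ Real.pi - ε →
      ‖ϑ (cexp (t + φ * I))‖ * Real.exp (t / 2) * Real.exp (-(n * t)) ≤ C * Real.exp (-|t|) := by
  obtain ⟨C, hC⟩ := hr (Real.sin ε) (Real.sin_pos_of_pos_of_lt_pi hε hε') (n + 2)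
  refine ⟨max C 0, le_max_right _ _, fun t φ h1 h2 => ?_⟩
  obtain ⟨h3, h4⟩ := hC _ (cexp_mem_cone hε h1 h2 t)
  rw [norm_cexp_add_mul_I, ← Real.exp_nat_mul] at h3 h4
  set a := ‖ϑ (cexp (t + φ * I))‖
  have ha : 0 ≤ a := norm_nonneg _
  push_cast at h3 h4
  rw [mul_assoc, ← Real.exp_add]
  have hn : (0 : ℝ) ≤ n := Nat.cast_nonneg n
  rcases le_total 0 t with ht | ht
  · have h5 : a ≤ max C 0 * Real.exp (-((n + 2) * t)) := by
      rw [Real.exp_neg, ← div_eq_mul_inv, le_div_iff₀ (Real.exp_pos _)]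
      exact h4.trans (le_max_left _ _)
    refine (mul_le_mul_of_nonneg_right h5 (Real.exp_pos _).le).trans ?_
    rw [mul_assoc, ← Real.exp_add, abs_of_nonneg ht]
    refine mul_le_mul_of_nonneg_left (Real.exp_le_exp.2 ?_) (le_max_right _ _)
    nlinarith [mul_nonneg hn ht]
  · have h5 : a ≤ max C 0 * Real.exp ((n + 2) * t) :=
      h3.trans (mul_le_mul_of_nonneg_right (le_max_left _ _) (Real.exp_pos _).le)
    refine (mul_le_mul_of_nonneg_right h5 (Real.exp_pos _).le).trans ?_
    rw [mul_assoc, ← Real.exp_add, abs_of_nonpos ht]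
    refine mul_le_mul_of_nonneg_left (Real.exp_le_exp.2 ?_) (le_max_right _ _)
    linarith

theorem norm_rayKernel (ϑ : ℂ → ℂ) (u : ℂ) (t φ : ℝ) :
    ‖rayKernel ϑ u (t + φ * I)‖ = ‖ϑ (cexp (t + φ * I))‖ * Real.exp (t / 2) *
      ‖1 - u * cexp (-(t + φ * I))‖ ^ (-(1 / 2) : ℝ) := by
  rw [rayKernel, norm_mul, norm_mul, Complex.norm_cpow_real]
  congr 2
  rw [Complex.norm_exp]
  simp

theorem norm_mul_cexp_neg {u : ℂ} (hu : u ≠ 0) (t φ : ℝ) :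
    ‖u * cexp (-(t + φ * I))‖ = Real.exp (-(t - Real.log ‖u‖)) := by
  rw [norm_mul, Complex.norm_exp, neg_sub, Real.exp_sub, Real.exp_log (norm_pos_iff.2 hu)]
  simp [Real.exp_neg, div_eq_mul_inv]

/-- Together with |1 - ω| ≥ |1 - |ω||, for |ω| = e^{-r}, this bounds the distance to the branch
point from below whatever the argument of ω is. -/
theorem one_sub_exp_neg_abs_le (r : ℝ) : 1 - Real.exp (-|r|) ≤ |1 - Real.exp (-r)| := by
  rcases le_total 0 r with h | h
  · rw [abs_of_nonneg h]; exact le_abs_self _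
  · rw [abs_of_nonpos h, neg_neg, abs_sub_comm]
    refine le_trans ?_ (le_abs_self _)
    have h1 : Real.exp r * Real.exp (-r) = 1 := by rw [← Real.exp_add]; simp
    nlinarith [sq_nonneg (Real.exp r - 1), sq_nonneg (Real.exp (-r) - 1), Real.exp_pos r,
      Real.exp_pos (-r), sq_nonneg (Real.exp r - Real.exp (-r))]

/-- Uniform bound of the integrand, valid off the singular point. -/
theorem exists_norm_rayKernel_le {ϑ : ℂ → ℂ} (hr : RapidDecay ϑ) {ε : ℝ} (hε : 0 < ε)
    (hε' : ε < Real.pi) {u : ℂ} (hu : u ≠ 0) : ∃ C : ℝ, 0 ≤ C ∧ ∀ t φ : ℝ, t ≠ Real.log ‖u‖ →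
      ε ≤ φ → φ ≤ Real.pi - ε →
      ‖rayKernel ϑ u (t + φ * I)‖ ≤ C * rayBound (t - Real.log ‖u‖) := by
  obtain ⟨C, hC0, hC⟩ := hr.exists_bound hε hε' 0
  -- The extra factor pays for recentring e^{-|t|} at t = log|u|.
  refine ⟨C * Real.exp |Real.log ‖u‖|, by positivity, fun t φ ht h1 h2 => ?_⟩
  have h3 := hC t φ h1 h2
  simp only [Nat.cast_zero, zero_mul, neg_zero, Real.exp_zero, mul_one] at h3
  set r := t - Real.log ‖u‖ with hrdef
  have hr0 : r ≠ 0 := sub_ne_zero.2 ht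
  have h4 : 0 < 1 - Real.exp (-|r|) := by
    rw [sub_pos, Real.exp_lt_one_iff]; simp [hr0]
  have h5 : 1 - Real.exp (-|r|) ≤ ‖1 - u * cexp (-(t + φ * I))‖ := by
    refine (one_sub_exp_neg_abs_le r).trans ?_
    have := abs_norm_sub_norm_le (1 : ℂ) (u * cexp (-(t + φ * I)))
    rwa [norm_one, norm_mul_cexp_neg hu] at this
  rw [norm_rayKernel]
  refine (mul_le_mul h3 (Real.rpow_le_rpow_of_nonpos h4 h5 (by norm_num)) (by positivity)
    (by positivity)).trans ?_
  rw [rayBound, mul_assoc, mul_assoc, ← mul_assoc (Real.exp |Real.log ‖u‖|), ← Real.exp_add]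
  have : -|t| ≤ |Real.log ‖u‖| + -|r| := by
    have := abs_sub_abs_le_abs_sub t r
    have h6 : |r| ≤ |t| + |Real.log ‖u‖| := abs_sub _ _
    linarith
  gcongr

theorem im_mul_cexp_neg {u : ℂ} (hu : u ≠ 0) (t φ : ℝ) :
    (u * cexp (-(t + φ * I))).im =
      Real.exp (-(t - Real.log ‖u‖)) * Real.sin (u.arg - φ) := by
  have h : u * cexp (-(t + φ * I)) =
      cexp (((-(t - Real.log ‖u‖) : ℝ) : ℂ) + ((u.arg - φ : ℝ) : ℂ) * I) := by
    conv_lhs => rw [← Complex.exp_log hu, ← Complex.exp_add]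
    rw [Complex.log]
    congr 1
    push_cast
    ring
  rw [h, cexp_im_add_mul_I]

theorem differentiableOn_rayKernel {ϑ : ℂ → ℂ} (hd : DifferentiableOn ℂ ϑ {z | 0 < z.im}) (u : ℂ)
    {w : ℂ} (h0 : 0 < w.im) (hπ : w.im < Real.pi)
    (hw : 1 - u * cexp (-w) ∈ slitPlane) : DifferentiableAt ℂ (rayKernel ϑ u) w := by
  have h1 : 0 < (cexp w).im := by
    rw [Complex.exp_im]
    exact mul_pos (Real.exp_pos _) (Real.sin_pos_of_pos_of_lt_pi h0 hπ)
  have h2 : DifferentiableAt ℂ ϑ (cexp w) :=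
    (hd _ h1).differentiableAt ((isOpen_lt continuous_const Complex.continuous_im).mem_nhds h1)
  have h3 : DifferentiableAt ℂ (fun w => ϑ (cexp w)) w := h2.comp w Complex.differentiableAt_exp
  unfold rayKernel
  refine (h3.mul (by fun_prop)).mul (DifferentiableAt.cpow_const (by fun_prop) hw)

/-- Shifting the line of integration inside a horizontal strip. -/
theorem integral_horizontal_eq {f : ℂ → ℂ} {φ₁ φ₂ : ℝ} (h12 : φ₁ ≤ φ₂)
    (hf : ∀ w : ℂ, φ₁ ≤ w.im → w.im ≤ φ₂ → DifferentiableAt ℂ f w) {β : ℝ → ℝ}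
    (hβ : Integrable β) (hb : ∀ᶠ t : ℝ in cofinite, ∀ φ ∈ Set.Icc φ₁ φ₂, ‖f (t + φ * I)‖ ≤ β t)
    (h0 : ∀ l : Filter ℝ, Tendsto (fun r : ℝ => |r|) l atTop → Tendsto β l (𝓝 0)) :
    ∫ t : ℝ, f (t + φ₁ * I) = ∫ t : ℝ, f (t + φ₂ * I) := by
  have hint : ∀ φ ∈ Set.Icc φ₁ φ₂, Integrable fun t : ℝ => f (t + φ * I) := by
    intro φ hφ
    refine hβ.mono' (Continuous.aestronglyMeasurable ?_) ?_
    · rw [continuous_iff_continuousAt]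
      intro t
      have h1 : ContinuousAt f (t + φ * I) :=
        (hf _ (by simpa using hφ.1) (by simpa using hφ.2)).continuousAt
      exact ContinuousAt.comp (f := fun t : ℝ => (t : ℂ) + φ * I) h1 (by fun_prop)
    · have : cofinite ≥ ae (volume : Measure ℝ) := by
        rw [ge_iff_le, Filter.le_cofinite_iff_compl_singleton_mem]
        intro x
        exact compl_mem_ae_iff.2 (by simp)
      filter_upwards [this hb] with t ht using ht φ hφ
  -- The vertical sides of the rectangle, right for σ = 1 and left for σ = -1, contribute nothing in
  -- the limit. The bound may fail at finitely many t, which large T avoids.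
  have hvert : ∀ σ : ℝ, |σ| = 1 → Tendsto (fun T : ℝ => ∫ y in φ₁..φ₂, f (((σ * T : ℝ) : ℂ) + y * I))
      atTop (𝓝 0) := by
    intro σ hσ
    have ht : Tendsto (fun T : ℝ => |σ * T|) atTop atTop := by
      simp only [abs_mul, hσ, one_mul]
      exact tendsto_abs_atTop_atTop
    have h1 : Tendsto (fun T : ℝ => β (σ * T)) atTop (𝓝 0) :=
      (h0 (map (fun T => σ * T) atTop) (by simpa [tendsto_map'_iff, Function.comp_def] using ht)).comp
        tendsto_map
    have h2 : Tendsto (fun T : ℝ => β (σ * T) * |φ₂ - φ₁|) atTop (𝓝 0) := by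
      simpa using h1.mul_const |φ₂ - φ₁|
    refine squeeze_zero_norm' ?_ h2
    have hσ0 : σ ≠ 0 := by rintro rfl; simp at hσ
    have h3 : Tendsto (fun T : ℝ => σ * T) atTop cofinite :=
      (mul_right_injective₀ hσ0).tendsto_cofinite.mono_left atTop_le_cofinite
    filter_upwards [h3.eventually hb] with T hT
    refine intervalIntegral.norm_integral_le_of_norm_le_const fun y hy => ?_
    rw [Set.uIoc_of_le h12] at hy
    exact hT y ⟨hy.1.le, hy.2⟩
  have key : ∀ T : ℝ, (∫ x in (-T)..T, f (x + φ₁ * I)) - (∫ x in (-T)..T, f (x + φ₂ * I)) =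
      I * (∫ y in φ₁..φ₂, f (((-1 * T : ℝ) : ℂ) + y * I)) -
        I * ∫ y in φ₁..φ₂, f (((1 * T : ℝ) : ℂ) + y * I) := by
    intro T
    have h := integral_boundary_rect_eq_zero_of_differentiableOn f (-T + φ₁ * I) (T + φ₂ * I) ?_
    · simp only [add_re, neg_re, ofReal_re, mul_re, I_re, mul_zero, ofReal_im, I_im, mul_one,
        sub_self, add_zero, add_im, neg_im, neg_zero, mul_im, zero_add, smul_eq_mul] at h
      rw [neg_one_mul, one_mul]
      linear_combination h
    · intro w hw
      have hw2 := hw.2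
      simp only [add_re, neg_re, ofReal_re, mul_re, I_re, mul_zero, ofReal_im, I_im, mul_one,
        sub_self, add_zero, add_im, neg_im, neg_zero, mul_im, zero_add, smul_eq_mul,
        Set.uIcc_of_le h12] at hw2
      exact (hf w hw2.1 hw2.2).differentiableWithinAt
  have h1 := (intervalIntegral_tendsto_integral (hint φ₁ ⟨le_rfl, h12⟩) tendsto_neg_atTop_atBot
    tendsto_id).sub (intervalIntegral_tendsto_integral (hint φ₂ ⟨h12, le_rfl⟩)
      tendsto_neg_atTop_atBot tendsto_id)
  have h2 := ((hvert (-1) (by simp)).const_mul I).sub ((hvert 1 (by simp)).const_mul I)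
  simp only [id] at h1
  simp only [← key, mul_zero, sub_zero] at h2
  exact sub_eq_zero.1 (tendsto_nhds_unique h1 h2)

end

/-! ### The jump of a ray integral across the point u -/

section

open MeasureTheory

theorem cofinite_ge_ae_real : ae (volume : Measure ℝ) ≤ cofinite := by
  rw [Filter.le_cofinite_iff_compl_singleton_mem]
  intro x
  exact compl_mem_ae_iff.2 (by simp)

/-- For Im z < 0 one has arg(-z) = arg z + π, so the principal roots differ by e^{iπ/2}. With the
opposite sign in the upper half-plane, this is the source of the jump of the ray integral. -/
theorem cpow_neg_half_of_im_neg {z : ℂ} (hz : z.im < 0) :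
    z ^ (((-(1 / 2) : ℝ)) : ℂ) = I * (-z) ^ (((-(1 / 2) : ℝ)) : ℂ) := by
  have h0 : z ≠ 0 := by rintro rfl; simp at hz
  have hI : (I : ℂ) = cexp (Real.pi / 2 * I) := Complex.exp_pi_div_two_mul_I.symm
  rw [Complex.cpow_def_of_ne_zero h0, Complex.cpow_def_of_ne_zero (neg_ne_zero.2 h0)]
  nth_rw 1 [hI]
  rw [← Complex.exp_add, Complex.log, Complex.log, norm_neg, arg_neg_eq_arg_add_pi_of_im_neg hz]
  congr 1
  push_cast
  ring

theorem cpow_neg_half_of_im_pos {z : ℂ} (hz : 0 < z.im) :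
    z ^ (((-(1 / 2) : ℝ)) : ℂ) = -I * (-z) ^ (((-(1 / 2) : ℝ)) : ℂ) := by
  have h := cpow_neg_half_of_im_neg (z := -z) (by simpa using hz)
  rw [neg_neg] at h
  rw [h, ← mul_assoc, neg_mul, I_mul_I, neg_neg, one_mul]

section ray

variable {ϑ : ℂ → ℂ} {u : ℂ}

/-- The imaginary part of 1 - u/z has the sign of -sin(arg u - φ). Hence 1 - u/z meets the branch
cut only when the ray passes through u, and the side of u on which the ray lies decides the sign of
the root. -/
theorem im_ne_zero_of_arg_ne (hu : 0 < u.im) {φ : ℝ} (h0 : 0 < φ) (hπ : φ < Real.pi) (t : ℝ) :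
    (φ < u.arg → (1 - u * cexp (-(t + φ * I))).im < 0) ∧
      (u.arg < φ → 0 < (1 - u * cexp (-(t + φ * I))).im) := by
  have hu0 : u ≠ 0 := by rintro rfl; simp at hu
  have ha0 : 0 ≤ u.arg := Complex.arg_nonneg_iff.2 hu.le
  have haπ : u.arg ≤ Real.pi := Complex.arg_le_pi u
  rw [sub_im, one_im, im_mul_cexp_neg hu0, zero_sub]
  refine ⟨fun h => neg_neg_of_pos ?_, fun h => neg_pos_of_neg ?_⟩
  · exact mul_pos (Real.exp_pos _) (Real.sin_pos_of_pos_of_lt_pi (by linarith) (by linarith))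
  · exact mul_neg_of_pos_of_neg (Real.exp_pos _)
      (Real.sin_neg_of_neg_of_neg_pi_lt (by linarith) (by linarith))

theorem mem_slitPlane_of_arg_ne (hu : 0 < u.im) {φ : ℝ} (h0 : 0 < φ) (hπ : φ < Real.pi)
    (hφ : φ ≠ u.arg) (t : ℝ) : 1 - u * cexp (-(t + φ * I)) ∈ slitPlane := by
  have h := im_ne_zero_of_arg_ne hu h0 hπ t
  rcases lt_or_gt_of_ne hφ with h1 | h1
  · exact Or.inr (h.1 h1).ne
  · exact Or.inr (h.2 h1).ne'

theorem continuous_rayKernel (hd : DifferentiableOn ℂ ϑ {z | 0 < z.im}) {φ : ℝ} (h0 : 0 < φ)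
    (hπ : φ < Real.pi) (h : ∀ t : ℝ, 1 - u * cexp (-(t + φ * I)) ∈ slitPlane) :
    Continuous fun t : ℝ => rayKernel ϑ u (t + φ * I) := by
  rw [continuous_iff_continuousAt]
  intro t
  have h1 : ContinuousAt (rayKernel ϑ u) (t + φ * I) :=
    (differentiableOn_rayKernel hd u (by simpa using h0) (by simpa using hπ) (h t)).continuousAt
  exact ContinuousAt.comp (f := fun t : ℝ => (t : ℂ) + φ * I) h1 (by fun_prop)

theorem integrable_rayKernel (hd : DifferentiableOn ℂ ϑ {z | 0 < z.im}) (hr : RapidDecay ϑ)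
    (hu : 0 < u.im) {φ : ℝ} (h0 : 0 < φ) (hπ : φ < Real.pi) (hφ : φ ≠ u.arg) :
    Integrable fun t : ℝ => rayKernel ϑ u (t + φ * I) := by
  have hu0 : u ≠ 0 := by rintro rfl; simp at hu
  have hε : 0 < min φ (Real.pi - φ) := lt_min h0 (by linarith)
  obtain ⟨C, -, hC⟩ := exists_norm_rayKernel_le hr hε ((min_le_left _ _).trans_lt hπ) hu0
  refine ((integrable_rayBound.comp_sub_right (Real.log ‖u‖)).const_mul C).mono'
    (continuous_rayKernel hd h0 hπ (mem_slitPlane_of_arg_ne hu h0 hπ hφ)).aestronglyMeasurable ?_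
  filter_upwards [cofinite_ge_ae_real (Set.Finite.compl_mem_cofinite
    (Set.finite_singleton (Real.log ‖u‖)))] with t ht
  exact hC t φ ht (min_le_left _ _) (by linarith [min_le_right φ (Real.pi - φ)])

/-- The integral along a ray does not change when the ray moves without crossing `u`. -/
theorem rayIntegral_eq (hd : DifferentiableOn ℂ ϑ {z | 0 < z.im}) (hr : RapidDecay ϑ)
    (hu : 0 < u.im) {φ₁ φ₂ : ℝ} (h1 : 0 < φ₁) (h12 : φ₁ ≤ φ₂) (h2 : φ₂ < Real.pi)
    (h : φ₂ < u.arg ∨ u.arg < φ₁) : rayIntegral ϑ φ₁ u = rayIntegral ϑ φ₂ u := by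
  have hu0 : u ≠ 0 := by rintro rfl; simp at hu
  have hε : 0 < min φ₁ (Real.pi - φ₂) := lt_min h1 (by linarith)
  obtain ⟨C, -, hC⟩ := exists_norm_rayKernel_le hr hε ((min_le_left _ _).trans_lt
    (h12.trans_lt h2)) hu0
  refine integral_horizontal_eq h12 (fun w hw1 hw2 => ?_)
    ((integrable_rayBound.comp_sub_right (Real.log ‖u‖)).const_mul C) ?_ ?_
  · refine differentiableOn_rayKernel hd u (by linarith) (by linarith) ?_
    have := mem_slitPlane_of_arg_ne hu (φ := w.im) (by linarith) (by linarith)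
      (by rcases h with h | h <;> [exact (hw2.trans_lt h).ne; exact (h.trans_le hw1).ne']) w.re
    rwa [Complex.re_add_im] at this
  · filter_upwards [Set.Finite.compl_mem_cofinite (Set.finite_singleton (Real.log ‖u‖))] with t ht
    intro φ hφ
    exact hC t φ ht ((min_le_left _ _).trans hφ.1)
      (by linarith [min_le_right φ₁ (Real.pi - φ₂), hφ.2])
  · intro l hl
    have h3 : Tendsto (fun r : ℝ => rayBound (r - Real.log ‖u‖)) l (𝓝 0) := by
      have h4 : Tendsto (fun r : ℝ => |r|) (map (fun r => r - Real.log ‖u‖) l) atTop := by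
        rw [tendsto_map'_iff]
        refine tendsto_atTop_mono (fun r => ?_) (tendsto_atTop_add_const_right l
          (-|Real.log ‖u‖|) hl)
        simpa [sub_eq_add_neg] using abs_sub_abs_le_abs_sub r (Real.log ‖u‖)
      exact (tendsto_rayBound h4).comp tendsto_map
    simpa using h3.const_mul C

/-- The integrand on the inner part of the ray through `u`. -/
def innerKernel (ϑ : ℂ → ℂ) (u w : ℂ) : ℂ :=
  ϑ (cexp w) * cexp (w / 2) * (u * cexp (-w) - 1) ^ (((-(1 / 2) : ℝ)) : ℂ)

theorem continuousAt_innerKernel (hd : DifferentiableOn ℂ ϑ {z | 0 < z.im}) (u : ℂ)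
    {w : ℂ} (h0 : 0 < w.im) (hπ : w.im < Real.pi)
    (hw : u * cexp (-w) - 1 ∈ slitPlane) : ContinuousAt (innerKernel ϑ u) w := by
  have h1 : 0 < (cexp w).im := by
    rw [Complex.exp_im]
    exact mul_pos (Real.exp_pos _) (Real.sin_pos_of_pos_of_lt_pi h0 hπ)
  have h2 : ContinuousAt ϑ (cexp w) :=
    ((hd _ h1).differentiableAt
      ((isOpen_lt continuous_const Complex.continuous_im).mem_nhds h1)).continuousAt
  have h3 : ContinuousAt (fun w => ϑ (cexp w)) w :=
    ContinuousAt.comp h2 Complex.continuous_exp.continuousAt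
  unfold innerKernel
  exact (h3.mul (by fun_prop)).mul
    (ContinuousAt.cpow (by fun_prop) continuousAt_const hw)

theorem mul_cexp_neg_eq (hu : u ≠ 0) (t φ : ℝ) : u * cexp (-(t + φ * I)) =
    cexp (((-(t - Real.log ‖u‖) : ℝ) : ℂ) + ((u.arg - φ : ℝ) : ℂ) * I) := by
  conv_lhs => rw [← Complex.exp_log hu, ← Complex.exp_add]
  rw [Complex.log]
  congr 1
  push_cast
  ring

theorem mul_cexp_neg_arg (hu : u ≠ 0) (t : ℝ) :
    u * cexp (-(t + u.arg * I)) = ((Real.exp (-(t - Real.log ‖u‖)) : ℝ) : ℂ) := by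
  rw [mul_cexp_neg_eq hu, sub_self, ofReal_zero, zero_mul, add_zero, ofReal_exp]

/-- Dominated convergence as the ray turns onto the one through u from one side. Beyond u the kernel
is continuous. Between 0 and u the number 1 - u/z tends to the branch cut, so the kernel is first
rewritten with u/z - 1 at the cost of the factor σ, which will be i or -i. -/
theorem tendsto_rayIntegral (hd : DifferentiableOn ℂ ϑ {z | 0 < z.im}) (hr : RapidDecay ϑ)
    (hu : 0 < u.im) {l : Filter ℝ} [l.IsCountablyGenerated] (hl : l ≤ 𝓝 u.arg) (σ : ℂ)
    (hσ : ∀ᶠ φ : ℝ in l, ∀ t : ℝ, rayKernel ϑ u (t + φ * I) = σ * innerKernel ϑ u (t + φ * I))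
    (hne : ∀ᶠ φ in l, φ ≠ u.arg) :
    Tendsto (fun φ => rayIntegral ϑ φ u) l
      (𝓝 ((∫ t in Set.Ioi (Real.log ‖u‖), rayKernel ϑ u (t + u.arg * I)) +
        σ * ∫ t in Set.Iio (Real.log ‖u‖), innerKernel ϑ u (t + u.arg * I))) := by
  have hu0 : u ≠ 0 := by rintro rfl; simp at hu
  have ha0 : 0 < u.arg := lt_of_le_of_ne (Complex.arg_nonneg_iff.2 hu.le) fun h => by
    rw [eq_comm, Complex.arg_eq_zero_iff] at h; exact hu.ne' h.2
  have haπ : u.arg < Real.pi := lt_of_le_of_ne (Complex.arg_le_pi u) fun h => by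
    rw [Complex.arg_eq_pi_iff] at h; exact hu.ne' h.2
  set θ := u.arg with hθ
  set R := Real.log ‖u‖ with hR
  set ε := min (θ / 2) ((Real.pi - θ) / 2) with hεdef
  have hε : 0 < ε := lt_min (by linarith) (by linarith)
  have hε1 : ε ≤ θ / 2 := min_le_left _ _
  have hε2 : ε ≤ (Real.pi - θ) / 2 := min_le_right _ _
  obtain ⟨C, -, hC⟩ := exists_norm_rayKernel_le hr hε (by linarith) hu0
  have hmem : ∀ᶠ φ in l, ε < φ ∧ φ < Real.pi - ε := by
    refine hl (Ioo_mem_nhds ?_ ?_) <;> linarith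
  have hdom : ∀ (S : Set ℝ) (G : ℝ → ℂ), (∀ t ∈ S, t ≠ R →
      Tendsto (fun φ : ℝ => rayKernel ϑ u (t + φ * I)) l (𝓝 (G t))) → MeasurableSet S →
      Tendsto (fun φ : ℝ => ∫ t in S, rayKernel ϑ u (t + φ * I)) l (𝓝 (∫ t in S, G t)) := by
    intro S G hG hS
    have hae : ∀ᵐ t ∂(volume.restrict S), t ≠ R :=
      ae_restrict_of_ae (cofinite_ge_ae_real (Set.Finite.compl_mem_cofinite
        (Set.finite_singleton R)))
    refine tendsto_integral_filter_of_dominated_convergence (fun t => C * rayBound (t - R))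
      ?_ ?_ ((integrable_rayBound.comp_sub_right R).const_mul C).integrableOn ?_
    · filter_upwards [hmem, hne] with φ h1 h2
      exact (integrable_rayKernel hd hr hu (by linarith) (by linarith)
        h2).aestronglyMeasurable.restrict
    · filter_upwards [hmem] with φ h1
      filter_upwards [hae] with t ht
      exact hC t φ ht h1.1.le h1.2.le
    · filter_upwards [hae, ae_restrict_mem hS] with t ht htS
      exact hG t htS ht
  have hpath : ∀ t : ℝ, Tendsto (fun φ : ℝ => (t : ℂ) + φ * I) l (𝓝 (t + θ * I)) := by
    intro t
    have : Continuous fun φ : ℝ => (t : ℂ) + φ * I := by fun_prop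
    exact (this.tendsto θ).mono_left hl
  have h1 := hdom (Set.Ioi R) (fun t => rayKernel ϑ u (t + θ * I)) (fun t ht _ => by
    refine (differentiableOn_rayKernel hd u (by simpa using ha0) (by simpa using haπ)
      ?_).continuousAt.tendsto.comp (hpath t)
    rw [mul_cexp_neg_arg hu0]
    refine Or.inl ?_
    rw [← ofReal_one, ← ofReal_sub, ofReal_re, sub_pos, Real.exp_lt_one_iff]
    linarith [ht.out]) measurableSet_Ioi
  have h2 := hdom (Set.Iic R) (fun t => σ * innerKernel ϑ u (t + θ * I)) (fun t ht htR => by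
    have h1 : Tendsto (fun φ : ℝ => σ * innerKernel ϑ u (t + φ * I)) l
        (𝓝 (σ * innerKernel ϑ u (t + θ * I))) := by
      refine ((continuousAt_innerKernel hd u (by simpa using ha0) (by simpa using haπ)
        ?_).tendsto.comp (hpath t)).const_mul σ
      rw [mul_cexp_neg_arg hu0]
      refine Or.inl ?_
      rw [← ofReal_one, ← ofReal_sub, ofReal_re, sub_pos, Real.one_lt_exp_iff]
      linarith [lt_of_le_of_ne ht.out htR]
    refine h1.congr' ?_
    filter_upwards [hσ] with φ hφ
    exact (hφ t).symm) measurableSet_Iic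
  rw [integral_Iic_eq_integral_Iio (f := fun t : ℝ => σ * innerKernel ϑ u (t + θ * I)),
    integral_const_mul] at h2
  refine (h1.add h2).congr' ?_
  filter_upwards [hmem, hne] with φ h3 h4
  have h5 := integral_add_compl (measurableSet_Ioi (a := R))
    (integrable_rayKernel hd hr hu (φ := φ) (by linarith) (by linarith) h4)
  rw [Set.compl_Ioi] at h5
  exact h5

/-- The part of the ray integral beyond `u`. -/
def outerIntegral (ϑ : ℂ → ℂ) (u : ℂ) : ℂ :=
  cexp (Complex.log u / 2) * ∫ x : ℝ in Set.Ioi 0, 2 * ϑ (u * ((1 + x ^ 2 : ℝ) : ℂ))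

/-- The part of the ray integral between `0` and `u`. -/
def innerIntegral (ϑ : ℂ → ℂ) (u : ℂ) : ℂ :=
  cexp (Complex.log u / 2) * ∫ x : ℝ in Set.Ioi 0,
    ((2 / ((1 + x ^ 2) * √(1 + x ^ 2)) : ℝ) : ℂ) * ϑ (u / ((1 + x ^ 2 : ℝ) : ℂ))

theorem hasDerivAt_log_one_add_sq (x : ℝ) :
    HasDerivAt (fun x : ℝ => Real.log (1 + x ^ 2)) (2 * x / (1 + x ^ 2)) x := by
  have h : HasDerivAt (fun x : ℝ => 1 + x ^ 2) (2 * x) x := by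
    simpa using (hasDerivAt_pow 2 x).const_add 1
  exact h.log (by positivity)

theorem cexp_half_log_one_add_sq (x : ℝ) :
    cexp (((Real.log (1 + x ^ 2) : ℝ) : ℂ) / 2) = ((√(1 + x ^ 2) : ℝ) : ℂ) := by
  have h : (0 : ℝ) < 1 + x ^ 2 := by positivity
  rw [Real.sqrt_eq_rpow, Real.rpow_def_of_pos h, ofReal_exp]
  congr 1
  push_cast
  ring

theorem log_one_add_sq_image_add (R : ℝ) :
    (fun x : ℝ => R + Real.log (1 + x ^ 2)) '' Set.Ioi 0 = Set.Ioi R := by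
  ext y
  simp only [Set.mem_image, Set.mem_Ioi]
  constructor
  · rintro ⟨x, hx, rfl⟩
    have : 0 < Real.log (1 + x ^ 2) := Real.log_pos (by nlinarith)
    linarith
  · intro hy
    have h1 : 1 < Real.exp (y - R) := Real.one_lt_exp_iff.2 (by linarith)
    refine ⟨√(Real.exp (y - R) - 1), Real.sqrt_pos.2 (by linarith), ?_⟩
    rw [Real.sq_sqrt (by linarith), add_sub_cancel, Real.log_exp]
    ring

theorem log_one_add_sq_image_sub (R : ℝ) :
    (fun x : ℝ => R - Real.log (1 + x ^ 2)) '' Set.Ioi 0 = Set.Iio R := by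
  ext y
  have h := Set.ext_iff.1 (log_one_add_sq_image_add R) (2 * R - y)
  simp only [Set.mem_image, Set.mem_Ioi, Set.mem_Iio] at h ⊢
  rw [show y < R ↔ R < 2 * R - y by constructor <;> intro <;> linarith, ← h]
  refine exists_congr fun x => and_congr_right fun _ => ?_
  constructor <;> intro <;> linarith

theorem injOn_log_one_add_sq : Set.InjOn (fun x : ℝ => Real.log (1 + x ^ 2)) (Set.Ioi 0) := by
  intro x hx y hy h
  have h1 := Real.log_injOn_pos (show (0 : ℝ) < 1 + x ^ 2 by positivity)
    (show (0 : ℝ) < 1 + y ^ 2 by positivity) h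
  have h2 : x ^ 2 = y ^ 2 := by linarith
  exact (sq_eq_sq₀ hx.out.le hy.out.le).1 h2

/-- Substitution z = u(1 + x²): here 1 - u/z = x²/(1 + x²), and its root in the denominator cancels
against the Jacobian 2x/(1 + x²), so no singularity remains. -/
theorem integral_outer_eq (hu : u ≠ 0) :
    ∫ t in Set.Ioi (Real.log ‖u‖), rayKernel ϑ u (t + u.arg * I) = outerIntegral ϑ u := by
  rw [← log_one_add_sq_image_add (Real.log ‖u‖), integral_image_eq_integral_abs_deriv_smul
    measurableSet_Ioi (fun x _ => ((hasDerivAt_log_one_add_sq x).const_add _).hasDerivWithinAt)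
    (fun x hx y hy h => injOn_log_one_add_sq hx hy (by simpa using h)), outerIntegral,
    ← integral_const_mul]
  refine setIntegral_congr_fun measurableSet_Ioi fun x hx => ?_
  have hx : 0 < x := hx
  have hpos : (0 : ℝ) < 1 + x ^ 2 := by positivity
  have hw : ((Real.log ‖u‖ + Real.log (1 + x ^ 2) : ℝ) : ℂ) + u.arg * I =
      Complex.log u + ((Real.log (1 + x ^ 2) : ℝ) : ℂ) := by
    rw [Complex.log]; push_cast; ring
  have h1 : cexp (((Real.log ‖u‖ + Real.log (1 + x ^ 2) : ℝ) : ℂ) + u.arg * I) =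
      u * ((1 + x ^ 2 : ℝ) : ℂ) := by
    rw [hw, Complex.exp_add, Complex.exp_log hu, ← ofReal_exp, Real.exp_log hpos]
  have h2 : cexp ((((Real.log ‖u‖ + Real.log (1 + x ^ 2) : ℝ) : ℂ) + u.arg * I) / 2) =
      cexp (Complex.log u / 2) * ((√(1 + x ^ 2) : ℝ) : ℂ) := by
    rw [hw, add_div, Complex.exp_add, cexp_half_log_one_add_sq]
  have h3 : 1 - u * cexp (-(((Real.log ‖u‖ + Real.log (1 + x ^ 2) : ℝ) : ℂ) + u.arg * I)) =
      ((x ^ 2 / (1 + x ^ 2) : ℝ) : ℂ) := by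
    rw [mul_cexp_neg_arg hu, add_sub_cancel_left, Real.exp_neg, Real.exp_log hpos]
    rw [← ofReal_one, ← ofReal_sub]
    congr 1
    field_simp
    ring
  have h4 : (x ^ 2 / (1 + x ^ 2)) ^ (-(1 / 2) : ℝ) = √(1 + x ^ 2) / x := by
    rw [Real.rpow_neg (by positivity), ← Real.sqrt_eq_rpow, Real.sqrt_div (by positivity),
      Real.sqrt_sq hx.le, inv_div]
  simp only [rayKernel]
  rw [h1, h2, h3, ← ofReal_cpow (by positivity), h4, abs_of_pos (by positivity), real_smul]
  have h5 : ((√(1 + x ^ 2) : ℝ) : ℂ) * ((√(1 + x ^ 2) : ℝ) : ℂ) = 1 + (x : ℂ) ^ 2 := by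
    rw [← ofReal_mul, Real.mul_self_sqrt hpos.le]; push_cast; rfl
  have h6 : (1 + (x : ℂ) ^ 2) ≠ 0 := by exact_mod_cast hpos.ne'
  have h7 : (x : ℂ) ≠ 0 := by exact_mod_cast hx.ne'
  push_cast
  field_simp
  linear_combination (ϑ ((1 + (x : ℂ) ^ 2) * u)) * h5

/-- Substitution z = u/(1 + x²): here u/z - 1 = x², and the factor 1/x of the kernel again cancels
against the Jacobian. -/
theorem integral_inner_eq (hu : u ≠ 0) :
    ∫ t in Set.Iio (Real.log ‖u‖), innerKernel ϑ u (t + u.arg * I) = innerIntegral ϑ u := by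
  rw [← log_one_add_sq_image_sub (Real.log ‖u‖), integral_image_eq_integral_abs_deriv_smul
    measurableSet_Ioi (fun x _ => ((hasDerivAt_log_one_add_sq x).const_sub _).hasDerivWithinAt)
    (fun x hx y hy h => injOn_log_one_add_sq hx hy (by simpa using h)), innerIntegral,
    ← integral_const_mul]
  refine setIntegral_congr_fun measurableSet_Ioi fun x hx => ?_
  have hx : 0 < x := hx
  have hpos : (0 : ℝ) < 1 + x ^ 2 := by positivity
  have hw : ((Real.log ‖u‖ - Real.log (1 + x ^ 2) : ℝ) : ℂ) + u.arg * I =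
      Complex.log u - ((Real.log (1 + x ^ 2) : ℝ) : ℂ) := by
    rw [Complex.log]; push_cast; ring
  have h1 : cexp (((Real.log ‖u‖ - Real.log (1 + x ^ 2) : ℝ) : ℂ) + u.arg * I) =
      u / ((1 + x ^ 2 : ℝ) : ℂ) := by
    rw [hw, Complex.exp_sub, Complex.exp_log hu, ← ofReal_exp, Real.exp_log hpos]
  have h2 : cexp ((((Real.log ‖u‖ - Real.log (1 + x ^ 2) : ℝ) : ℂ) + u.arg * I) / 2) =
      cexp (Complex.log u / 2) / ((√(1 + x ^ 2) : ℝ) : ℂ) := by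
    rw [hw, sub_div, Complex.exp_sub, cexp_half_log_one_add_sq]
  have h3 : u * cexp (-(((Real.log ‖u‖ - Real.log (1 + x ^ 2) : ℝ) : ℂ) + u.arg * I)) - 1 =
      ((x ^ 2 : ℝ) : ℂ) := by
    rw [mul_cexp_neg_arg hu, sub_sub_cancel_left, neg_neg, Real.exp_log hpos]
    push_cast
    ring
  have h4 : (x ^ 2) ^ (-(1 / 2) : ℝ) = x⁻¹ := by
    rw [Real.rpow_neg (by positivity), ← Real.sqrt_eq_rpow, Real.sqrt_sq hx.le]
  simp only [innerKernel]
  rw [h1, h2, h3, ← ofReal_cpow (by positivity), h4, abs_neg, abs_of_pos (by positivity),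
    real_smul]
  have h6 : (1 + (x : ℂ) ^ 2) ≠ 0 := by exact_mod_cast hpos.ne'
  have h7 : (x : ℂ) ≠ 0 := by exact_mod_cast hx.ne'
  have h8 : ((√(1 + x ^ 2) : ℝ) : ℂ) ≠ 0 := by exact_mod_cast (Real.sqrt_pos.2 hpos).ne'
  push_cast
  field_simp

theorem arg_pos_of_im_pos (hu : 0 < u.im) : 0 < u.arg :=
  lt_of_le_of_ne (Complex.arg_nonneg_iff.2 hu.le) fun h => by
    rw [eq_comm, Complex.arg_eq_zero_iff] at h; exact hu.ne' h.2

theorem arg_lt_pi_of_im_pos (hu : 0 < u.im) : u.arg < Real.pi :=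
  lt_of_le_of_ne (Complex.arg_le_pi u) fun h => by
    rw [Complex.arg_eq_pi_iff] at h; exact hu.ne' h.2

/-- The ray integral when the ray has smaller argument than `u`. -/
theorem rayIntegral_of_lt_arg (hd : DifferentiableOn ℂ ϑ {z | 0 < z.im}) (hr : RapidDecay ϑ)
    (hu : 0 < u.im) {φ : ℝ} (h0 : 0 < φ) (hφ : φ < u.arg) :
    rayIntegral ϑ φ u = outerIntegral ϑ u + I * innerIntegral ϑ u := by
  have hu0 : u ≠ 0 := by rintro rfl; simp at hu
  have hπ := arg_lt_pi_of_im_pos hu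
  have hev : ∀ᶠ ψ : ℝ in 𝓝[<] u.arg, φ < ψ ∧ ψ < u.arg := Ioo_mem_nhdsLT hφ
  -- As a function of the angle the ray integral is constant up to arg u, so it equals its left-hand
  -- limit there.
  have h1 := tendsto_rayIntegral hd hr hu (l := 𝓝[<] u.arg) nhdsWithin_le_nhds I (by
    filter_upwards [hev] with ψ hψ t
    rw [rayKernel, cpow_neg_half_of_im_neg
      ((im_ne_zero_of_arg_ne hu (by linarith) (by linarith) t).1 hψ.2), innerKernel, neg_sub]
    ring) (by filter_upwards [hev] with ψ hψ using hψ.2.ne)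
  rw [integral_outer_eq hu0, integral_inner_eq hu0] at h1
  refine tendsto_nhds_unique (tendsto_const_nhds.congr' ?_) h1
  filter_upwards [hev] with ψ hψ
  exact rayIntegral_eq hd hr hu h0 hψ.1.le (by linarith) (Or.inl hψ.2)

/-- The ray integral when the ray has larger argument than `u`. -/
theorem rayIntegral_of_arg_lt (hd : DifferentiableOn ℂ ϑ {z | 0 < z.im}) (hr : RapidDecay ϑ)
    (hu : 0 < u.im) {φ : ℝ} (hπ : φ < Real.pi) (hφ : u.arg < φ) :
    rayIntegral ϑ φ u = outerIntegral ϑ u - I * innerIntegral ϑ u := by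
  have hu0 : u ≠ 0 := by rintro rfl; simp at hu
  have h0 := arg_pos_of_im_pos hu
  have hev : ∀ᶠ ψ : ℝ in 𝓝[>] u.arg, u.arg < ψ ∧ ψ < φ := Ioo_mem_nhdsGT hφ
  have h1 := tendsto_rayIntegral hd hr hu (l := 𝓝[>] u.arg) nhdsWithin_le_nhds (-I) (by
    filter_upwards [hev] with ψ hψ t
    rw [rayKernel, cpow_neg_half_of_im_pos
      ((im_ne_zero_of_arg_ne hu (by linarith) (by linarith) t).2 hψ.1), innerKernel, neg_sub]
    ring) (by filter_upwards [hev] with ψ hψ using hψ.1.ne')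
  rw [integral_outer_eq hu0, integral_inner_eq hu0, neg_mul, ← sub_eq_add_neg] at h1
  refine tendsto_nhds_unique (tendsto_const_nhds.congr' ?_) h1
  filter_upwards [hev] with ψ hψ
  exact (rayIntegral_eq hd hr hu (by linarith) hψ.2.le hπ (Or.inr hψ.1)).symm

end ray

end

/-! ### Analyticity and asymptotic expansion of ray integrals -/

section

open MeasureTheory

section ray

variable {ϑ : ℂ → ℂ}

theorem continuous_comp_cexp (hd : DifferentiableOn ℂ ϑ {z | 0 < z.im}) {φ : ℝ} (h0 : 0 < φ)
    (hπ : φ < Real.pi) : Continuous fun t : ℝ => ϑ (cexp (t + φ * I)) := by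
  refine hd.continuousOn.comp_continuous (by fun_prop) fun t => ?_
  rw [Set.mem_ofPred_eq, cexp_im_add_mul_I]
  exact mul_pos (Real.exp_pos _) (Real.sin_pos_of_pos_of_lt_pi h0 hπ)

/-- For z on the positive imaginary axis, u/z is u turned by -π/2 and rescaled. If |Im u| ≤ |Re u|,
its imaginary part dominates its real part, which keeps it away from 1. -/
theorem half_le_norm_one_sub {u : ℂ} (hu : |u.im| ≤ |u.re|) (t : ℝ) :
    1 / 2 ≤ ‖1 - u * cexp (-(t + (Real.pi / 2 : ℝ) * I))‖ := by
  have h : 1 - u * cexp (-(t + (Real.pi / 2 : ℝ) * I)) =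
      1 + u * I * ((Real.exp (-t) : ℝ) : ℂ) := by
    rw [neg_add, Complex.exp_add, Complex.exp_neg (_ * I)]
    push_cast
    rw [Complex.exp_pi_div_two_mul_I, Complex.inv_I]
    ring
  rw [h]
  set e := Real.exp (-t)
  have h2 : (u.im) ^ 2 ≤ u.re ^ 2 := sq_le_sq.2 hu
  have h1 : (1 / 2) ^ 2 ≤ ‖1 + u * I * (e : ℂ)‖ ^ 2 := by
    rw [Complex.sq_norm, Complex.normSq_apply]
    simp only [add_re, one_re, mul_re, mul_im, I_re, I_im, ofReal_re, ofReal_im, add_im, one_im,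
      mul_zero, mul_one, zero_sub, sub_zero, zero_add, add_zero]
    nlinarith [sq_nonneg (1 - 2 * u.im * e), mul_nonneg (sub_nonneg.2 h2) (sq_nonneg e)]
  exact le_of_sq_le_sq h1 (norm_nonneg _)

theorem mem_slitPlane_of_abs_im_le {u : ℂ} (h0 : u.re ≠ 0) (t : ℝ) :
    1 - u * cexp (-(t + (Real.pi / 2 : ℝ) * I)) ∈ slitPlane := by
  refine Or.inr ?_
  have h : 1 - u * cexp (-(t + (Real.pi / 2 : ℝ) * I)) =
      1 + u * I * ((Real.exp (-t) : ℝ) : ℂ) := by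
    rw [neg_add, Complex.exp_add, Complex.exp_neg (_ * I)]
    push_cast
    rw [Complex.exp_pi_div_two_mul_I, Complex.inv_I]
    ring
  rw [h]
  simp only [add_im, one_im, mul_im, mul_re, I_re, I_im, ofReal_re, ofReal_im, mul_zero, mul_one,
    zero_add, add_zero]
  exact mul_ne_zero h0 (Real.exp_ne_zero _)

/-- The integral along the vertical ray is analytic near real points different from `0`. -/
theorem analyticAt_rayIntegral (hd : DifferentiableOn ℂ ϑ {z | 0 < z.im}) (hr : RapidDecay ϑ)
    {x : ℝ} (hx : x ≠ 0) : AnalyticAt ℂ (rayIntegral ϑ (Real.pi / 2)) (x : ℂ) := by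
  have hπ := Real.pi_pos
  set U : Set ℂ := {u | |u.im| < |u.re|} with hU
  have hUo : IsOpen U := isOpen_lt (by fun_prop) (by fun_prop)
  have hxU : (x : ℂ) ∈ U := by simpa [hU] using hx
  refine DifferentiableOn.analyticAt (s := U) (fun u₀ hu₀ => ?_) (hUo.mem_nhds hxU)
  have hre : ∀ u ∈ U, u.re ≠ 0 := fun u hu h0 => by
    have : |u.im| < |u.re| := hu
    rw [h0, abs_zero] at this
    exact absurd this (not_lt.2 (abs_nonneg _))
  have hcont : ∀ u ∈ U, Continuous fun t : ℝ => rayKernel ϑ u (t + (Real.pi / 2 : ℝ) * I) :=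
    fun u hu => continuous_rayKernel hd (by positivity) (by linarith)
      fun t => mem_slitPlane_of_abs_im_le (hre u hu) t
  obtain ⟨C, hC0, hC⟩ := hr.exists_bound (ε := Real.pi / 2) (by positivity) (by linarith) 0
  -- Differentiation in u brings out a factor 1/z, whence the bound with n = 1.
  obtain ⟨C', hC0', hC'⟩ := hr.exists_bound (ε := Real.pi / 2) (by positivity) (by linarith) 1
  set F' : ℂ → ℝ → ℂ := fun u t => ϑ (cexp (t + (Real.pi / 2 : ℝ) * I)) *
    cexp ((t + (Real.pi / 2 : ℝ) * I) / 2) * ((((-(1 / 2) : ℝ)) : ℂ) *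
      (1 - u * cexp (-(t + (Real.pi / 2 : ℝ) * I))) ^ ((((-(1 / 2) : ℝ)) : ℂ) - 1) *
      (-cexp (-(t + (Real.pi / 2 : ℝ) * I)))) with hF'
  have hnorm : ∀ t : ℝ, ‖cexp ((t + (Real.pi / 2 : ℝ) * I) / 2)‖ = Real.exp (t / 2) := fun t => by
    rw [Complex.norm_exp]; simp
  have hnorm' : ∀ t : ℝ, ‖cexp (-(t + (Real.pi / 2 : ℝ) * I))‖ = Real.exp (-t) := fun t => by
    rw [Complex.norm_exp]; simp
  refine (hasDerivAt_integral_of_dominated_loc_of_deriv_le (hUo.mem_nhds hu₀)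
    (F := fun u t => rayKernel ϑ u (t + (Real.pi / 2 : ℝ) * I)) (F' := F')
    (bound := fun t => (1 / 2 * (1 / 2 : ℝ) ^ (-(3 / 2) : ℝ) * C') * Real.exp (-|t|))
    ?_ ?_ ?_ ?_ ?_ ?_).2.differentiableAt.differentiableWithinAt
  · filter_upwards [hUo.mem_nhds hu₀] with u hu using (hcont u hu).aestronglyMeasurable
  · refine (integrable_exp_neg_abs.const_mul ((1 / 2 : ℝ) ^ (-(1 / 2) : ℝ) * C)).mono'
      (hcont u₀ hu₀).aestronglyMeasurable (Eventually.of_forall fun t => ?_)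
    rw [norm_rayKernel]
    have h1 := hC t (Real.pi / 2) le_rfl (by linarith)
    simp only [Nat.cast_zero, zero_mul, neg_zero, Real.exp_zero, mul_one] at h1
    have h2 := Real.rpow_le_rpow_of_nonpos (by norm_num) (half_le_norm_one_sub
      (le_of_lt hu₀.out) t) (show (-(1 / 2) : ℝ) ≤ 0 by norm_num)
    calc _ ≤ (C * Real.exp (-|t|)) * (1 / 2 : ℝ) ^ (-(1 / 2) : ℝ) := by gcongr
      _ = _ := by ring
  · refine Continuous.aestronglyMeasurable ?_
    refine ((continuous_comp_cexp hd (by positivity) (by linarith)).mul (by fun_prop)).mul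
      ((continuous_const.mul ?_).mul (by fun_prop))
    exact Continuous.cpow (by fun_prop) continuous_const
      fun t => mem_slitPlane_of_abs_im_le (hre u₀ hu₀) t
  · refine Eventually.of_forall fun t u hu => ?_
    have h1 := hC' t (Real.pi / 2) le_rfl (by linarith)
    simp only [Nat.cast_one, one_mul] at h1
    have h2 := Real.rpow_le_rpow_of_nonpos (by norm_num) (half_le_norm_one_sub
      (le_of_lt hu.out) t) (show (-(3 / 2) : ℝ) ≤ 0 by norm_num)
    have h3 : ((((-(1 / 2) : ℝ)) : ℂ) - 1) = ((-(3 / 2) : ℝ) : ℂ) := by push_cast; norm_num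
    rw [hF']
    simp only [norm_mul, norm_neg, hnorm, hnorm']
    rw [h3, Complex.norm_cpow_real, Complex.norm_real]
    have h4 : ‖(-(1 / 2) : ℝ)‖ = 1 / 2 := by norm_num
    rw [h4]
    calc _ = 1 / 2 * ‖1 - u * cexp (-(t + (Real.pi / 2 : ℝ) * I))‖ ^ (-(3 / 2) : ℝ) *
          (‖ϑ (cexp (t + (Real.pi / 2 : ℝ) * I))‖ * Real.exp (t / 2) * Real.exp (-t)) := by ring
      _ ≤ 1 / 2 * (1 / 2 : ℝ) ^ (-(3 / 2) : ℝ) * (C' * Real.exp (-|t|)) := by gcongr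
      _ = _ := by ring
  · exact integrable_exp_neg_abs.const_mul _
  · refine Eventually.of_forall fun t u hu => ?_
    have h1 : HasDerivAt (fun u : ℂ => 1 - u * cexp (-(t + (Real.pi / 2 : ℝ) * I)))
        (-cexp (-(t + (Real.pi / 2 : ℝ) * I))) u := by
      simpa using ((hasDerivAt_id u).mul_const
        (cexp (-(t + (Real.pi / 2 : ℝ) * I)))).const_sub 1
    exact (h1.cpow_const (mem_slitPlane_of_abs_im_le (hre u hu) t)).const_mul _

/-- A Taylor estimate for `(1 - ω)^{-1/2}` that is uniform in a cone. -/
theorem exists_norm_cpow_sub_le {δ : ℝ} (hδ : 0 < δ) (N : ℕ) : ∃ C : ℝ, 0 ≤ C ∧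
    ∀ ω : ℂ, ω ≠ 0 → δ * ‖ω‖ ≤ |ω.im| →
      ‖(1 - ω) ^ (((-(1 / 2) : ℝ)) : ℂ) - ((PowerSeries.trunc N (taylorSeries
        (fun ω => (1 - ω) ^ (((-(1 / 2) : ℝ)) : ℂ)) 0)).eval ω)‖ ≤ C * ‖ω‖ ^ N := by
  set a := taylorSeries (fun ω => (1 - ω) ^ (((-(1 / 2) : ℝ)) : ℂ)) 0
  have han : AnalyticAt ℂ (fun ω : ℂ => (1 - ω) ^ (((-(1 / 2) : ℝ)) : ℂ)) 0 :=
    AnalyticAt.cpow (by fun_prop) analyticAt_const (by simp)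
  obtain ⟨C, hC⟩ := (hasExp_taylorSeries han N).bound
  obtain ⟨r, hr, hball⟩ := Metric.mem_nhds_iff.1 hC
  -- This constant serves |ω| ≥ r, outside the range of the Taylor estimate: there |1 - ω| ≥ |Im ω|
  -- ≥ δr, and |ω|^n is at most r^{n-N}|ω|^N for n ≤ N.
  set D := (δ * r) ^ (-(1 / 2) : ℝ) / r ^ N + ∑ n ∈ Finset.range N,
    ‖PowerSeries.coeff n a‖ * r ^ n / r ^ N with hD
  have hD0 : 0 ≤ D := by positivity
  refine ⟨max C D, hD0.trans (le_max_right _ _), fun ω h0 hω => ?_⟩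
  rcases lt_or_ge ‖ω‖ r with h | h
  · have h1 := hball (show ω ∈ Metric.ball 0 r by simpa using h)
    simp only [Set.mem_ofPred_eq, zero_add, norm_pow] at h1
    exact h1.trans (mul_le_mul_of_nonneg_right (le_max_left _ _) (by positivity))
  · refine le_trans ?_ (mul_le_mul_of_nonneg_right (le_max_right C D) (by positivity))
    have h1 : δ * r ≤ ‖1 - ω‖ := by
      have : |(1 - ω).im| ≤ ‖1 - ω‖ := Complex.abs_im_le_norm _
      rw [sub_im, one_im, zero_sub, abs_neg] at this
      exact ((mul_le_mul_of_nonneg_left h hδ.le).trans hω).trans this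
    have hpow : ∀ n ≤ N, ‖ω‖ ^ n ≤ r ^ n / r ^ N * ‖ω‖ ^ N := by
      intro n hn
      have h2 : 1 ≤ ‖ω‖ / r := by rwa [one_le_div hr]
      have h3 := pow_le_pow_right₀ h2 hn
      rw [div_pow, div_pow, div_le_div_iff₀ (by positivity) (by positivity)] at h3
      rw [div_mul_eq_mul_div, le_div_iff₀ (by positivity)]
      linarith
    refine (norm_sub_le _ _).trans ?_
    rw [hD, add_mul, Finset.sum_mul]
    refine add_le_add ?_ ?_
    · rw [Complex.norm_cpow_real]
      have h4 := Real.rpow_le_rpow_of_nonpos (by positivity) h1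
        (show (-(1 / 2) : ℝ) ≤ 0 by norm_num)
      refine h4.trans ?_
      have h5 := hpow 0 (Nat.zero_le N)
      rw [pow_zero, pow_zero] at h5
      calc (δ * r) ^ (-(1 / 2) : ℝ) = (δ * r) ^ (-(1 / 2) : ℝ) * 1 := by ring
        _ ≤ (δ * r) ^ (-(1 / 2) : ℝ) * (1 / r ^ N * ‖ω‖ ^ N) := by gcongr
        _ = _ := by ring
    · rw [Polynomial.eval, PowerSeries.eval₂_trunc_eq_sum_range]
      refine (norm_sum_le _ _).trans (Finset.sum_le_sum fun n hn => ?_)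
      rw [norm_mul, norm_pow]
      have h5 := hpow n (Finset.mem_range.1 hn).le
      calc _ ≤ ‖PowerSeries.coeff n a‖ * (r ^ n / r ^ N * ‖ω‖ ^ N) := by
            gcongr; rfl
        _ = _ := by ring

/-- Ray integrals have asymptotic expansions at `0` in cones. -/
theorem exists_hasExp_rayIntegral (hd : DifferentiableOn ℂ ϑ {z | 0 < z.im}) (hr : RapidDecay ϑ)
    {η : ℝ} (hη : 0 < η) : ∃ a : ℂ⟦X⟧,
      HasExp (𝓝[cone η] 0) (fun u => outerIntegral ϑ u + I * innerIntegral ϑ u) a := by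
  -- The ray with slope η/2 runs strictly below the cone, so for u in the cone and z on the ray
  -- Im(u/z) is at least δ|u/z|.
  set φ := Real.arctan (η / 2) with hφdef
  have hφ0 : 0 < φ := Real.arctan_pos.2 (by positivity)
  have hφ2 : φ < Real.pi / 2 := Real.arctan_lt_pi_div_two _
  have hπ := Real.pi_pos
  have hcos : 0 < Real.cos φ := Real.cos_pos_of_mem_Ioo ⟨by linarith, hφ2⟩
  have hsin : Real.sin φ = η / 2 * Real.cos φ := by
    rw [← Real.tan_mul_cos hcos.ne', hφdef, Real.tan_arctan]
  set δ := η / 2 * Real.cos φ with hδ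
  have hδ0 : 0 < δ := by positivity
  have hkey : ∀ u ∈ cone η, ∀ t : ℝ, δ * ‖u * cexp (-(t + φ * I))‖ ≤
      (u * cexp (-(t + φ * I))).im := by
    intro u hu t
    have h1 : cexp (-(t + φ * I)) = ((Real.exp (-t) : ℝ) : ℂ) *
        (((Real.cos φ : ℝ) : ℂ) - ((Real.sin φ : ℝ) : ℂ) * I) := by
      rw [neg_add, Complex.exp_add, ofReal_exp, ofReal_neg, ← neg_mul, Complex.exp_mul_I,
        Complex.cos_neg, Complex.sin_neg]
      push_cast
      ring
    have h2 : ‖u * cexp (-(t + φ * I))‖ = ‖u‖ * Real.exp (-t) := by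
      rw [norm_mul, Complex.norm_exp]; simp
    have h3 : (u * cexp (-(t + φ * I))).im =
        (u.im * Real.cos φ - u.re * Real.sin φ) * Real.exp (-t) := by
      rw [h1]
      simp only [mul_im, mul_re, sub_re, sub_im, ofReal_re, ofReal_im, I_re, I_im, mul_zero,
        mul_one, zero_mul, sub_zero, zero_sub, add_zero, zero_add]
      ring
    rw [h2, h3, ← mul_assoc]
    refine mul_le_mul_of_nonneg_right ?_ (Real.exp_pos _).le
    have h4 := hu.2
    have h5 : u.re ≤ ‖u‖ := Complex.re_le_norm u
    rw [hsin]
    have h6 : η * ‖u‖ * Real.cos φ ≤ u.im * Real.cos φ := by gcongr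
    have h7 : u.re * (η / 2 * Real.cos φ) ≤ ‖u‖ * (η / 2 * Real.cos φ) := by gcongr
    rw [hδ]
    nlinarith
  have harg : ∀ u ∈ cone η, φ < u.arg := by
    intro u hu
    have h1 := hkey u hu 0
    have h2 : 0 < ‖u * cexp (-(((0 : ℝ) : ℂ) + φ * I))‖ :=
      norm_pos_iff.2 (mul_ne_zero hu.1 (Complex.exp_ne_zero _))
    have h3 : 0 < (u * cexp (-(((0 : ℝ) : ℂ) + φ * I))).im := (mul_pos hδ0 h2).trans_le h1
    rw [im_mul_cexp_neg hu.1] at h3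
    by_contra hle
    have h4 := arg_pos_of_im_pos (im_pos_of_mem_cone hη hu)
    have h5 := Real.sin_nonpos_of_nonpos_of_neg_pi_le (x := u.arg - φ) (by linarith)
      (by linarith)
    nlinarith [Real.exp_pos (-(0 - Real.log ‖u‖))]
  set b := taylorSeries (fun ω => (1 - ω) ^ (((-(1 / 2) : ℝ)) : ℂ)) 0 with hb
  -- These are the moments of ϑ against z^{-n-1/2} dz, finite by rapid decay at 0. Expanding (1 -
  -- u/z)^{-1/2} in powers of u/z makes them, up to binomial factors, the coefficients of the
  -- expansion.
  set m : ℕ → ℂ := fun n => ∫ t : ℝ, ϑ (cexp (t + φ * I)) * cexp ((t + φ * I) / 2) *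
    cexp (-(t + φ * I)) ^ n with hm
  have hnorm : ∀ t : ℝ, ‖cexp ((t + φ * I) / 2)‖ = Real.exp (t / 2) := fun t => by
    rw [Complex.norm_exp]; simp
  have hnorm' : ∀ (t : ℝ) (n : ℕ), ‖cexp (-(t + φ * I)) ^ n‖ = Real.exp (-(n * t)) := fun t n => by
    rw [← Complex.exp_nat_mul, Complex.norm_exp]; simp
  have hmint : ∀ n, Integrable fun t : ℝ => ϑ (cexp (t + φ * I)) * cexp ((t + φ * I) / 2) *
      cexp (-(t + φ * I)) ^ n := by
    intro n
    obtain ⟨C, -, hC⟩ := hr.exists_bound hφ0 (by linarith) n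
    refine (integrable_exp_neg_abs.const_mul C).mono'
      (((continuous_comp_cexp hd hφ0 (by linarith)).mul (by fun_prop)).mul
        (by fun_prop)).aestronglyMeasurable (Eventually.of_forall fun t => ?_)
    rw [norm_mul, norm_mul, hnorm, hnorm']
    exact hC t φ le_rfl (by linarith)
  refine ⟨PowerSeries.mk fun n => PowerSeries.coeff n b * m n, fun N => ?_⟩
  obtain ⟨C, hC0, hC⟩ := exists_norm_cpow_sub_le hδ0 N
  obtain ⟨C', hC0', hC'⟩ := hr.exists_bound hφ0 (by linarith) N
  refine IsBigO.of_bound (∫ t : ℝ, C * C' * Real.exp (-|t|)) ?_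
  filter_upwards [self_mem_nhdsWithin] with u hu
  have hui := im_pos_of_mem_cone hη hu
  rw [← rayIntegral_of_lt_arg hd hr hui hφ0 (harg u hu), Polynomial.eval,
    PowerSeries.eval₂_trunc_eq_sum_range]
  have h1 : ∑ n ∈ Finset.range N, (RingHom.id ℂ) (PowerSeries.coeff n
      (PowerSeries.mk fun n => PowerSeries.coeff n b * m n)) * u ^ n =
      ∫ t : ℝ, ∑ n ∈ Finset.range N, (PowerSeries.coeff n b * u ^ n) *
        (ϑ (cexp (t + φ * I)) * cexp ((t + φ * I) / 2) * cexp (-(t + φ * I)) ^ n) := by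
    rw [integral_finsetSum _ fun n _ => (hmint n).const_mul _]
    refine Finset.sum_congr rfl fun n _ => ?_
    rw [integral_const_mul, PowerSeries.coeff_mk, RingHom.id_apply]
    ring
  rw [h1, rayIntegral, ← integral_sub (integrable_rayKernel hd hr hui hφ0 (by linarith)
    (harg u hu).ne) (integrable_finsetSum _ fun n _ => (hmint n).const_mul _)]
  refine (norm_integral_le_of_norm_le ((integrable_exp_neg_abs.const_mul (C * C')).mul_const
    ‖u ^ N‖) (Eventually.of_forall fun t => ?_)).trans (le_of_eq (integral_mul_const _ _))
  have h2 := hC (u * cexp (-(t + φ * I))) (mul_ne_zero hu.1 (Complex.exp_ne_zero _))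
    ((hkey u hu t).trans (le_abs_self _))
  rw [Polynomial.eval, PowerSeries.eval₂_trunc_eq_sum_range] at h2
  have h3 : rayKernel ϑ u (t + φ * I) - ∑ n ∈ Finset.range N, (PowerSeries.coeff n b * u ^ n) *
      (ϑ (cexp (t + φ * I)) * cexp ((t + φ * I) / 2) * cexp (-(t + φ * I)) ^ n) =
      ϑ (cexp (t + φ * I)) * cexp ((t + φ * I) / 2) *
      ((1 - u * cexp (-(t + φ * I))) ^ (((-(1 / 2) : ℝ)) : ℂ) -
        ∑ n ∈ Finset.range N, (RingHom.id ℂ) (PowerSeries.coeff n b) *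
          (u * cexp (-(t + φ * I))) ^ n) := by
    rw [rayKernel, mul_sub, Finset.mul_sum]
    congr 1
    refine Finset.sum_congr rfl fun n _ => ?_
    rw [mul_pow, RingHom.id_apply]
    ring
  rw [h3, norm_mul, norm_mul, hnorm]
  have h4 := hC' t φ le_rfl (by linarith)
  have h5 : ‖u * cexp (-(t + φ * I))‖ ^ N = ‖u ^ N‖ * Real.exp (-(N * t)) := by
    rw [← norm_pow, mul_pow, norm_mul, hnorm']
  rw [h5] at h2
  calc _ ≤ ‖ϑ (cexp (t + φ * I))‖ * Real.exp (t / 2) * (C * (‖u ^ N‖ * Real.exp (-(N * t)))) := by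
        gcongr
    _ = C * ‖u ^ N‖ * (‖ϑ (cexp (t + φ * I))‖ * Real.exp (t / 2) * Real.exp (-(N * t))) := by ring
    _ ≤ C * ‖u ^ N‖ * (C' * Real.exp (-|t|)) := by gcongr
    _ = _ := by ring

end ray

end

section

open MeasureTheory

/-! ### Ray integrals of theta series -/

/-- The argument of i/u is π/2 - arg u and lies in (-π/2, π/2), so the principal root is the product
of the individual roots. This root occurs in the Gaussian integral. -/
theorem log_div_I {u : ℂ} (hu : 0 < u.im) {r : ℝ} (hr : 0 < r) :
    ((((r ^ 2 : ℝ) : ℂ) * (I / u)) ^ (1 / 2 : ℂ)) =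
      r * cexp (Real.pi / 4 * I) * cexp (-(Complex.log u / 2)) := by
  have hu0 : u ≠ 0 := by rintro rfl; simp at hu
  have h1 : ((r ^ 2 : ℝ) : ℂ) * (I / u) =
      cexp (((2 * Real.log r : ℝ) : ℂ) + Real.pi / 2 * I - Complex.log u) := by
    rw [Complex.exp_sub, Complex.exp_add, Complex.exp_log hu0, Complex.exp_pi_div_two_mul_I,
      ← ofReal_exp, two_mul, Real.exp_add, Real.exp_log hr]
    push_cast
    ring
  have h0 := arg_pos_of_im_pos hu
  have hπ := arg_lt_pi_of_im_pos hu
  have him : (((2 * Real.log r : ℝ) : ℂ) + Real.pi / 2 * I - Complex.log u).im =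
      Real.pi / 2 - u.arg := by
    rw [sub_im, add_im, ofReal_im, Complex.log_im, zero_add]
    congr 1
    have : ((Real.pi : ℂ) / 2 * I) = ((Real.pi / 2 : ℝ) : ℂ) * I := by push_cast; rfl
    rw [this]
    simp
  have hne : ((r ^ 2 : ℝ) : ℂ) * (I / u) ≠ 0 := by rw [h1]; exact Complex.exp_ne_zero _
  rw [Complex.cpow_def_of_ne_zero hne, h1, Complex.log_exp (by rw [him]; linarith)
    (by rw [him]; linarith)]
  have h2 : (r : ℂ) = cexp ((Real.log r : ℝ) : ℂ) := by
    rw [← ofReal_exp, Real.exp_log hr]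
  nth_rw 1 [h2]
  rw [← Complex.exp_add, ← Complex.exp_add]
  congr 1
  push_cast
  ring

/-- The coefficient of `x ^ 2` in the exponent of a theta term at `u (1 + x ^ 2)`. -/
def thetaExponent (M : ℕ) (n : ℕ+) (u : ℂ) : ℂ := -(I * Real.pi * ((n : ℕ) : ℂ) ^ 2 * u / M)

theorem thetaExponent_re (M : ℕ) (n : ℕ+) (u : ℂ) :
    (thetaExponent M n u).re = Real.pi * ((n : ℕ) : ℝ) ^ 2 * u.im / M := by
  have : thetaExponent M n u = ((Real.pi * ((n : ℕ) : ℝ) ^ 2 / M : ℝ) : ℂ) * (-(I * u)) := by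
    rw [thetaExponent]; push_cast; ring
  rw [this, Complex.re_ofReal_mul, Complex.neg_re, Complex.I_mul_re]
  ring

theorem thetaTerm_mul_one_add_sq (ν : ℕ) (f : ℤ → ℂ) (M : ℕ) (n : ℕ+) (u : ℂ) (x : ℝ) :
    thetaTerm ν f M n (u * ((1 + x ^ 2 : ℝ) : ℂ)) =
      thetaTerm ν f M n u * cexp (-thetaExponent M n u * (x : ℂ) ^ 2) := by
  rw [thetaTerm, thetaTerm, mul_assoc (((n : ℕ) : ℂ) ^ ν * f ((n : ℕ) : ℤ)),
    ← Complex.exp_add, thetaExponent]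
  congr 2
  push_cast
  ring

theorem integrable_pow_mul_cexp_neg_mul_sq {b : ℂ} (hb : 0 < b.re) (j : ℕ) :
    Integrable fun x : ℝ => (x : ℂ) ^ j * cexp (-b * (x : ℂ) ^ 2) := by
  have h := integrable_rpow_mul_exp_neg_mul_sq hb (s := j) (by linarith [Nat.cast_nonneg (α := ℝ) j])
  refine h.norm.mono' (by fun_prop) (Eventually.of_forall fun x => le_of_eq ?_)
  rw [norm_mul, norm_mul, Real.rpow_natCast, norm_pow, norm_pow, Complex.norm_real]
  congr 1
  rw [Complex.norm_exp, Real.norm_eq_abs, Real.abs_exp]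
  congr 1
  rw [← ofReal_pow, re_mul_ofReal, neg_re]

/-- Integrate the derivative of x e^{-bx²} over the half-line. -/
theorem integral_sq_mul_cexp_neg_mul_sq {b : ℂ} (hb : 0 < b.re) :
    ∫ x : ℝ in Set.Ioi 0, (x : ℂ) ^ 2 * cexp (-b * (x : ℂ) ^ 2) =
      (2 * b)⁻¹ * ∫ x : ℝ in Set.Ioi 0, cexp (-b * (x : ℂ) ^ 2) := by
  have hb0 : b ≠ 0 := by rintro rfl; simp at hb
  have hi0 := integrable_pow_mul_cexp_neg_mul_sq hb 0
  have hi2 := integrable_pow_mul_cexp_neg_mul_sq hb 2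
  simp only [pow_zero, one_mul] at hi0
  have h := integral_Ioi_of_hasDerivAt_of_tendsto (a := 0) (m := (0 : ℂ))
    (f := fun x : ℝ => (x : ℂ) * cexp (-b * (x : ℂ) ^ 2))
    (f' := fun x : ℝ => cexp (-b * (x : ℂ) ^ 2) - 2 * b * ((x : ℂ) ^ 2 * cexp (-b * (x : ℂ) ^ 2)))
    (by fun_prop) (fun x _ => ?_) (hi0.sub (hi2.const_mul _)).integrableOn ?_
  · rw [integral_sub hi0.integrableOn (hi2.const_mul _).integrableOn, integral_const_mul] at h
    simp only [ofReal_zero, zero_mul, sub_zero] at h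
    rw [eq_inv_mul_iff_mul_eq₀ (by simpa using hb0)]
    exact (sub_eq_zero.1 h).symm
  · have h1 : HasDerivAt (fun z : ℂ => z * cexp (-b * z ^ 2))
        (cexp (-b * (x : ℂ) ^ 2) - 2 * b * ((x : ℂ) ^ 2 * cexp (-b * (x : ℂ) ^ 2))) (x : ℂ) := by
      refine ((hasDerivAt_id (x : ℂ)).mul
        (((hasDerivAt_pow 2 (x : ℂ)).const_mul (-b)).cexp)).congr_deriv ?_
      simp only [id]
      push_cast
      ring
    exact h1.comp_ofReal
  · have hr := tendsto_rpow_abs_mul_exp_neg_mul_sq_cocompact hb 1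
    rw [tendsto_zero_iff_norm_tendsto_zero]
    refine (hr.mono_left atTop_le_cocompact).congr fun x => ?_
    rw [norm_mul, Complex.norm_exp, Complex.norm_real, Real.rpow_one, Real.norm_eq_abs]
    congr 2
    rw [← ofReal_pow, re_mul_ofReal, neg_re]

section bounded

variable {f : ℤ → ℂ} {B : ℝ} {M : ℕ}

theorem thetaExponent_re_pos (hM : 0 < M) (n : ℕ+) {u : ℂ} (hu : 0 < u.im) :
    0 < (thetaExponent M n u).re := by
  rw [thetaExponent_re]
  have hM' : (0 : ℝ) < M := by exact_mod_cast hM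
  have hn : (0 : ℝ) < (n : ℕ) := by exact_mod_cast n.pos
  have := Real.pi_pos
  positivity

theorem integrable_pow_mul_thetaTerm (hM : 0 < M) (ν j : ℕ) (n : ℕ+) {u : ℂ} (hu : 0 < u.im) :
    Integrable fun x : ℝ => (x : ℂ) ^ j * thetaTerm ν f M n (u * ((1 + x ^ 2 : ℝ) : ℂ)) := by
  refine ((integrable_pow_mul_cexp_neg_mul_sq (thetaExponent_re_pos hM n hu) j).const_mul
    (thetaTerm ν f M n u)).congr (Eventually.of_forall fun x => ?_)
  simp only [thetaTerm_mul_one_add_sq]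
  ring

/-- Termwise integration of theta series along rays. -/
theorem hasSum_integral_theta (hB : 0 ≤ B) (hf : ∀ n, ‖f n‖ ≤ B) (hM : 0 < M) (ν j : ℕ) {u : ℂ}
    (hu : 0 < u.im) :
    HasSum (fun n => ∫ x : ℝ in Set.Ioi 0, (x : ℂ) ^ j *
      thetaTerm ν f M n (u * ((1 + x ^ 2 : ℝ) : ℂ)))
      (∫ x : ℝ in Set.Ioi 0, (x : ℂ) ^ j * partialTheta ν f M (u * ((1 + x ^ 2 : ℝ) : ℂ))) := by
  have hM' : (0 : ℝ) < M := by exact_mod_cast hM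
  have hπ := Real.pi_pos
  -- The decay rate of the term n = 1, the slowest of all; its Gaussian dominates the others in x.
  set c := Real.pi * u.im / M with hc
  have hc0 : 0 < c := by positivity
  have hg : Integrable fun x : ℝ => ‖(x : ℂ) ^ j * cexp (-(c : ℂ) * (x : ℂ) ^ 2)‖ :=
    (integrable_pow_mul_cexp_neg_mul_sq (b := (c : ℂ)) (by simpa using hc0) j).norm
  have h := hasSum_integral_of_summable_integral_norm
    (μ := volume.restrict (Set.Ioi (0 : ℝ)))
    (F := fun n (x : ℝ) => (x : ℂ) ^ j * thetaTerm ν f M n (u * ((1 + x ^ 2 : ℝ) : ℂ)))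
    (fun n => (integrable_pow_mul_thetaTerm hM ν j n hu).integrableOn) ?_
  · simpa only [tsum_mul_left, ← partialTheta_eq_tsum] using h
  · refine ((summable_norm_thetaTerm hB hf hM ν hu).mul_right
      (∫ x : ℝ in Set.Ioi 0, ‖(x : ℂ) ^ j * cexp (-(c : ℂ) * (x : ℂ) ^ 2)‖)).of_nonneg_of_le
      (fun n => integral_nonneg fun x => norm_nonneg _) fun n => ?_
    rw [← integral_const_mul]
    refine integral_mono (integrable_pow_mul_thetaTerm hM ν j n hu).norm.integrableOn
      (hg.const_mul _).integrableOn fun x => ?_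
    have hn : (1 : ℝ) ≤ (n : ℕ) := by exact_mod_cast n.pos
    simp only [thetaTerm_mul_one_add_sq, norm_mul]
    rw [Complex.norm_exp, Complex.norm_exp, ← ofReal_pow x 2, re_mul_ofReal, neg_re, re_mul_ofReal,
      neg_re, ofReal_re, thetaExponent_re]
    have h1 : -(Real.pi * ((n : ℕ) : ℝ) ^ 2 * u.im / M) * x ^ 2 ≤ -c * x ^ 2 := by
      have h2 : (1 : ℝ) ≤ ((n : ℕ) : ℝ) ^ 2 := one_le_pow₀ hn
      have h3 : c * 1 ≤ c * ((n : ℕ) : ℝ) ^ 2 := by gcongr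
      have h4 : Real.pi * ((n : ℕ) : ℝ) ^ 2 * u.im / M = c * ((n : ℕ) : ℝ) ^ 2 := by
        rw [hc]; ring
      rw [h4]
      nlinarith [sq_nonneg x]
    calc _ = ‖thetaTerm ν f M n u‖ * (‖(x : ℂ) ^ j‖ *
          Real.exp (-(Real.pi * ((n : ℕ) : ℝ) ^ 2 * u.im / M) * x ^ 2)) := by ring
      _ ≤ _ := by gcongr

/-- The integral of a single theta term. -/
theorem integral_thetaTerm (hM : 0 < M) (ν : ℕ) (n : ℕ+) {u : ℂ} (hu : 0 < u.im) :
    2 * ∫ x : ℝ in Set.Ioi 0, thetaTerm (ν + 1) f M n (u * ((1 + x ^ 2 : ℝ) : ℂ)) =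
      √M * cexp (Real.pi / 4 * I) * cexp (-(Complex.log u / 2)) * thetaTerm ν f M n u := by
  have hM' : (0 : ℝ) < M := by exact_mod_cast hM
  have hMc : (M : ℂ) ≠ 0 := by exact_mod_cast hM.ne'
  have hn : (0 : ℝ) < (n : ℕ) := by exact_mod_cast n.pos
  have hnc : ((n : ℕ) : ℂ) ≠ 0 := by exact_mod_cast n.pos.ne'
  have hu0 : u ≠ 0 := by rintro rfl; simp at hu
  have hπ : (Real.pi : ℂ) ≠ 0 := by exact_mod_cast Real.pi_ne_zero
  simp only [thetaTerm_mul_one_add_sq]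
  rw [integral_const_mul, integral_gaussian_complex_Ioi (thetaExponent_re_pos hM n hu)]
  -- The root of this quotient contributes 1/n, which lowers the exponent ν + 1 to ν.
  have h1 : (Real.pi : ℂ) / thetaExponent M n u =
      (((√M / (n : ℕ)) ^ 2 : ℝ) : ℂ) * (I / u) := by
    rw [div_pow, Real.sq_sqrt hM'.le, thetaExponent]
    push_cast
    field_simp
    rw [I_sq]
  rw [h1, log_div_I hu (by positivity), thetaTerm, thetaTerm, pow_succ]
  push_cast
  field_simp

/-- The outer part of the ray integral of a theta series is a partial theta series. -/
theorem outerIntegral_partialTheta (hB : 0 ≤ B) (hf : ∀ n, ‖f n‖ ≤ B) (hM : 0 < M) (ν : ℕ)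
    {u : ℂ} (hu : 0 < u.im) :
    outerIntegral (partialTheta (ν + 1) f M) u =
      √M * cexp (Real.pi / 4 * I) * partialTheta ν f M u := by
  have h := (hasSum_integral_theta hB hf hM (ν + 1) 0 hu).mul_left 2
  simp only [pow_zero, one_mul, integral_thetaTerm hM ν _ hu] at h
  rw [outerIntegral, integral_const_mul, ← h.tsum_eq, tsum_mul_left, ← partialTheta_eq_tsum]
  have h1 : cexp (Complex.log u / 2) * cexp (-(Complex.log u / 2)) = 1 := by
    rw [← Complex.exp_add, add_neg_cancel, Complex.exp_zero]
  linear_combination (√M * cexp (Real.pi / 4 * I) * partialTheta ν f M u) * h1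

theorem integrable_partialTheta (hB : 0 ≤ B) (hf : ∀ n, ‖f n‖ ≤ B) (hM : 0 < M) (ν j : ℕ)
    {u : ℂ} (hu : 0 < u.im) : IntegrableOn (fun x : ℝ =>
      (x : ℂ) ^ j * partialTheta ν f M (u * ((1 + x ^ 2 : ℝ) : ℂ))) (Set.Ioi 0) := by
  -- Of the ν + 2 + j powers of 1 + x², j absorb |x|^j and the others leave at least the integrable
  -- (1 + x²)^{-1}.
  obtain ⟨K, hK0, hK⟩ := norm_partialTheta_le hB hf hM (ν := ν) (N := ν + 2 + j) (by omega)
  have him : ∀ x : ℝ, (u * ((1 + x ^ 2 : ℝ) : ℂ)).im = u.im * (1 + x ^ 2) := fun x => by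
    rw [mul_comm, Complex.im_ofReal_mul, mul_comm]
  refine Integrable.integrableOn ?_
  refine (integrable_inv_one_add_sq.const_mul (K * (u.im ^ (ν + 2 + j))⁻¹)).mono' ?_
    (Eventually.of_forall fun x => ?_)
  · refine Continuous.aestronglyMeasurable (Continuous.mul (by fun_prop) ?_)
    refine (differentiableOn_partialTheta hB hf hM ν).continuousOn.comp_continuous (by fun_prop)
      fun x => ?_
    rw [Set.mem_ofPred_eq, him]
    positivity
  · have h1 : (0 : ℝ) < 1 + x ^ 2 := by positivity
    have h2 := hK (u * ((1 + x ^ 2 : ℝ) : ℂ)) (by rw [him]; positivity)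
    rw [him, mul_pow, mul_inv] at h2
    rw [norm_mul, norm_pow, Complex.norm_real, Real.norm_eq_abs]
    have h3 : |x| ^ j ≤ (1 + x ^ 2) ^ j :=
      pow_le_pow_left₀ (abs_nonneg x) (abs_le.2 ⟨by nlinarith, by nlinarith⟩) j
    have h4 : ((1 + x ^ 2) ^ (ν + 2 + j))⁻¹ * (1 + x ^ 2) ^ j ≤ (1 + x ^ 2)⁻¹ := by
      rw [pow_add, mul_inv, mul_assoc, inv_mul_cancel₀ (by positivity), mul_one]
      refine inv_anti₀ h1 ?_
      calc (1 + x ^ 2) = (1 + x ^ 2) ^ 1 := (pow_one _).symm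
        _ ≤ _ := pow_le_pow_right₀ (by nlinarith) (by omega)
    calc |x| ^ j * ‖partialTheta ν f M (u * ((1 + x ^ 2 : ℝ) : ℂ))‖
        ≤ (1 + x ^ 2) ^ j * (K * ((u.im ^ (ν + 2 + j))⁻¹ * ((1 + x ^ 2) ^ (ν + 2 + j))⁻¹)) := by
          gcongr
      _ = K * (u.im ^ (ν + 2 + j))⁻¹ * (((1 + x ^ 2) ^ (ν + 2 + j))⁻¹ * (1 + x ^ 2) ^ j) := by ring
      _ ≤ _ := by gcongr

/-- The Eichler-type regularization used in weight `1/2`. -/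
theorem integral_theta_regularized (hB : 0 ≤ B) (hf : ∀ n, ‖f n‖ ≤ B) (hM : 0 < M) {v : ℂ}
    (hv : 0 < v.im) :
    ∫ x : ℝ in Set.Ioi 0, 2 * (-(2 * (I * Real.pi / M))⁻¹ *
        partialTheta 0 f M (v * ((1 + x ^ 2 : ℝ) : ℂ)) -
      v * ((1 + x ^ 2 : ℝ) : ℂ) * partialTheta 2 f M (v * ((1 + x ^ 2 : ℝ) : ℂ))) =
      -v * ∫ x : ℝ in Set.Ioi 0, 2 * partialTheta 2 f M (v * ((1 + x ^ 2 : ℝ) : ℂ)) := by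
  have hMc : (M : ℂ) ≠ 0 := by exact_mod_cast hM.ne'
  have hπ : (Real.pi : ℂ) ≠ 0 := by exact_mod_cast Real.pi_ne_zero
  have hv0 : v ≠ 0 := by rintro rfl; simp at hv
  have s0 := hasSum_integral_theta hB hf hM 0 0 hv
  have s2 := hasSum_integral_theta hB hf hM 2 2 hv
  have i0 := integrable_partialTheta hB hf hM 0 0 hv
  have i1 := integrable_partialTheta hB hf hM 2 0 hv
  have i2 := integrable_partialTheta hB hf hM 2 2 hv
  simp only [pow_zero, one_mul] at s0 i0 i1
  -- Termwise integration by parts. The left side is the x² part of the second summand of the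
  -- integrand and cancels against the first summand, leaving only a multiple of the integral of the
  -- series of exponent 2.
  have key : 2 * v * ∫ x : ℝ in Set.Ioi 0, (x : ℂ) ^ 2 *
      partialTheta 2 f M (v * ((1 + x ^ 2 : ℝ) : ℂ)) = -(I * Real.pi / M)⁻¹ *
      ∫ x : ℝ in Set.Ioi 0, partialTheta 0 f M (v * ((1 + x ^ 2 : ℝ) : ℂ)) := by
    rw [← s0.tsum_eq, ← s2.tsum_eq, ← tsum_mul_left, ← tsum_mul_left]
    refine tsum_congr fun n => ?_
    have hb := thetaExponent_re_pos hM n hv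
    have hn : ((n : ℕ) : ℂ) ≠ 0 := by exact_mod_cast n.pos.ne'
    have h1 : ∀ x : ℝ, (x : ℂ) ^ 2 * thetaTerm 2 f M n (v * ((1 + x ^ 2 : ℝ) : ℂ)) =
        thetaTerm 2 f M n v * ((x : ℂ) ^ 2 * cexp (-thetaExponent M n v * (x : ℂ) ^ 2)) := by
      intro x; rw [thetaTerm_mul_one_add_sq]; ring
    simp only [h1]
    simp only [thetaTerm_mul_one_add_sq]
    rw [integral_const_mul, integral_const_mul, integral_sq_mul_cexp_neg_mul_sq hb]
    generalize (∫ x : ℝ in Set.Ioi 0, cexp (-thetaExponent M n v * (x : ℂ) ^ 2)) = X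
    rw [thetaExponent, thetaTerm, thetaTerm]
    field_simp
  have h2 : ∀ x : ℝ, 2 * (-(2 * (I * Real.pi / M))⁻¹ *
        partialTheta 0 f M (v * ((1 + x ^ 2 : ℝ) : ℂ)) -
      v * ((1 + x ^ 2 : ℝ) : ℂ) * partialTheta 2 f M (v * ((1 + x ^ 2 : ℝ) : ℂ))) =
      -(I * Real.pi / M)⁻¹ * partialTheta 0 f M (v * ((1 + x ^ 2 : ℝ) : ℂ)) -
      2 * v * partialTheta 2 f M (v * ((1 + x ^ 2 : ℝ) : ℂ)) -
      2 * v * ((x : ℂ) ^ 2 * partialTheta 2 f M (v * ((1 + x ^ 2 : ℝ) : ℂ))) := by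
    intro x
    rw [mul_inv]
    push_cast
    ring
  simp only [h2]
  have i01 : IntegrableOn (fun x : ℝ =>
      -(I * Real.pi / M)⁻¹ * partialTheta 0 f M (v * ((1 + x ^ 2 : ℝ) : ℂ)) -
      2 * v * partialTheta 2 f M (v * ((1 + x ^ 2 : ℝ) : ℂ))) (Set.Ioi 0) :=
    (i0.const_mul _).sub (i1.const_mul _)
  rw [integral_sub i01 (i2.const_mul _), integral_sub (i0.const_mul _) (i1.const_mul _), integral_const_mul, integral_const_mul,
    integral_const_mul, key, integral_const_mul]
  ring

end bounded

end

section

open MeasureTheory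

/-! ### Consequences of a theta transformation law -/

/-- Polynomial growth together with rapid decay as `Im v → ∞`. -/
def ThetaBound (ψ : ℂ → ℂ) : Prop :=
  ∃ N₀ : ℕ, ∀ N ≥ N₀, ∃ K : ℝ, 0 ≤ K ∧ ∀ v : ℂ, 0 < v.im →
    ‖ψ v‖ ≤ K * (1 + ‖v‖) * (v.im ^ N)⁻¹

theorem thetaBound_partialTheta {f : ℤ → ℂ} {B : ℝ} {M : ℕ} (hB : 0 ≤ B) (hf : ∀ n, ‖f n‖ ≤ B)
    (hM : 0 < M) (ν : ℕ) : ThetaBound (partialTheta ν f M) := by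
  refine ⟨ν + 2, fun N hN => ?_⟩
  obtain ⟨K, hK0, hK⟩ := norm_partialTheta_le hB hf hM (ν := ν) (N := N) (by omega)
  refine ⟨K, hK0, fun v hv => (hK v hv).trans ?_⟩
  have h1 : K * 1 ≤ K * (1 + ‖v‖) := by
    gcongr
    linarith [norm_nonneg v]
  have h2 : (0 : ℝ) ≤ (v.im ^ N)⁻¹ := by positivity
  nlinarith

/-- The factor v in the second term is the reason for 1 + ‖v‖ in `ThetaBound`. -/
theorem thetaBound_regularized {f : ℤ → ℂ} {B : ℝ} {M : ℕ} (hB : 0 ≤ B) (hf : ∀ n, ‖f n‖ ≤ B)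
    (hM : 0 < M) (c : ℂ) :
    ThetaBound fun v => c * partialTheta 0 f M v - v * partialTheta 2 f M v := by
  refine ⟨4, fun N hN => ?_⟩
  obtain ⟨K, hK0, hK⟩ := norm_partialTheta_le hB hf hM (ν := 0) (N := N) (by omega)
  obtain ⟨K', hK0', hK'⟩ := norm_partialTheta_le hB hf hM (ν := 2) (N := N) (by omega)
  refine ⟨‖c‖ * K + K', by positivity, fun v hv => ?_⟩
  refine (norm_sub_le _ _).trans ?_
  rw [norm_mul, norm_mul]
  have h1 := hK v hv
  have h2 := hK' v hv
  have h3 : (0 : ℝ) ≤ (v.im ^ N)⁻¹ := by positivity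
  calc ‖c‖ * ‖partialTheta 0 f M v‖ + ‖v‖ * ‖partialTheta 2 f M v‖
      ≤ ‖c‖ * (K * (v.im ^ N)⁻¹) + ‖v‖ * (K' * (v.im ^ N)⁻¹) := by gcongr
    _ ≤ _ := by
      have h4 : 0 ≤ ‖v‖ * (‖c‖ * K * (v.im ^ N)⁻¹) := by positivity
      have h5 : 0 ≤ K' * (v.im ^ N)⁻¹ := by positivity
      nlinarith

theorem neg_inv_mul_im {c : ℝ} (hc : 0 < c) (u : ℂ) :
    (-1 / ((c : ℂ) * u)).im = u.im / (c * ‖u‖ ^ 2) := by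
  rw [neg_div, one_div, Complex.neg_im, Complex.inv_im, Complex.im_ofReal_mul,
    Complex.normSq_mul, Complex.normSq_ofReal, ← Complex.sq_norm, neg_div, neg_neg]
  rw [mul_assoc, mul_div_mul_left _ _ hc.ne']

theorem neg_inv_mul_im_pos {c : ℝ} (hc : 0 < c) {u : ℂ} (hu : 0 < u.im) :
    0 < (-1 / ((c : ℂ) * u)).im := by
  have hu0 : u ≠ 0 := by rintro rfl; simp at hu
  have := norm_pos_iff.2 hu0
  rw [neg_inv_mul_im hc]
  positivity

theorem norm_neg_inv_mul {c : ℝ} (hc : 0 < c) (u : ℂ) :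
    ‖-1 / ((c : ℂ) * u)‖ = (c * ‖u‖)⁻¹ := by
  rw [norm_div, norm_neg, norm_one, norm_mul, Complex.norm_real, Real.norm_eq_abs,
    abs_of_pos hc, one_div]

theorem norm_cexp_mul_log {u : ℂ} (hu : u ≠ 0) (s : ℝ) :
    ‖cexp ((s : ℂ) * Complex.log u)‖ = ‖u‖ ^ s := by
  rw [Complex.norm_exp, re_ofReal_mul, Complex.log_re, mul_comm, Real.rpow_def_of_pos
    (norm_pos_iff.2 hu)]

/-- Values of a theta-type function near the vertex of a cone, through inversion. -/
theorem exists_norm_inversion_le {ψ : ℂ → ℂ} (hψ : ThetaBound ψ) {c η : ℝ} (hc : 0 < c)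
    (hη : 0 < η) (m : ℕ) : ∃ K : ℝ, 0 ≤ K ∧ ∀ u ∈ cone η, ‖u‖ ≤ 1 →
      ‖ψ (-1 / ((c : ℂ) * u))‖ ≤ K * ‖u‖ ^ m := by
  obtain ⟨N₀, h⟩ := hψ
  -- The additional 1 compensates the factor |u|^{-1} that comes from 1 + ‖v‖ at v = -1/(cu).
  obtain ⟨K, hK0, hK⟩ := h (N₀ + m + 1) (by omega)
  refine ⟨K * (1 + c⁻¹) * (c / η) ^ (N₀ + m + 1), by positivity, fun u hu hu1 => ?_⟩
  have hui := im_pos_of_mem_cone hη hu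
  have hn : 0 < ‖u‖ := norm_pos_iff.2 hu.1
  refine (hK _ (neg_inv_mul_im_pos hc hui)).trans ?_
  rw [norm_neg_inv_mul hc, neg_inv_mul_im hc]
  have h1 : η / (c * ‖u‖) ≤ u.im / (c * ‖u‖ ^ 2) := by
    rw [div_le_div_iff₀ (by positivity) (by positivity)]
    have := hu.2
    have h2 : η * ‖u‖ * (c * ‖u‖) ≤ u.im * (c * ‖u‖) := by gcongr
    calc _ = η * ‖u‖ * (c * ‖u‖) := by ring
      _ ≤ _ := h2
  have h2 : ((u.im / (c * ‖u‖ ^ 2)) ^ (N₀ + m + 1))⁻¹ ≤ (c / η * ‖u‖) ^ (N₀ + m + 1) := by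
    rw [← inv_pow]
    refine pow_le_pow_left₀ (by positivity) ?_ _
    refine (inv_anti₀ (by positivity) h1).trans (le_of_eq ?_)
    field_simp
  have h3 : 1 + (c * ‖u‖)⁻¹ ≤ (1 + c⁻¹) * ‖u‖⁻¹ := by
    have : 1 ≤ ‖u‖⁻¹ := (one_le_inv₀ hn).2 hu1
    rw [mul_inv, add_mul]
    linarith
  calc _ ≤ K * ((1 + c⁻¹) * ‖u‖⁻¹) * (c / η * ‖u‖) ^ (N₀ + m + 1) := by gcongr
    _ = K * (1 + c⁻¹) * (c / η) ^ (N₀ + m + 1) * ‖u‖ ^ (N₀ + m) := by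
      rw [mul_pow, pow_succ ‖u‖]
      field_simp
    _ ≤ _ := by
      refine mul_le_mul_of_nonneg_left ?_ (by positivity)
      exact pow_le_pow_of_le_one hn.le hu1 (by omega)

/-- At ∞ in a cone the bound for ϑ itself suffices. At 0 the inversion moves the point far up, where
ψ decays faster than any power and beats |u|^{-3/2}. -/
theorem rapidDecay_of_inversion {ϑ ψ : ℂ → ℂ} (hϑ : ThetaBound ϑ) (hψ : ThetaBound ψ) {c : ℝ}
    (hc : 0 < c) (K : ℂ) (h : ∀ u : ℂ, 0 < u.im →
      ϑ u = K * cexp ((-(3 / 2) : ℝ) * Complex.log u) * ψ (-1 / ((c : ℂ) * u))) :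
    RapidDecay ϑ := by
  intro η hη N
  obtain ⟨N₀, h1⟩ := hϑ
  obtain ⟨K₁, hK0₁, hK₁⟩ := h1 (N₀ + N + 1) (by omega)
  obtain ⟨K₂, hK0₂, hK₂⟩ := exists_norm_inversion_le hψ hc hη (N + 2)
  set D₁ := 2 * K₁ * (η ^ (N₀ + N + 1))⁻¹ with hD₁
  set D₂ := ‖K‖ * K₂ with hD₂
  have hD₁0 : 0 ≤ D₁ := by positivity
  have hD₂0 : 0 ≤ D₂ := by positivity
  refine ⟨D₁ + D₂, fun u hu => ?_⟩
  have hui := im_pos_of_mem_cone hη hu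
  have hn : 0 < ‖u‖ := norm_pos_iff.2 hu.1
  rcases le_total ‖u‖ 1 with hu1 | hu1
  · have h2 : ‖ϑ u‖ ≤ D₂ * ‖u‖ ^ N := by
      rw [h u hui, norm_mul, norm_mul, norm_cexp_mul_log hu.1]
      have h3 := hK₂ u hu hu1
      have h4 : ‖u‖ ^ (-(3 / 2) : ℝ) ≤ ‖u‖ ^ (-2 : ℝ) :=
        Real.rpow_le_rpow_of_exponent_ge hn hu1 (by norm_num)
      have h5 : ‖u‖ ^ (-2 : ℝ) = (‖u‖ ^ 2)⁻¹ := by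
        rw [Real.rpow_neg hn.le]; norm_cast
      rw [h5] at h4
      calc _ ≤ ‖K‖ * (‖u‖ ^ 2)⁻¹ * (K₂ * ‖u‖ ^ (N + 2)) := by gcongr
        _ = _ := by rw [pow_add]; field_simp; rw [hD₂]
    refine ⟨h2.trans ?_, ?_⟩
    · have : 0 ≤ ‖u‖ ^ N := by positivity
      nlinarith
    · have h6 : ‖u‖ ^ N ≤ 1 := pow_le_one₀ hn.le hu1
      have h7 : 0 ≤ ‖u‖ ^ N := by positivity
      calc ‖ϑ u‖ * ‖u‖ ^ N ≤ (D₂ * 1) * 1 := by gcongr; exact h2.trans (by gcongr)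
        _ ≤ _ := by linarith
  · have h2 : ‖ϑ u‖ * ‖u‖ ^ N ≤ D₁ := by
      have h3 := hK₁ u hui
      have h4 : (u.im ^ (N₀ + N + 1))⁻¹ ≤ (η ^ (N₀ + N + 1))⁻¹ * (‖u‖ ^ (N + 1))⁻¹ := by
        rw [← mul_inv]
        refine inv_anti₀ (by positivity) ?_
        calc η ^ (N₀ + N + 1) * ‖u‖ ^ (N + 1) ≤ η ^ (N₀ + N + 1) * ‖u‖ ^ (N₀ + N + 1) := by
              gcongr
              omega
          _ = (η * ‖u‖) ^ (N₀ + N + 1) := (mul_pow _ _ _).symm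
          _ ≤ _ := by gcongr; exact hu.2
      calc ‖ϑ u‖ * ‖u‖ ^ N
          ≤ (K₁ * (2 * ‖u‖) * ((η ^ (N₀ + N + 1))⁻¹ * (‖u‖ ^ (N + 1))⁻¹)) * ‖u‖ ^ N := by
            gcongr
            refine h3.trans ?_
            gcongr
            linarith
        _ = D₁ := by rw [hD₁, pow_succ ‖u‖ N]; field_simp
    refine ⟨?_, h2.trans (by linarith)⟩
    have h6 : 1 ≤ ‖u‖ ^ N := one_le_pow₀ hu1
    have h7 : ‖ϑ u‖ ≤ ‖ϑ u‖ * ‖u‖ ^ N := le_mul_of_one_le_right (norm_nonneg _) h6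
    calc ‖ϑ u‖ ≤ D₁ * 1 := by linarith
      _ ≤ (D₁ + D₂) * ‖u‖ ^ N := by gcongr; linarith

/-- The inner part of the ray integral, through inversion. -/
theorem innerIntegral_of_inversion {ϑ ψ : ℂ → ℂ} {c : ℝ} (K : ℂ)
    (h : ∀ u : ℂ, 0 < u.im →
      ϑ u = K * cexp ((-(3 / 2) : ℝ) * Complex.log u) * ψ (-1 / ((c : ℂ) * u)))
    {u : ℂ} (hu : 0 < u.im) : innerIntegral ϑ u = K * cexp (-Complex.log u) *
      ∫ x : ℝ in Set.Ioi 0, 2 * ψ (-1 / ((c : ℂ) * u) * ((1 + x ^ 2 : ℝ) : ℂ)) := by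
  have hu0 : u ≠ 0 := by rintro rfl; simp at hu
  have h0 : cexp (-Complex.log u) =
      cexp (Complex.log u / 2) * cexp ((-(3 / 2) : ℝ) * Complex.log u) := by
    rw [← Complex.exp_add]
    congr 1
    push_cast
    ring
  rw [innerIntegral, h0, ← mul_assoc, mul_comm K, mul_assoc (cexp _), mul_assoc (cexp _)]
  congr 1
  rw [← integral_const_mul]
  refine setIntegral_congr_fun measurableSet_Ioi fun x _ => ?_
  have hr : (0 : ℝ) < 1 + x ^ 2 := by positivity
  set r := 1 + x ^ 2
  have hrc : (r : ℂ) ≠ 0 := by exact_mod_cast hr.ne'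
  have hui : 0 < (u / (r : ℂ)).im := by
    rw [Complex.div_ofReal_im]; positivity
  have h1 : Complex.log (u / (r : ℂ)) = Complex.log u - (Real.log r : ℝ) := by
    rw [div_eq_inv_mul, ← ofReal_inv, Complex.log_ofReal_mul (inv_pos.2 hr) hu0, Real.log_inv]
    push_cast
    ring
  have h2 : cexp ((-(3 / 2) : ℝ) * Complex.log (u / (r : ℂ))) =
      cexp ((-(3 / 2) : ℝ) * Complex.log u) * ((r * √r : ℝ) : ℂ) := by
    have h3 : r * √r = Real.exp (3 / 2 * Real.log r) := by
      rw [Real.sqrt_eq_rpow, Real.rpow_def_of_pos hr]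
      nth_rw 1 [← Real.exp_log hr]
      rw [← Real.exp_add]
      congr 1
      ring
    rw [h1, h3, ofReal_exp, ← Complex.exp_add]
    congr 1
    push_cast
    ring
  -- Inversion carries the segment from u to 0 to the ray from -1/(cu) to ∞. The power r^{3/2} from
  -- the automorphy factor cancels the weight in the inner integral.
  have h4 : -1 / ((c : ℂ) * (u / (r : ℂ))) = -1 / ((c : ℂ) * u) * (r : ℂ) := by
    field_simp
  have h5 : ((√r : ℝ) : ℂ) ≠ 0 := by exact_mod_cast (Real.sqrt_pos.2 hr).ne'
  rw [h _ hui, h2, h4]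
  push_cast
  field_simp

theorem log_neg_inv_mul {c : ℝ} (hc : 0 < c) {u : ℂ} (hu : 0 < u.im) :
    Complex.log (-1 / ((c : ℂ) * u)) = Real.pi * I - (Real.log c : ℝ) - Complex.log u := by
  have hu0 : u ≠ 0 := by rintro rfl; simp at hu
  have hcc : (c : ℂ) ≠ 0 := by exact_mod_cast hc.ne'
  have h1 : -1 / ((c : ℂ) * u) = cexp (Real.pi * I - (Real.log c : ℝ) - Complex.log u) := by
    rw [Complex.exp_sub, Complex.exp_sub, Complex.exp_pi_mul_I, ← ofReal_exp, Real.exp_log hc,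
      Complex.exp_log hu0]
    field_simp
  have him : (Real.pi * I - (Real.log c : ℝ) - Complex.log u).im = Real.pi - u.arg := by
    simp [Complex.log_im]
  rw [h1, Complex.log_exp]
  · rw [him]; linarith [arg_lt_pi_of_im_pos hu, Real.pi_pos]
  · rw [him]; linarith [arg_pos_of_im_pos hu]

section transform

variable {f₁ : ℤ → ℂ} {B₁ : ℝ} {M : ℕ}

/-- Integrals of theta series beyond a point. -/
theorem integral_two_mul_partialTheta (hB : 0 ≤ B₁) (hf : ∀ n, ‖f₁ n‖ ≤ B₁) (hM : 0 < M) (ν : ℕ)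
    {v : ℂ} (hv : 0 < v.im) :
    ∫ x : ℝ in Set.Ioi 0, 2 * partialTheta (ν + 1) f₁ M (v * ((1 + x ^ 2 : ℝ) : ℂ)) =
      cexp (-(Complex.log v / 2)) * (√M * cexp (Real.pi / 4 * I) * partialTheta ν f₁ M v) := by
  rw [← outerIntegral_partialTheta hB hf hM ν hv, outerIntegral, ← mul_assoc, ← Complex.exp_add,
    neg_add_cancel, Complex.exp_zero, one_mul]

/-- The modular case: a theta series of weight 3/2, whose inner integral becomes an outer integral
by inversion. The constant is fixed before the coefficient functions, since one multiplier must
serve the whole vector. -/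
theorem transform_zero (hM : 0 < M) {c : ℝ} (hc : 0 < c) {K : ℂ} (hK : K ≠ 0) :
    ∃ K' : ℂ, K' ≠ 0 ∧ ∀ {f₁ f₂ : ℤ → ℂ} {B₁ B₂ : ℝ}, 0 ≤ B₁ → (∀ n, ‖f₁ n‖ ≤ B₁) → 0 ≤ B₂ →
    (∀ n, ‖f₂ n‖ ≤ B₂) → (∀ u : ℂ, 0 < u.im → partialTheta 1 f₂ M u =
      K * cexp ((-(3 / 2) : ℝ) * Complex.log u) * partialTheta 1 f₁ M (-1 / ((c : ℂ) * u))) →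
    RapidDecay (partialTheta 1 f₂ M) ∧ ∀ u : ℂ, 0 < u.im →
      innerIntegral (partialTheta 1 f₂ M) u = K' * cexp ((-(1 / 2) : ℝ) * Complex.log u) *
        partialTheta 0 f₁ M (-1 / ((c : ℂ) * u)) := by
  have hM' : ((√M : ℝ) : ℂ) ≠ 0 := by
    have : (0 : ℝ) < M := by exact_mod_cast hM
    exact_mod_cast (Real.sqrt_pos.2 this).ne'
  refine ⟨K * (√M * cexp (Real.pi / 4 * I)) * cexp (-((Real.pi * I - (Real.log c : ℝ)) / 2)), ?_,
    fun {f₁ f₂ B₁ B₂} hB₁ hf₁ hB₂ hf₂ H =>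
      ⟨rapidDecay_of_inversion (thetaBound_partialTheta hB₂ hf₂ hM 1)
        (thetaBound_partialTheta hB₁ hf₁ hM 1) hc K H, fun u hu => ?_⟩⟩
  · exact mul_ne_zero (mul_ne_zero hK (mul_ne_zero hM' (Complex.exp_ne_zero _)))
      (Complex.exp_ne_zero _)
  · rw [innerIntegral_of_inversion K H hu,
      integral_two_mul_partialTheta hB₁ hf₁ hM 0 (neg_inv_mul_im_pos hc hu), log_neg_inv_mul hc hu]
    have h1 : cexp (-Complex.log u) *
        cexp (-((Real.pi * I - (Real.log c : ℝ) - Complex.log u) / 2)) =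
        cexp (-((Real.pi * I - (Real.log c : ℝ)) / 2)) *
          cexp ((-(1 / 2) : ℝ) * Complex.log u) := by
      rw [← Complex.exp_add, ← Complex.exp_add]
      congr 1
      push_cast
      ring
    linear_combination (K * (√M * cexp (Real.pi / 4 * I)) *
      partialTheta 0 f₁ M (-1 / ((c : ℂ) * u))) * h1

/-- The series of exponent 2 is up to a constant the derivative of a form of weight 1/2 and is only
quasimodular. Differentiating the transformation law adds a multiple of the series of exponent 0,
which `integral_theta_regularized` removes after integration. -/
theorem transform_one (hM : 0 < M) {c : ℝ} (hc : 0 < c) {K : ℂ} (hK : K ≠ 0) :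
    ∃ K' : ℂ, K' ≠ 0 ∧ ∀ {f₁ f₂ : ℤ → ℂ} {B₁ B₂ : ℝ}, 0 ≤ B₁ → (∀ n, ‖f₁ n‖ ≤ B₁) → 0 ≤ B₂ →
    (∀ n, ‖f₂ n‖ ≤ B₂) → (∀ u : ℂ, 0 < u.im → partialTheta 0 f₂ M u =
      K * cexp ((-(1 / 2) : ℝ) * Complex.log u) * partialTheta 0 f₁ M (-1 / ((c : ℂ) * u))) →
    RapidDecay (partialTheta 2 f₂ M) ∧ ∀ u : ℂ, 0 < u.im →
      innerIntegral (partialTheta 2 f₂ M) u = K' * cexp ((-(3 / 2) : ℝ) * Complex.log u) *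
        partialTheta 1 f₁ M (-1 / ((c : ℂ) * u)) := by
  have hM' : ((√M : ℝ) : ℂ) ≠ 0 := by
    have : (0 : ℝ) < M := by exact_mod_cast hM
    exact_mod_cast (Real.sqrt_pos.2 this).ne'
  have hMc : (M : ℂ) ≠ 0 := by exact_mod_cast hM.ne'
  have hcc : (c : ℂ) ≠ 0 := by exact_mod_cast hc.ne'
  have hπ : (Real.pi : ℂ) ≠ 0 := by exact_mod_cast Real.pi_ne_zero
  set lam : ℂ := I * Real.pi / M with hlam
  have hlam0 : lam ≠ 0 := div_ne_zero (mul_ne_zero I_ne_zero hπ) hMc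
  refine ⟨K * (√M * cexp (Real.pi / 4 * I)) * cexp (-((Real.pi * I - (Real.log c : ℝ)) / 2)) *
    (c : ℂ)⁻¹, ?_, fun {f₁ f₂ B₁ B₂} hB₁ hf₁ hB₂ hf₂ H => ?_⟩
  · exact mul_ne_zero (mul_ne_zero (mul_ne_zero hK (mul_ne_zero hM' (Complex.exp_ne_zero _)))
      (Complex.exp_ne_zero _)) (inv_ne_zero hcc)
  set ψ : ℂ → ℂ := fun v => -(2 * lam)⁻¹ * partialTheta 0 f₁ M v - v * partialTheta 2 f₁ M v with hψ
  have H2 : ∀ u : ℂ, 0 < u.im → partialTheta 2 f₂ M u =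
      K * cexp ((-(3 / 2) : ℝ) * Complex.log u) * ψ (-1 / ((c : ℂ) * u)) := by
    intro u hu
    have hu0 : u ≠ 0 := by rintro rfl; simp at hu
    have d1 := hasDerivAt_partialTheta hB₂ hf₂ hM 0 hu
    have d2 : HasDerivAt (fun u : ℂ => -1 / ((c : ℂ) * u)) (1 / ((c : ℂ) * u ^ 2)) u := by
      have := (((hasDerivAt_id u).const_mul (c : ℂ)).inv (mul_ne_zero hcc hu0)).const_mul (-1)
      refine (this.congr_deriv ?_).congr_of_eventuallyEq (Eventually.of_forall fun z => ?_)
      · simp only [id]; field_simp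
      · simp [div_eq_mul_inv]
    have d3 := (hasDerivAt_partialTheta hB₁ hf₁ hM 0 (neg_inv_mul_im_pos hc hu)).comp u d2
    have d4 := (((Complex.hasDerivAt_log (Or.inr hu.ne' : u ∈ slitPlane)).const_mul
      ((-(1 / 2) : ℝ) : ℂ)).cexp.const_mul K).mul d3
    have hev : partialTheta 0 f₂ M =ᶠ[𝓝 u] fun u => K * cexp ((-(1 / 2) : ℝ) * Complex.log u) *
        partialTheta 0 f₁ M (-1 / ((c : ℂ) * u)) := by
      filter_upwards [(isOpen_lt continuous_const Complex.continuous_im).mem_nhds hu] with z hz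
      exact H z hz
    have heq := d1.unique (d4.congr_of_eventuallyEq hev)
    have h1 : cexp ((-(3 / 2) : ℝ) * Complex.log u) =
        cexp ((-(1 / 2) : ℝ) * Complex.log u) * u⁻¹ := by
      conv_rhs => rw [← Complex.exp_log hu0]
      rw [← Complex.exp_neg, Complex.exp_log hu0, ← Complex.exp_add]
      congr 1
      push_cast
      ring
    rw [← hlam] at heq
    refine mul_left_cancel₀ hlam0 (heq.trans ?_)
    rw [h1, hψ]
    simp only [Function.comp]
    push_cast
    field_simp
    ring
  refine ⟨rapidDecay_of_inversion (thetaBound_partialTheta hB₂ hf₂ hM 2)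
    (thetaBound_regularized hB₁ hf₁ hM _) hc K H2, fun u hu => ?_⟩
  · have hu0 : u ≠ 0 := by rintro rfl; simp at hu
    have hv := neg_inv_mul_im_pos hc hu
    rw [innerIntegral_of_inversion K H2 hu, hψ]
    simp only [hlam]
    rw [integral_theta_regularized hB₁ hf₁ hM hv,
      integral_two_mul_partialTheta hB₁ hf₁ hM 1 hv, log_neg_inv_mul hc hu]
    have h1 : cexp (-Complex.log u) * u⁻¹ *
        cexp (-((Real.pi * I - (Real.log c : ℝ) - Complex.log u) / 2)) =
        cexp (-((Real.pi * I - (Real.log c : ℝ)) / 2)) *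
          cexp ((-(3 / 2) : ℝ) * Complex.log u) := by
      have : u⁻¹ = cexp (-Complex.log u) := by rw [Complex.exp_neg, Complex.exp_log hu0]
      rw [this, ← Complex.exp_add, ← Complex.exp_add, ← Complex.exp_add]
      congr 1
      push_cast
      ring
    have h2 : -(-1 / ((c : ℂ) * u)) = (c : ℂ)⁻¹ * u⁻¹ := by field_simp
    rw [h2]
    linear_combination (K * (√M * cexp (Real.pi / 4 * I)) * (c : ℂ)⁻¹ *
      partialTheta 1 f₁ M (-1 / ((c : ℂ) * u))) * h1

end transform

end

section

open MeasureTheory ZMod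

/-! ### Modularity of theta series of a finite quadratic form -/

section full

variable {f : ℤ → ℂ} {C : ℝ} {M : ℕ}

/-- The general term of a theta series over `ℤ`. -/
def fullTerm (e : ℕ) (f : ℤ → ℂ) (M : ℕ) (τ : ℂ) (n : ℤ) : ℂ :=
  (n : ℂ) ^ e * f n * cexp (I * Real.pi * (n : ℂ) ^ 2 * τ / M)

theorem summable_fullTerm (hC : 0 ≤ C) (hf : ∀ n, ‖f n‖ ≤ C) (hM : 0 < M) (e : ℕ) {τ : ℂ}
    (hτ : 0 < τ.im) : Summable (fullTerm e f M τ) := by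
  refine Summable.of_nat_of_neg ?_ ?_
  · rw [← summable_pnat_iff_summable_nat]
    exact (summable_norm_thetaTerm hC hf hM e hτ).of_norm.congr fun n => by
      simp [thetaTerm, fullTerm]
  · rw [← summable_pnat_iff_summable_nat (f := fun n : ℕ => fullTerm e f M τ (-(n : ℤ)))]
    refine ((summable_norm_thetaTerm hC (fun n => hf (-n)) hM e hτ).of_norm.mul_left
      ((-1) ^ e)).congr fun n => ?_
    simp only [thetaTerm, fullTerm]
    push_cast
    rw [neg_sq, neg_pow (_ : ℂ) e]
    ring

theorem tsum_fullTerm (hC : 0 ≤ C) (hf : ∀ n, ‖f n‖ ≤ C) (hM : 0 < M) {e : ℕ} {τ : ℂ}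
    (hτ : 0 < τ.im) (h0 : f 0 = 0) (hpar : ∀ n, f (-n) = (-1) ^ e * f n) :
    ∑' n, fullTerm e f M τ n = 2 * partialTheta e f M τ := by
  have h := tsum_int_eq_zero_add_two_mul_tsum_pnat (f := fullTerm e f M τ) (fun n => by
    simp only [fullTerm]
    rw [hpar]
    push_cast
    have : ((-1 : ℂ) ^ e) * (-1) ^ e = 1 := by rw [← mul_pow]; simp
    rw [neg_sq, neg_pow (_ : ℂ) e]
    linear_combination ((n : ℂ) ^ e * f n * cexp (I * Real.pi * (n : ℂ) ^ 2 * τ / M)) * this)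
    (summable_fullTerm hC hf hM e hτ)
  rw [h]
  simp [fullTerm, h0, partialTheta]

end full

section dft

variable {M : ℕ} [NeZero M]

theorem div_natCast_im_pos {z : ℂ} (hz : 0 < z.im) : 0 < (z / (M : ℂ)).im := by
  have : (0 : ℝ) < M := by exact_mod_cast NeZero.pos M
  rw [Complex.div_natCast_im]; positivity

theorem neg_inv_im_pos {z : ℂ} (hz : 0 < z.im) : 0 < (-1 / z).im := by
  have := neg_inv_mul_im_pos one_pos hz
  simpa using this

/-- The Jacobi functional equation at (-x/M, z/M). Completing the square makes the dual sum run over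
the class x + Mℤ. -/
theorem tsum_theta_residue_zero (x : ℂ) {z : ℂ} (hz : 0 < z.im) :
    ∑' n : ℤ, jacobiTheta₂_term n (-(x / M)) (z / M) =
      ((-I * (z / M)) ^ (1 / 2 : ℂ))⁻¹ *
        ∑' q : ℤ, cexp (I * Real.pi * (x + q * M) ^ 2 * (-1 / z) / M) := by
  have hMc : (M : ℂ) ≠ 0 := NeZero.ne _
  have hz0 : z ≠ 0 := by rintro rfl; simp at hz
  have h := jacobiTheta₂_functional_equation (-(x / M)) (z / M)
  rw [jacobiTheta₂] at h
  rw [h, jacobiTheta₂, one_div, mul_assoc, ← tsum_mul_left]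
  congr 1
  refine tsum_congr fun q => ?_
  rw [jacobiTheta₂_term, ← Complex.exp_add]
  congr 1
  field_simp
  ring

/-- The differentiated Jacobi equation; its correction term in the elliptic variable combines with
the dual index q into the factor x + qM. -/
theorem tsum_theta_residue_one (x : ℂ) {z : ℂ} (hz : 0 < z.im) :
    ∑' n : ℤ, (n : ℂ) * jacobiTheta₂_term n (-(x / M)) (z / M) =
      ((-I * (z / M)) ^ (1 / 2 : ℂ))⁻¹ * z⁻¹ *
        ∑' q : ℤ, (x + q * M) * cexp (I * Real.pi * (x + q * M) ^ 2 * (-1 / z) / M) := by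
  have hMc : (M : ℂ) ≠ 0 := NeZero.ne _
  have hz0 : z ≠ 0 := by rintro rfl; simp at hz
  have hπ : (Real.pi : ℂ) ≠ 0 := by exact_mod_cast Real.pi_ne_zero
  have hv : 0 < (-1 / (z / (M : ℂ))).im := neg_inv_im_pos (div_natCast_im_pos hz)
  have h := jacobiTheta₂'_functional_equation (-(x / M)) (z / M)
  have h1 : jacobiTheta₂' (-(x / M)) (z / M) =
      2 * Real.pi * I * ∑' n : ℤ, (n : ℂ) * jacobiTheta₂_term n (-(x / M)) (z / M) := by
    rw [jacobiTheta₂', ← tsum_mul_left]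
    exact tsum_congr fun n => by rw [jacobiTheta₂'_term]; ring
  have h2 := (((hasSum_jacobiTheta₂'_term (-(x / M) / (z / M)) hv).sub
    ((hasSum_jacobiTheta₂_term (-(x / M) / (z / M)) hv).mul_left
      (2 * Real.pi * I * (-(x / M))))).mul_left
      (cexp (-Real.pi * I * (-(x / M)) ^ 2 / (z / M)) / (z / M))).tsum_eq
  rw [h1, mul_div_assoc, mul_assoc (1 / _), ← h2, one_div] at h
  refine mul_left_cancel₀ (mul_ne_zero (mul_ne_zero two_ne_zero hπ) I_ne_zero) (h.trans ?_)
  rw [← mul_assoc, mul_comm (2 * Real.pi * I), mul_assoc, mul_assoc, mul_assoc, ← tsum_mul_left,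
    ← tsum_mul_left]
  rw [← tsum_mul_left]
  refine tsum_congr fun q => ?_
  have h3 : cexp (I * Real.pi * (x + q * M) ^ 2 * (-1 / z) / M) =
      cexp (-Real.pi * I * (-(x / M)) ^ 2 / (z / M)) *
        jacobiTheta₂_term q (-(x / M) / (z / M)) (-1 / (z / M)) := by
    rw [jacobiTheta₂_term, ← Complex.exp_add]
    congr 1
    field_simp
    ring
  rw [h3, jacobiTheta₂'_term]
  field_simp
  ring

/-- Residue and quotient modulo `M`. -/
def residueEquiv (M : ℕ) [NeZero M] : ZMod M × ℤ ≃ ℤ where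
  toFun p := (p.1.val : ℤ) + p.2 * M
  invFun n := ((n : ZMod M), n / M)
  left_inv p := by
    have h1 : ((p.1.val : ℤ) : ℤ) < M := by exact_mod_cast p.1.val_lt
    have h2 : (M : ℤ) ≠ 0 := by exact_mod_cast NeZero.ne M
    refine Prod.ext (by simp) ?_
    simp only
    rw [Int.add_mul_ediv_right _ _ h2, Int.ediv_eq_zero_of_lt (by positivity) h1, zero_add]
  right_inv n := by
    simp only [ZMod.val_intCast]
    rw [mul_comm]
    exact Int.emod_add_mul_ediv n M

theorem tsum_eq_sum_residue {g : ℤ → ℂ} (hg : Summable g) :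
    ∑' n, g n = ∑ j : ZMod M, ∑' q : ℤ, g ((j.val : ℤ) + q * M) := by
  rw [← (residueEquiv M).tsum_eq g]
  refine ((residueEquiv M).summable_iff.2 hg).tsum_prod.trans ?_
  rw [tsum_fintype]
  rfl

theorem exists_norm_le_zmod (Φ : ZMod M → ℂ) : ∃ C : ℝ, 0 ≤ C ∧ ∀ n : ℤ, ‖Φ n‖ ≤ C :=
  ⟨∑ j, ‖Φ j‖, Finset.sum_nonneg fun _ _ => norm_nonneg _, fun n =>
    Finset.single_le_sum (f := fun j => ‖Φ j‖) (fun _ _ => norm_nonneg _) (Finset.mem_univ (n : ZMod M))⟩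

theorem dft_intCast (Φ : ZMod M → ℂ) (n : ℤ) (w : ℂ) :
    𝓕 Φ n * cexp (I * Real.pi * (n : ℂ) ^ 2 * w / M) =
      ∑ j : ZMod M, Φ j * jacobiTheta₂_term n (-((j.val : ℂ) / M)) (w / M) := by
  rw [dft_apply, Finset.sum_mul]
  refine Finset.sum_congr rfl fun j _ => ?_
  have h : -(j * (n : ZMod M)) = ((-((j.val : ℤ) * n) : ℤ) : ZMod M) := by simp
  rw [h, stdAddChar_coe, jacobiTheta₂_term, smul_eq_mul, mul_comm _ (Φ j), mul_assoc,
    ← Complex.exp_add]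
  congr 2
  push_cast
  ring

/-- Expanding the Fourier transform gives one Jacobi theta function for each residue class.
Inverting these class by class recovers the theta series of Φ. Only the exponents 0 and 1 obey such
a pure law. -/
theorem tsum_dft (Φ : ZMod M → ℂ) {e : ℕ} (he : e ≤ 1) {z : ℂ} (hz : 0 < z.im) :
    ∑' n, fullTerm e (fun n => 𝓕 Φ n) M z n =
      ((-I * (z / M)) ^ (1 / 2 : ℂ))⁻¹ * (z⁻¹) ^ e *
        ∑' n, fullTerm e (fun n => Φ n) M (-1 / z) n := by
  obtain ⟨C, hC, hf⟩ := exists_norm_le_zmod Φ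
  have hzM := div_natCast_im_pos (M := M) hz
  rw [tsum_eq_sum_residue (M := M) (summable_fullTerm hC hf (NeZero.pos M) e (neg_inv_im_pos hz)),
    Finset.mul_sum]
  have h1 : ∀ n : ℤ, fullTerm e (fun n => 𝓕 Φ n) M z n =
      ∑ j : ZMod M, Φ j * ((n : ℂ) ^ e * jacobiTheta₂_term n (-((j.val : ℂ) / M)) (z / M)) := by
    intro n
    rw [fullTerm, mul_assoc, dft_intCast, Finset.mul_sum]
    exact Finset.sum_congr rfl fun j _ => by ring
  have hs : ∀ j : ZMod M, Summable fun n : ℤ =>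
      (n : ℂ) ^ e * jacobiTheta₂_term n (-((j.val : ℂ) / M)) (z / M) := by
    intro j
    interval_cases e
    · simpa using (hasSum_jacobiTheta₂_term (-((j.val : ℂ) / M)) hzM).summable
    · refine ((hasSum_jacobiTheta₂'_term (-((j.val : ℂ) / M)) hzM).summable.mul_left
        (2 * Real.pi * I)⁻¹).congr fun n => ?_
      have hπ : (Real.pi : ℂ) ≠ 0 := by exact_mod_cast Real.pi_ne_zero
      rw [jacobiTheta₂'_term]
      field_simp
  rw [tsum_congr h1, Summable.tsum_finsetSum fun j _ => (hs j).mul_left _]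
  refine Finset.sum_congr rfl fun j _ => ?_
  rw [tsum_mul_left]
  have h2 : ∀ q : ℤ, fullTerm e (fun n => Φ n) M (-1 / z) ((j.val : ℤ) + q * M) =
      Φ j * (((j.val : ℂ) + q * M) ^ e *
        cexp (I * Real.pi * ((j.val : ℂ) + q * M) ^ 2 * (-1 / z) / M)) := by
    intro q
    simp only [fullTerm]
    push_cast
    simp only [ZMod.natCast_val, ZMod.cast_id', id, CharP.cast_eq_zero, mul_zero, add_zero]
    ring
  rw [tsum_congr h2, tsum_mul_left]
  interval_cases e
  · simp only [pow_zero, one_mul, mul_one]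
    rw [tsum_theta_residue_zero _ hz]
    ring
  · simp only [pow_one]
    rw [tsum_theta_residue_one _ hz]
    ring

end dft

end

/-! ### A space of functions on ℤ/M stable under the Weil representation -/

section

open MeasureTheory ZMod
open UpperHalfPlane hiding I

section weil

variable {M : ℕ} [NeZero M]

/-- The quadratic character `n ↦ exp(πi n²/M)` on `ZMod M`, meant for even `M`. -/
def quadChar (M : ℕ) (n : ZMod M) : ℂ := cexp (I * Real.pi * (n.val : ℂ) ^ 2 / M)

/-- Replacing n by n - Mq changes n²/M by -2nq + Mq², an even integer because M is even. -/
theorem quadChar_intCast (hM : Even M) (n : ℤ) :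
    quadChar M n = cexp (I * Real.pi * (n : ℂ) ^ 2 / M) := by
  obtain ⟨m, hm⟩ := hM
  have hMc : (M : ℂ) ≠ 0 := NeZero.ne _
  have h1 : (((n : ZMod M).val : ℤ)) = n - M * (n / M) := by
    rw [ZMod.val_intCast, Int.emod_def]
  have h2 : (((n : ZMod M).val : ℂ)) = n - M * ((n / M : ℤ) : ℂ) := by exact_mod_cast congrArg (Int.cast : ℤ → ℂ) h1
  rw [quadChar, h2, Complex.exp_eq_exp_iff_exists_int]
  refine ⟨m * (n / M) ^ 2 - n * (n / M), ?_⟩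
  have hm' : (M : ℂ) = m + m := by exact_mod_cast congrArg (Nat.cast : ℕ → ℂ) hm
  push_cast
  field_simp
  rw [hm']
  ring

theorem quadChar_neg (hM : Even M) (n : ZMod M) : quadChar M (-n) = quadChar M n := by
  obtain ⟨n, rfl⟩ := ZMod.intCast_surjective n
  rw [← Int.cast_neg, quadChar_intCast hM, quadChar_intCast hM]
  push_cast
  ring_nf

theorem quadChar_ne_zero (n : ZMod M) : quadChar M n ≠ 0 := Complex.exp_ne_zero _

/-- The functions on `ZMod M` with the parity of `e` which change sign under multiplication by a
unit that preserves the quadratic character. -/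
def weilSet (M e : ℕ) : Set (ZMod M → ℂ) :=
  {Φ | (∀ n, Φ (-n) = (-1) ^ e * Φ n) ∧
    ∃ w : (ZMod M)ˣ, (∀ n, quadChar M (w * n) = quadChar M n) ∧ ∀ n, Φ (w * n) = -Φ n}

/-- The span of `weilSet`. -/
def weilSpace (M e : ℕ) : Submodule ℂ (ZMod M → ℂ) := Submodule.span ℂ (weilSet M e)

theorem weilSpace_apply_neg {e : ℕ} {Φ : ZMod M → ℂ} (h : Φ ∈ weilSpace M e) (n : ZMod M) :
    Φ (-n) = (-1) ^ e * Φ n := by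
  induction h using Submodule.span_induction with
  | mem Φ h => exact h.1 n
  | zero => simp
  | add Φ Ψ _ _ h1 h2 => simp only [Pi.add_apply, h1, h2]; ring
  | smul a Φ _ h => simp only [Pi.smul_apply, h, smul_eq_mul]; ring

/-- The point 0 is fixed by the unit w and the function changes sign under it. Vanishing at 0 alone
would not survive the Fourier transform; the sign change under w does. -/
theorem weilSpace_apply_zero {e : ℕ} {Φ : ZMod M → ℂ} (h : Φ ∈ weilSpace M e) : Φ 0 = 0 := by
  induction h using Submodule.span_induction with
  | mem Φ h =>
    obtain ⟨w, -, hw⟩ := h.2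
    have := hw 0
    rw [mul_zero] at this
    linear_combination this / 2
  | zero => simp
  | add Φ Ψ _ _ h1 h2 => simp only [Pi.add_apply, h1, h2, add_zero]
  | smul a Φ _ h => simp only [Pi.smul_apply, h, smul_zero]

/-- The Fourier transform preserves parity and turns multiplication by w in the argument into
multiplication by its inverse, so the sign change persists. -/
theorem dft_mem_weilSpace {e : ℕ} {Φ : ZMod M → ℂ} (h : Φ ∈ weilSpace M e) :
    𝓕 Φ ∈ weilSpace M e := by
  have hle : weilSpace M e ≤ (weilSpace M e).comap (dft (N := M) (E := ℂ)).toLinearMap := by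
    refine Submodule.span_le.2 fun Φ h => Submodule.subset_span ⟨fun n => ?_, ?_⟩
    · have h1 := congrFun (dft_comp_neg Φ) n
      rw [show (fun j => Φ (-j)) = fun j => (-1) ^ e * Φ j from funext h.1, dft_const_mul] at h1
      exact h1.symm
    · obtain ⟨w, hq, hw⟩ := h.2
      refine ⟨w, hq, fun n => ?_⟩
      have h1 := dft_comp_unitMul Φ w (w * n)
      rw [show (fun j => Φ (w * j)) = -Φ from funext hw, map_neg, Pi.neg_apply,
        Units.inv_mul_cancel_left] at h1
      simp only [LinearEquiv.coe_coe]
      linear_combination -h1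
  exact hle h

theorem quadChar_mul_mem_weilSpace (hM : Even M) {e : ℕ} {Φ : ZMod M → ℂ}
    (h : Φ ∈ weilSpace M e) : quadChar M * Φ ∈ weilSpace M e := by
  have hle : weilSpace M e ≤ (weilSpace M e).comap (LinearMap.mulLeft ℂ (quadChar M)) := by
    refine Submodule.span_le.2 fun Φ h => Submodule.subset_span ⟨fun n => ?_, ?_⟩
    · simp only [LinearMap.mulLeft_apply, Pi.mul_apply, quadChar_neg hM, h.1]
      ring
    · obtain ⟨w, hq, hw⟩ := h.2
      refine ⟨w, hq, fun n => ?_⟩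
      simp only [LinearMap.mulLeft_apply, Pi.mul_apply, hq, hw]
      ring
  exact hle h

/-- The Fourier transform on `weilSpace`. -/
def weilS (M e : ℕ) [NeZero M] : weilSpace M e ≃ₗ[ℂ] weilSpace M e :=
  LinearEquiv.ofInjectiveEndo
    ((dft (N := M) (E := ℂ)).toLinearMap.restrict fun _ h => dft_mem_weilSpace h)
    fun Φ Ψ h => Subtype.ext ((dft (N := M) (E := ℂ)).injective (congrArg Subtype.val h))

/-- Multiplication by the quadratic character on `weilSpace`. -/
def weilT (hM : Even M) (e : ℕ) : weilSpace M e ≃ₗ[ℂ] weilSpace M e :=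
  LinearEquiv.ofInjectiveEndo
    ((LinearMap.mulLeft ℂ (quadChar M)).restrict fun _ h => quadChar_mul_mem_weilSpace hM h)
    fun Φ Ψ h => Subtype.ext <| funext fun n =>
      mul_left_cancel₀ (quadChar_ne_zero n) (congrFun (congrArg Subtype.val h) n)

/-- The partial theta series of a function on `ZMod M`. -/
def zmodTheta (ν : ℕ) (Φ : ZMod M → ℂ) (τ : ℂ) : ℂ := partialTheta ν (fun n => Φ n) M τ

theorem tsum_zmodTheta {e : ℕ} {Φ : ZMod M → ℂ} (h : Φ ∈ weilSpace M e) {τ : ℂ} (hτ : 0 < τ.im) :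
    ∑' n, fullTerm e (fun n => Φ n) M τ n = 2 * zmodTheta e Φ τ := by
  obtain ⟨C, hC, hf⟩ := exists_norm_le_zmod Φ
  refine tsum_fullTerm hC hf (NeZero.pos M) hτ ?_ fun n => ?_
  · simpa using weilSpace_apply_zero h
  · simpa using weilSpace_apply_neg h n

theorem zmodTheta_const_mul (ν : ℕ) (a : ℂ) (Φ : ZMod M → ℂ) (τ : ℂ) :
    zmodTheta ν (a • Φ) τ = a * zmodTheta ν Φ τ := by
  rw [zmodTheta, zmodTheta, partialTheta, partialTheta, ← tsum_mul_left]
  refine tsum_congr fun n => ?_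
  simp only [Pi.smul_apply, smul_eq_mul]
  ring

theorem zmodTheta_S {e : ℕ} (he : e ≤ 1) {Φ : ZMod M → ℂ} (h : Φ ∈ weilSpace M e) {z : ℂ}
    (hz : 0 < z.im) : zmodTheta e Φ (-1 / z) =
      (-I * (z / M)) ^ (1 / 2 : ℂ) * z ^ e * zmodTheta e (𝓕 Φ) z := by
  have h1 := tsum_dft Φ he hz
  rw [tsum_zmodTheta (dft_mem_weilSpace h) hz, tsum_zmodTheta h (neg_inv_im_pos hz)] at h1
  have hz0 : z ≠ 0 := by rintro rfl; simp at hz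
  have hMc : (M : ℂ) ≠ 0 := NeZero.ne _
  have h2 : (-I * (z / M)) ^ (1 / 2 : ℂ) ≠ 0 := by
    rw [Ne, Complex.cpow_eq_zero_iff]
    simp [hz0, hMc, I_ne_zero]
  rw [inv_pow] at h1
  have h3 : z ^ e ≠ 0 := pow_ne_zero _ hz0
  generalize (-I * (z / M)) ^ (1 / 2 : ℂ) = x at h1 h2 ⊢
  field_simp at h1
  rw [neg_div]
  linear_combination -h1

theorem zmodTheta_T (hM : Even M) (ν : ℕ) (Φ : ZMod M → ℂ) (z : ℂ) :
    zmodTheta ν Φ (z + 1) = zmodTheta ν (quadChar M * Φ) z := by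
  rw [zmodTheta, zmodTheta, partialTheta, partialTheta]
  refine tsum_congr fun n => ?_
  have h1 : cexp (I * Real.pi * ((n : ℕ) : ℂ) ^ 2 * (z + 1) / M) =
      quadChar M ((n : ℕ) : ℤ) * cexp (I * Real.pi * ((n : ℕ) : ℂ) ^ 2 * z / M) := by
    rw [quadChar_intCast hM, ← Complex.exp_add]
    congr 1
    push_cast
    ring
  rw [h1]
  simp only [Pi.mul_apply]
  ring

theorem sqrt_factor {z : ℂ} (hz : 0 < z.im) :
    (-I * (z / M)) ^ (1 / 2 : ℂ) =
      cexp (-(Real.pi / 2 * I + (Real.log M : ℝ)) / 2) * cexp (Complex.log z / 2) := by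
  have hM : (0 : ℝ) < M := by exact_mod_cast NeZero.pos M
  have hMc : (M : ℂ) ≠ 0 := NeZero.ne _
  have hz0 : z ≠ 0 := by rintro rfl; simp at hz
  have h1 : -I * (z / M) = cexp (Complex.log z - (Real.pi / 2 * I + (Real.log M : ℝ))) := by
    rw [Complex.exp_sub, Complex.exp_add, Complex.exp_log hz0, Complex.exp_pi_div_two_mul_I,
      ← ofReal_exp, Real.exp_log hM]
    field_simp
    rw [ofReal_natCast]
    field_simp
    simp
  have him : (Complex.log z - (Real.pi / 2 * I + (Real.log M : ℝ))).im = z.arg - Real.pi / 2 := by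
    rw [show (Real.pi / 2 * I : ℂ) = ((Real.pi / 2 : ℝ) : ℂ) * I by push_cast; ring]
    simp [Complex.log_im]
  have h2 := arg_pos_of_im_pos hz
  have h3 := arg_lt_pi_of_im_pos hz
  rw [Complex.cpow_def_of_ne_zero (by simp [hz0, hMc, I_ne_zero]), h1, Complex.log_exp
    (by rw [him]; linarith) (by rw [him]; linarith), ← Complex.exp_add]
  congr 1
  ring

end weil

section modular

variable {M : ℕ} [NeZero M]

/-- The theta functions attached to `weilSpace` transform among themselves under `γ`. -/
def ThetaTransforms (M e : ℕ) [NeZero M] (γ : SL(2, ℤ)) : Prop :=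
  ∃ s : ℍ → ℂ, Continuous s ∧ (∀ z : ℍ, s z ^ 2 = denom γ z) ∧
    ∃ ρ : weilSpace M e ≃ₗ[ℂ] weilSpace M e, ∀ (Φ : weilSpace M e) (z : ℍ),
      zmodTheta e (Φ : ZMod M → ℂ) (γ • z : ℍ) =
        s z ^ (2 * e + 1) * zmodTheta e (ρ Φ : ZMod M → ℂ) z

theorem thetaTransforms_one (e : ℕ) : ThetaTransforms M e 1 :=
  ⟨fun _ => 1, continuous_const, fun z => by simp [ModularGroup.denom_apply], LinearEquiv.refl _ _,
    fun Φ z => by simp⟩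

theorem denom_mul_apply (γ₁ γ₂ : SL(2, ℤ)) (z : ℍ) :
    denom (γ₁ * γ₂ : SL(2, ℤ)) z = denom γ₁ (γ₂ • z : ℍ) * denom γ₂ z := by
  have := denom_cocycle_σ (γ₁ : GL (Fin 2) ℝ) (γ₂ : GL (Fin 2) ℝ) z
  have hσ : σ (γ₂ : GL (Fin 2) ℝ) = .refl ℝ ℂ := by simp [σ]
  rw [hσ] at this
  simpa using this

theorem continuous_smul_sl (γ : SL(2, ℤ)) : Continuous fun z : ℍ => γ • z :=
  continuous_const_smul (γ : GL (Fin 2) ℝ)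

/-- The continuous root s of the denominator is left unspecified, so no sign cocycle needs tracking;
products of roots are roots of the cocycle product. -/
theorem thetaTransforms_mul {e : ℕ} {γ₁ γ₂ : SL(2, ℤ)} (h₁ : ThetaTransforms M e γ₁)
    (h₂ : ThetaTransforms M e γ₂) : ThetaTransforms M e (γ₁ * γ₂) := by
  obtain ⟨s₁, hc₁, hs₁, ρ₁, hρ₁⟩ := h₁
  obtain ⟨s₂, hc₂, hs₂, ρ₂, hρ₂⟩ := h₂
  refine ⟨fun z => s₁ (γ₂ • z) * s₂ z, (hc₁.comp (continuous_smul_sl γ₂)).mul hc₂, fun z => ?_,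
    ρ₁.trans ρ₂, fun Φ z => ?_⟩
  · rw [mul_pow, hs₁, hs₂, denom_mul_apply]
  · rw [mul_smul, hρ₁, hρ₂, LinearEquiv.trans_apply]
    ring

theorem thetaTransforms_inv {e : ℕ} {γ : SL(2, ℤ)} (h : ThetaTransforms M e γ) :
    ThetaTransforms M e γ⁻¹ := by
  obtain ⟨s, hc, hs, ρ, hρ⟩ := h
  have hs0 : ∀ z, s z ≠ 0 := fun z h0 => by
    have := hs z
    rw [h0, zero_pow two_ne_zero] at this
    exact denom_ne_zero _ _ this.symm
  refine ⟨fun z => (s (γ⁻¹ • z))⁻¹, (hc.comp (continuous_smul_sl γ⁻¹)).inv₀ fun z => hs0 _,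
    fun z => ?_, ρ.symm, fun Φ z => ?_⟩
  · have h1 := denom_mul_apply γ γ⁻¹ z
    have h2 : denom (1 : SL(2, ℤ)) z = 1 := by simp [ModularGroup.denom_apply]
    rw [mul_inv_cancel, h2] at h1
    rw [inv_pow, hs]
    exact inv_eq_of_mul_eq_one_right h1.symm
  · have h1 := hρ (ρ.symm Φ) (γ⁻¹ • z)
    rw [smul_inv_smul, LinearEquiv.apply_symm_apply] at h1
    rw [h1, inv_pow, inv_mul_cancel_left₀ (pow_ne_zero _ (hs0 _))]

theorem thetaTransforms_T (hM : Even M) (e : ℕ) : ThetaTransforms M e ModularGroup.T := by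
  refine ⟨fun _ => 1, continuous_const, fun z => by
      rw [ModularGroup.denom_apply]; simp [ModularGroup.T],
    weilT hM e, fun Φ z => ?_⟩
  rw [modular_T_smul, one_pow, one_mul]
  have : (((1 : ℝ) +ᵥ z : ℍ) : ℂ) = z + 1 := by simp [add_comm]
  rw [this, zmodTheta_T hM]
  rfl

theorem thetaTransforms_S {e : ℕ} (he : e ≤ 1) : ThetaTransforms M e ModularGroup.S := by
  refine ⟨fun z => cexp (Complex.log z / 2), ?_, fun z => ?_,
    (weilS M e).trans (LinearEquiv.smulOfNeZero ℂ _
      (cexp (-(Real.pi / 2 * I + (Real.log M : ℝ)) / 2)) (Complex.exp_ne_zero _)), fun Φ z => ?_⟩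
  · refine Complex.continuous_exp.comp (Continuous.div_const ?_ _)
    exact UpperHalfPlane.continuous_coe.clog fun z => Or.inr z.im_pos.ne'
  · rw [ModularGroup.denom_S, ← Complex.exp_nat_mul]
    push_cast
    rw [mul_div_cancel₀ _ two_ne_zero, Complex.exp_log z.ne_zero]
  · have h1 : ((ModularGroup.S • z : ℍ) : ℂ) = -1 / z := by
      rw [modular_S_smul]; simp [neg_div, one_div, inv_neg]
    have h2 : cexp (Complex.log z / 2) ^ 2 = z := by
      rw [← Complex.exp_nat_mul]
      push_cast
      rw [mul_div_cancel₀ _ two_ne_zero, Complex.exp_log z.ne_zero]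
    rw [h1, zmodTheta_S he Φ.2 z.im_pos, sqrt_factor z.im_pos, pow_succ, pow_mul, h2]
    have h3 : ((((weilS M e).trans (LinearEquiv.smulOfNeZero ℂ _
        (cexp (-(Real.pi / 2 * I + (Real.log M : ℝ)) / 2)) (Complex.exp_ne_zero _))) Φ :
          weilSpace M e) : ZMod M → ℂ) =
        cexp (-(Real.pi / 2 * I + (Real.log M : ℝ)) / 2) • 𝓕 (Φ : ZMod M → ℂ) := rfl
    rw [h3, zmodTheta_const_mul]
    ring

theorem thetaTransforms (hM : Even M) {e : ℕ} (he : e ≤ 1) (γ : SL(2, ℤ)) :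
    ThetaTransforms M e γ := by
  have : γ ∈ Subgroup.closure {ModularGroup.S, ModularGroup.T} := by
    simp [SpecialLinearGroup.SL2Z_generators]
  induction this using Subgroup.closure_induction with
  | one => exact thetaTransforms_one e
  | mem g hg =>
    rcases hg with rfl | rfl
    · exact thetaTransforms_S he
    · exact thetaTransforms_T hM e
  | mul a b _ _ ha hb => exact thetaTransforms_mul ha hb
  | inv a _ ha => exact thetaTransforms_inv ha

end modular

end

section

open MeasureTheory ZMod
open UpperHalfPlane hiding I

/-! ### Modularity defects of partial theta series -/

/-- The fractional linear action as a function on `ℂ`. -/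
def moebius (γ : SL(2, ℤ)) (τ : ℂ) : ℂ :=
  (((γ 0 0 : ℤ) : ℂ) * τ + ((γ 0 1 : ℤ) : ℂ)) / (((γ 1 0 : ℤ) : ℂ) * τ + ((γ 1 1 : ℤ) : ℂ))

theorem coe_smul_eq_moebius (γ : SL(2, ℤ)) (z : ℍ) : ((γ • z : ℍ) : ℂ) = moebius γ z := by
  rw [UpperHalfPlane.specialLinearGroup_apply]
  simp [moebius]

theorem moebius_im_pos (γ : SL(2, ℤ)) {τ : ℂ} (hτ : 0 < τ.im) : 0 < (moebius γ τ).im := by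
  have := (γ • (⟨τ, hτ⟩ : ℍ)).im_pos
  rwa [UpperHalfPlane.im, coe_smul_eq_moebius] at this

theorem SL2_det_eq (γ : SL(2, ℤ)) : (γ 0 0 : ℤ) * γ 1 1 - γ 0 1 * γ 1 0 = 1 := by
  have := γ.2
  rwa [Matrix.det_fin_two] at this

/-- This is γτ = a/c - 1/(c(cτ + d)) in the coordinate u = τ + d/c. It reduces γ to the inversion u
↦ -1/(c²u) between two real translations. -/
theorem moebius_sub_div {γ : SL(2, ℤ)} (hγ : 0 < γ 1 0) {u : ℂ} (hu : u ≠ 0) :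
    moebius γ (u - ((γ 1 1 : ℝ) / (γ 1 0 : ℝ) : ℝ)) =
      -1 / ((((γ 1 0 : ℝ) ^ 2 : ℝ) : ℂ) * u) + ((γ 0 0 : ℝ) / (γ 1 0 : ℝ) : ℝ) := by
  have hc : ((γ 1 0 : ℤ) : ℂ) ≠ 0 := by exact_mod_cast hγ.ne'
  have hdet : ((γ 0 0 : ℤ) : ℂ) * (γ 1 1 : ℤ) - (γ 0 1 : ℤ) * (γ 1 0 : ℤ) = 1 := by
    exact_mod_cast congrArg (Int.cast : ℤ → ℂ) (SL2_det_eq γ)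
  have h1 : ((γ 1 0 : ℤ) : ℂ) * (u - ((γ 1 1 : ℤ) : ℂ) / ((γ 1 0 : ℤ) : ℂ)) + ((γ 1 1 : ℤ) : ℂ) =
      ((γ 1 0 : ℤ) : ℂ) * u := by
    field_simp; ring
  rw [moebius]
  push_cast
  rw [h1]
  field_simp
  linear_combination -hdet

/-- Multiplication by `exp(πi n² t/M)`. -/
def twist (M : ℕ) (f : ℤ → ℂ) (t : ℝ) (n : ℤ) : ℂ := f n * cexp (I * Real.pi * (n : ℂ) ^ 2 * t / M)

theorem norm_twist (M : ℕ) (f : ℤ → ℂ) (t : ℝ) (n : ℤ) : ‖twist M f t n‖ = ‖f n‖ := by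
  rw [twist, norm_mul, show I * Real.pi * (n : ℂ) ^ 2 * t / M =
    ((Real.pi * (n : ℝ) ^ 2 * t / M : ℝ) : ℂ) * I by push_cast; ring, norm_exp_ofReal_mul_I, mul_one]

/-- A real translation changes the coefficients by factors of absolute value 1. They need not remain
functions on ℤ/M, which is why the analytic part treats arbitrary bounded coefficients. -/
theorem partialTheta_twist (ν : ℕ) (f : ℤ → ℂ) (M : ℕ) (t : ℝ) (u : ℂ) :
    partialTheta ν (twist M f t) M u = partialTheta ν f M (u + t) := by
  refine tsum_congr fun n => ?_
  rw [twist, mul_assoc, mul_assoc (f _), ← Complex.exp_add, ← mul_assoc]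
  congr 2
  push_cast
  ring

section defect

variable {M : ℕ} [NeZero M]

theorem exists_norm_twist_le (Φ : ZMod M → ℂ) (t : ℝ) :
    ∃ C : ℝ, 0 ≤ C ∧ ∀ n : ℤ, ‖twist M (fun n => Φ n) t n‖ ≤ C := by
  obtain ⟨C, hC, h⟩ := exists_norm_le_zmod Φ
  exact ⟨C, hC, fun n => (norm_twist _ _ _ _).trans_le (h n)⟩

/-- On the connected upper half-plane the root s of cτ + d differs by a constant sign from
√c·exp(log(u)/2), with u = τ + d/c. So all constants are collected in K, which does not depend on Φ.
-/
theorem theta_inversion (hM : Even M) {e : ℕ} (he : e ≤ 1) {γ : SL(2, ℤ)} (hγ : 0 < γ 1 0) :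
    ∃ K : ℂ, K ≠ 0 ∧ ∃ ρ : weilSpace M e ≃ₗ[ℂ] weilSpace M e, ∀ (Φ : weilSpace M e) (u : ℂ),
      0 < u.im → zmodTheta e (ρ Φ : ZMod M → ℂ) (u - ((γ 1 1 : ℝ) / (γ 1 0 : ℝ) : ℝ)) =
        K * cexp ((-((e : ℝ) + 1 / 2) : ℝ) * Complex.log u) * zmodTheta e (Φ : ZMod M → ℂ)
          (-1 / ((((γ 1 0 : ℝ) ^ 2 : ℝ) : ℂ) * u) + ((γ 0 0 : ℝ) / (γ 1 0 : ℝ) : ℝ)) := by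
  obtain ⟨s, hsc, hs, ρ, hρ⟩ := thetaTransforms (M := M) hM he γ
  have hc : (0 : ℝ) < (γ 1 0 : ℤ) := by exact_mod_cast hγ
  have hcc : ((γ 1 0 : ℤ) : ℂ) ≠ 0 := by exact_mod_cast hγ.ne'
  set D : ℝ := (γ 1 1 : ℝ) / (γ 1 0 : ℝ) with hD
  have hcD : ((γ 1 0 : ℤ) : ℂ) * D = ((γ 1 1 : ℤ) : ℂ) := by
    rw [hD]; push_cast; field_simp
  have hci : ∀ z : ℍ, 0 < ((z : ℂ) + D).im := fun z => by simpa using z.im_pos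
  set κ : ℂ := cexp ((Real.log (γ 1 0 : ℤ) : ℝ) / 2) with hκ
  have hκ2 : κ ^ 2 = ((γ 1 0 : ℤ) : ℂ) := by
    rw [hκ, ← Complex.exp_nat_mul]
    push_cast
    rw [mul_div_cancel₀ _ two_ne_zero, ← ofReal_exp, Real.exp_log hc]
    simp
  set g : ℍ → ℂ := fun z => κ * cexp (Complex.log ((z : ℂ) + D) / 2) with hg
  have hg0 : ∀ z, g z ≠ 0 := fun z => mul_ne_zero (Complex.exp_ne_zero _) (Complex.exp_ne_zero _)
  have hgc : Continuous g := by
    refine continuous_const.mul (Complex.continuous_exp.comp (Continuous.div_const ?_ _))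
    exact (UpperHalfPlane.continuous_coe.add continuous_const).clog fun z => Or.inr (hci z).ne'
  have hsq : Set.EqOn (s ^ 2) (g ^ 2) Set.univ := fun z _ => by
    have h0 : (z : ℂ) + D ≠ 0 := fun h => by have := hci z; rw [h] at this; simp at this
    simp only [Pi.pow_apply]
    rw [hs, hg, mul_pow, hκ2, ← Complex.exp_nat_mul]
    push_cast
    rw [mul_div_cancel₀ _ two_ne_zero, Complex.exp_log h0, ModularGroup.denom_apply, mul_add, hcD]
  obtain ⟨ε, hε0, hε⟩ : ∃ ε : ℂ, ε ≠ 0 ∧ ∀ z, s z = ε * g z := by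
    rcases isPreconnected_univ.eq_or_eq_neg_of_sq_eq hsc.continuousOn hgc.continuousOn hsq
      (fun {z} _ => hg0 z) with h | h
    · exact ⟨1, one_ne_zero, fun z => by rw [one_mul]; exact h (Set.mem_univ z)⟩
    · exact ⟨-1, neg_ne_zero.2 one_ne_zero, fun z => by
        rw [neg_one_mul]; exact h (Set.mem_univ z)⟩
  refine ⟨((ε * κ) ^ (2 * e + 1))⁻¹,
    inv_ne_zero (pow_ne_zero _ (mul_ne_zero hε0 (Complex.exp_ne_zero _))), ρ, fun Φ u hu => ?_⟩
  have hu0 : u ≠ 0 := by rintro rfl; simp at hu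
  have hz : 0 < (u - (D : ℂ)).im := by simpa using hu
  have h1 := hρ Φ ⟨u - D, hz⟩
  rw [coe_smul_eq_moebius, hε, hg] at h1
  simp only [UpperHalfPlane.coe_mk, sub_add_cancel] at h1
  rw [moebius_sub_div hγ hu0] at h1
  rw [h1]
  have h2 : cexp ((-((e : ℝ) + 1 / 2) : ℝ) * Complex.log u) =
      (cexp (Complex.log u / 2) ^ (2 * e + 1))⁻¹ := by
    rw [← Complex.exp_nat_mul, ← Complex.exp_neg]
    congr 1
    push_cast
    ring
  have h3 := Complex.exp_ne_zero (Complex.log u / 2)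
  have h4 : κ ≠ 0 := Complex.exp_ne_zero _
  rw [h2]
  simp only [mul_pow]
  field_simp

/-- The decomposition of a partial theta series after an inversion. -/
theorem exists_transform (hM : Even M) {e ν : ℕ} (he : ν + e = 1) {γ : SL(2, ℤ)}
    (hγ : 0 < γ 1 0) : ∃ K : ℂ, K ≠ 0 ∧ ∃ ρ : weilSpace M e ≃ₗ[ℂ] weilSpace M e,
      ∀ (Φ : weilSpace M e), ∃ ϑ : ℂ → ℂ, DifferentiableOn ℂ ϑ {z | 0 < z.im} ∧ RapidDecay ϑ ∧
        (∀ u : ℂ, 0 < u.im → outerIntegral ϑ u = √M * cexp (Real.pi / 4 * I) *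
          zmodTheta ν (ρ Φ : ZMod M → ℂ) (u - ((γ 1 1 : ℝ) / (γ 1 0 : ℝ) : ℝ))) ∧
        ∀ u : ℂ, 0 < u.im → innerIntegral ϑ u = K * cexp ((-((ν : ℝ) + 1 / 2) : ℝ) *
          Complex.log u) * partialTheta ν (twist M (fun n => (Φ : ZMod M → ℂ) n)
            ((γ 0 0 : ℝ) / (γ 1 0 : ℝ))) M (-1 / ((((γ 1 0 : ℝ) ^ 2 : ℝ) : ℂ) * u)) := by
  have hc : (0 : ℝ) < ((γ 1 0 : ℤ) : ℝ) ^ 2 := by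
    have : (0 : ℝ) < (γ 1 0 : ℤ) := by exact_mod_cast hγ
    positivity
  have hM0 := NeZero.pos M
  obtain ⟨K, hK, ρ, hρ⟩ := theta_inversion (M := M) hM (by omega : e ≤ 1) hγ
  -- The cases (ν, e) = (0, 1) and (1, 0) rest on theta series of weight 3/2 and 1/2.
  have key : ∃ K' : ℂ, K' ≠ 0 ∧ ∀ {f₁ f₂ : ℤ → ℂ} {B₁ B₂ : ℝ}, 0 ≤ B₁ → (∀ n, ‖f₁ n‖ ≤ B₁) →
      0 ≤ B₂ → (∀ n, ‖f₂ n‖ ≤ B₂) → (∀ u : ℂ, 0 < u.im → partialTheta e f₂ M u =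
        K * cexp ((-((e : ℝ) + 1 / 2) : ℝ) * Complex.log u) *
          partialTheta e f₁ M (-1 / ((((γ 1 0 : ℝ) ^ 2 : ℝ) : ℂ) * u))) →
      RapidDecay (partialTheta (ν + 1) f₂ M) ∧ ∀ u : ℂ, 0 < u.im →
        innerIntegral (partialTheta (ν + 1) f₂ M) u = K' *
          cexp ((-((ν : ℝ) + 1 / 2) : ℝ) * Complex.log u) *
          partialTheta ν f₁ M (-1 / ((((γ 1 0 : ℝ) ^ 2 : ℝ) : ℂ) * u)) := by
    have h3 : (((1 : ℕ) : ℝ) + 1 / 2) = 3 / 2 := by norm_num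
    have h1 : (((0 : ℕ) : ℝ) + 1 / 2) = 1 / 2 := by norm_num
    obtain ⟨rfl, rfl⟩ | ⟨rfl, rfl⟩ : (ν = 0 ∧ e = 1) ∨ (ν = 1 ∧ e = 0) := by omega
    · rw [h3, h1]
      exact transform_zero hM0 hc hK
    · rw [h3, h1]
      exact transform_one hM0 hc hK
  obtain ⟨K', hK', h⟩ := key
  refine ⟨K', hK', ρ, fun Φ => ?_⟩
  obtain ⟨B₁, hB₁, hf₁⟩ := exists_norm_twist_le (Φ : ZMod M → ℂ) ((γ 0 0 : ℝ) / (γ 1 0 : ℝ))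
  obtain ⟨B₂, hB₂, hf₂⟩ :=
    exists_norm_twist_le (ρ Φ : ZMod M → ℂ) (-((γ 1 1 : ℝ) / (γ 1 0 : ℝ)))
  obtain ⟨h1, h2⟩ := h hB₁ hf₁ hB₂ hf₂ fun u hu => by
    rw [partialTheta_twist, partialTheta_twist, ofReal_neg, ← sub_eq_add_neg]
    exact hρ Φ u hu
  refine ⟨_, differentiableOn_partialTheta hB₂ hf₂ hM0 (ν + 1), h1, fun u hu => ?_, h2⟩
  rw [outerIntegral_partialTheta hB₂ hf₂ hM0 ν hu, partialTheta_twist, ofReal_neg,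
    ← sub_eq_add_neg]
  rfl

theorem sqrt_mul_exp_ne_zero : (√M : ℂ) * cexp (Real.pi / 4 * I) ≠ 0 := by
  have : (0 : ℝ) < M := by exact_mod_cast NeZero.pos M
  exact mul_ne_zero (by exact_mod_cast (Real.sqrt_pos.2 this).ne') (Complex.exp_ne_zero _)

/-- Partial theta series have asymptotic expansions in cones at rational points. -/
theorem exists_coneExp_zmodTheta (hM : Even M) {e ν : ℕ} (he : ν + e = 1)
    (Φ : weilSpace M e) (α : ℚ) : ∃ a, ConeExp (zmodTheta ν (Φ : ZMod M → ℂ)) α a := by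
  have hcop : IsCoprime (α.den : ℤ) (-α.num) := by
    rw [IsCoprime.neg_right_iff, Int.isCoprime_iff_gcd_eq_one, Int.gcd_comm]
    simpa [Int.gcd] using α.reduced
  -- The bottom row (den, -num) makes α = -d/c, so that u = τ - α and γ moves α to the cusp at
  -- infinity.
  obtain ⟨γ, hγ0, hγ1⟩ := hcop.exists_SL2_row 1
  have hγ : 0 < γ 1 0 := by rw [hγ0]; exact_mod_cast α.pos
  obtain ⟨K, hK, ρ, h⟩ := exists_transform (M := M) hM he hγ
  obtain ⟨ϑ, hd, hr, ho, hi⟩ := h (ρ.symm Φ)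
  rw [LinearEquiv.apply_symm_apply] at ho
  have hα : ((γ 1 1 : ℝ) / (γ 1 0 : ℝ) : ℝ) = -(α : ℝ) := by
    rw [hγ0, hγ1, Rat.cast_def]
    push_cast
    ring
  obtain ⟨B₁, hB₁, hf₁⟩ :=
    exists_norm_twist_le (ρ.symm Φ : ZMod M → ℂ) ((γ 0 0 : ℝ) / (γ 1 0 : ℝ))
  have hc : (0 : ℝ) < ((γ 1 0 : ℤ) : ℝ) ^ 2 := by
    have : (0 : ℝ) < (γ 1 0 : ℤ) := by exact_mod_cast hγ
    positivity
  refine ConeExp.of_forall_exists fun η hη => ?_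
  have hl0 : 𝓝[cone η] (0 : ℂ) ≤ 𝓝 0 := nhdsWithin_le_nhds
  obtain ⟨a, ha⟩ := exists_hasExp_rayIntegral hd hr hη
  -- The inner part is a power of u times a series evaluated far up in the half-plane, hence flat.
  -- So outer and ray integral have the same expansion.
  have hinner : HasExp (𝓝[cone η] 0) (innerIntegral ϑ) 0 := by
    refine HasExp.of_isBigO_pow fun N => ?_
    obtain ⟨B, hB, hBb⟩ := exists_norm_inversion_le
      (thetaBound_partialTheta hB₁ hf₁ (NeZero.pos M) ν) hc hη (N + ν + 1)
    refine IsBigO.of_bound (‖K‖ * B) ?_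
    have hball : ∀ᶠ u : ℂ in 𝓝[cone η] 0, ‖u‖ ≤ 1 := by
      refine hl0 ?_
      filter_upwards [Metric.closedBall_mem_nhds (0 : ℂ) one_pos] with u hu
      simpa using hu
    filter_upwards [self_mem_nhdsWithin, hball] with u hu hu1
    have hui := im_pos_of_mem_cone hη hu
    have hn : 0 < ‖u‖ := norm_pos_iff.2 hu.1
    rw [hi u hui, norm_mul, norm_mul, norm_cexp_mul_log hu.1, norm_pow]
    have h2 : ‖u‖ ^ (-((ν : ℝ) + 1 / 2)) ≤ (‖u‖ ^ (ν + 1))⁻¹ := by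
      rw [← Real.rpow_natCast, ← Real.rpow_neg hn.le]
      refine Real.rpow_le_rpow_of_exponent_ge hn hu1 ?_
      push_cast
      linarith
    calc _ ≤ ‖K‖ * (‖u‖ ^ (ν + 1))⁻¹ * (B * ‖u‖ ^ (N + ν + 1)) := by
          gcongr
          exact hBb u hu hu1
      _ = ‖K‖ * B * ‖u‖ ^ N := by
          rw [add_assoc, pow_add ‖u‖ N]
          field_simp
  have h3 := ((ha.sub (hinner.const_mul hl0 I)).const_mul hl0
    ((√M : ℂ) * cexp (Real.pi / 4 * I))⁻¹)
  refine ⟨_, h3.congr' ?_⟩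
  filter_upwards [self_mem_nhdsWithin] with u hu
  rw [add_sub_cancel_right, ho u (im_pos_of_mem_cone hη hu),
    inv_mul_cancel_left₀ sqrt_mul_exp_ne_zero, hα]
  congr 1
  push_cast
  ring

end defect

end

/-! ### The branch of J_γ^{1/2} and holomorphy of the defects -/

section

open MeasureTheory ZMod
open UpperHalfPlane hiding I

section branch

/-- `c τ + d` as a function on `ℂ`. -/
def denomC (γ : SL(2, ℤ)) (τ : ℂ) : ℂ := ((γ 1 0 : ℤ) : ℂ) * τ + ((γ 1 1 : ℤ) : ℂ)

theorem denomC_ratCast (γ : SL(2, ℤ)) (α : ℚ) : denomC γ α = ((denomQ γ α : ℚ) : ℂ) := by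
  simp [denomC, denomQ]

theorem sqrtDenom_eq (γ : SL(2, ℤ)) (α : ℚ) (τ : ℂ) : sqrtDenom γ α τ =
    sqrtDenomAt γ α * (denomC γ τ / ((denomQ γ α : ℚ) : ℂ)) ^ (1 / 2 : ℂ) := rfl

theorem denomQ_neg (γ : SL(2, ℤ)) (α : ℚ) : denomQ (-γ) α = -denomQ γ α := by
  simp only [denomQ, Matrix.SpecialLinearGroup.coe_neg, Matrix.neg_apply]
  push_cast
  ring

theorem denomC_neg (γ : SL(2, ℤ)) (τ : ℂ) : denomC (-γ) τ = -denomC γ τ := by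
  simp only [denomC, Matrix.SpecialLinearGroup.coe_neg, Matrix.neg_apply]
  push_cast
  ring

theorem moebius_neg (γ : SL(2, ℤ)) (τ : ℂ) : moebius (-γ) τ = moebius γ τ := by
  have h := denomC_neg γ τ
  simp only [denomC] at h
  rw [moebius, moebius, h, div_neg, ← neg_div]
  simp only [Matrix.SpecialLinearGroup.coe_neg, Matrix.neg_apply]
  push_cast
  ring_nf

/-- The convention -i for c > 0 and i for c ≤ 0 makes the ratio of the two branches equal to i on
both sides of -d/c. -/
theorem sqrtDenom_neg {γ : SL(2, ℤ)} (hγ : 0 < γ 1 0) {α : ℚ} (hα : denomQ γ α ≠ 0) (τ : ℂ) :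
    sqrtDenom (-γ) α τ = I * sqrtDenom γ α τ := by
  have hγ' : ¬ 0 < (-γ) 1 0 := by
    simp only [Matrix.SpecialLinearGroup.coe_neg, Matrix.neg_apply]
    omega
  rw [sqrtDenom_eq, sqrtDenom_eq, denomC_neg, denomQ_neg, Rat.cast_neg, neg_div_neg_eq, ← mul_assoc]
  congr 1
  rw [sqrtDenomAt, sqrtDenomAt, denomQ_neg, if_neg hγ', if_pos hγ]
  rcases lt_or_gt_of_ne hα with h | h
  · rw [if_pos (by linarith), if_neg (by linarith)]
    rw [Rat.cast_neg, ← mul_assoc, mul_neg, I_mul_I]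
    simp
  · rw [if_neg (by linarith), if_pos h]
    simp

/-- The sign of a rational number as a complex number. -/
def signQ (x : ℚ) : ℂ := if 0 < x then 1 else -1

theorem signQ_ne_zero (x : ℚ) : signQ x ≠ 0 := by
  rw [signQ]; split_ifs <;> simp

theorem signQ_sq (x : ℚ) : signQ x ^ 2 = 1 := by
  rw [signQ]; split_ifs <;> simp

/-- To the right of -d/c the chosen branch is the root √c·exp(log(u)/2) on the upper half-plane; to
the left that root tends to i√|J|, and the convention takes its negative. -/
theorem sqrtDenom_of_pos {γ : SL(2, ℤ)} (hγ : 0 < γ 1 0) {α : ℚ} (hα : denomQ γ α ≠ 0) {u : ℂ}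
    (hu : 0 < u.im) :
    sqrtDenom γ α (u - ((γ 1 1 : ℝ) / (γ 1 0 : ℝ) : ℝ)) =
      signQ (denomQ γ α) * (cexp ((Real.log (γ 1 0 : ℤ) : ℝ) / 2) * cexp (Complex.log u / 2)) := by
  have hu0 : u ≠ 0 := by rintro rfl; simp at hu
  have hc : (0 : ℝ) < (γ 1 0 : ℤ) := by exact_mod_cast hγ
  have hcc : ((γ 1 0 : ℤ) : ℂ) ≠ 0 := by exact_mod_cast hγ.ne'
  set j : ℝ := (denomQ γ α : ℝ) with hj
  have hjc : ((denomQ γ α : ℚ) : ℂ) = (j : ℂ) := by rw [hj]; simp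
  have h1 : denomC γ (u - ((γ 1 1 : ℝ) / (γ 1 0 : ℝ) : ℝ)) = ((γ 1 0 : ℤ) : ℂ) * u := by
    rw [denomC]; push_cast; field_simp; ring
  have hsqrt : ∀ x : ℝ, 0 < x → ((√x : ℝ) : ℂ) = cexp ((Real.log x : ℝ) / 2) := by
    intro x hx
    rw [Real.sqrt_eq_rpow, Real.rpow_def_of_pos hx, ofReal_exp]
    congr 1
    push_cast
    ring
  rw [sqrtDenom_eq, h1, hjc, sqrtDenomAt, signQ]
  rcases lt_or_gt_of_ne hα with h | h
  · have hj0 : j < 0 := by rw [hj]; exact_mod_cast h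
    have h2 : ((γ 1 0 : ℤ) : ℂ) * u / (j : ℂ) = ((((γ 1 0 : ℤ) : ℝ) / (-j) : ℝ) : ℂ) * (-u) := by
      have : (j : ℂ) ≠ 0 := by exact_mod_cast hj0.ne
      push_cast
      field_simp
    have h3 : Complex.log (-u) = Complex.log u - Real.pi * I := by
      have h4 : -u = cexp (Complex.log u - Real.pi * I) := by
        rw [Complex.exp_sub, Complex.exp_pi_mul_I, Complex.exp_log hu0, div_neg, div_one]
      have him : (Complex.log u - Real.pi * I).im = u.arg - Real.pi := by simp [Complex.log_im]
      rw [h4, Complex.log_exp]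
      · rw [him]; linarith [arg_pos_of_im_pos hu]
      · rw [him]; linarith [arg_lt_pi_of_im_pos hu, Real.pi_pos]
    have hq : 0 < ((γ 1 0 : ℤ) : ℝ) / (-j) := div_pos hc (by linarith)
    rw [if_neg (by linarith), if_pos hγ, if_neg (by linarith), h2, hsqrt _ (by linarith),
      Complex.cpow_def_of_ne_zero (mul_ne_zero (by exact_mod_cast hq.ne') (neg_ne_zero.2 hu0)),
      Complex.log_ofReal_mul hq (neg_ne_zero.2 hu0), h3, Real.log_div hc.ne' (by linarith)]
    have h5 : -I = cexp (-(Real.pi / 2 * I)) := by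
      rw [Complex.exp_neg, Complex.exp_pi_div_two_mul_I, Complex.inv_I]
    have h6 : (-1 : ℂ) = cexp (-(Real.pi * I)) := by
      rw [Complex.exp_neg, Complex.exp_pi_mul_I]; norm_num
    rw [h5, h6, ← Complex.exp_add, ← Complex.exp_add, ← Complex.exp_add, ← Complex.exp_add]
    congr 1
    push_cast
    ring
  · have hj0 : 0 < j := by rw [hj]; exact_mod_cast h
    have h2 : ((γ 1 0 : ℤ) : ℂ) * u / (j : ℂ) = ((((γ 1 0 : ℤ) : ℝ) / j : ℝ) : ℂ) * u := by
      push_cast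
      ring
    have hq : 0 < ((γ 1 0 : ℤ) : ℝ) / j := div_pos hc hj0
    rw [if_pos h, if_pos h, h2, hsqrt _ hj0,
      Complex.cpow_def_of_ne_zero (mul_ne_zero (by exact_mod_cast hq.ne') hu0),
      Complex.log_ofReal_mul hq hu0, Real.log_div hc.ne' hj0.ne', one_mul,
      ← Complex.exp_add, ← Complex.exp_add]
    congr 1
    push_cast
    ring

end branch

section defect

variable {M : ℕ} [NeZero M]

/-- The defects of modularity under `γ` of the theta functions attached to `weilSpace` are
holomorphic near the reals. -/
def DefectHol (M e ν : ℕ) [NeZero M] (γ : SL(2, ℤ)) : Prop :=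
  ∃ E : weilSpace M e ≃ₗ[ℂ] weilSpace M e, ∀ Φ : weilSpace M e, ∃ h : ℂ → ℂ, HolNearReals γ h ∧
    ∀ α : ℚ, denomQ γ α ≠ 0 → ∀ᶠ τ in 𝓝[{τ : ℂ | 0 < τ.im}] (α : ℂ),
      zmodTheta ν (Φ : ZMod M → ℂ) τ - sqrtDenom γ α τ ^ (-(2 * (ν : ℤ) + 1)) *
        zmodTheta ν (E Φ : ZMod M → ℂ) (moebius γ τ) = h τ

/-- The vertical ray integral at u = τ + d/c, suitably scaled, is the defect. It equals outer -
i·inner to the right of -d/c and outer + i·inner to the left, where outer is the theta series at τ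
and inner the transformed one. The sign of J_γ^{1/2} changes at the same place, so a single function
serves both sides. -/
theorem defectHol_of_pos (hM : Even M) {e ν : ℕ} (he : ν + e = 1) {γ : SL(2, ℤ)}
    (hγ : 0 < γ 1 0) : DefectHol M e ν γ := by
  obtain ⟨K, hK, ρ, H⟩ := exists_transform (M := M) hM he hγ
  have hc : (0 : ℝ) < (γ 1 0 : ℤ) := by exact_mod_cast hγ
  have hcc : ((γ 1 0 : ℤ) : ℂ) ≠ 0 := by exact_mod_cast hγ.ne'
  set C₁ : ℂ := (√M : ℂ) * cexp (Real.pi / 4 * I) with hC₁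
  have hC₁0 : C₁ ≠ 0 := sqrt_mul_exp_ne_zero
  set κ : ℂ := cexp ((Real.log (γ 1 0 : ℤ) : ℝ) / 2) with hκ
  have hκ0 : κ ≠ 0 := Complex.exp_ne_zero _
  -- This scalar collects the jump factor i, the constant of the inner part, the powers of √c and
  -- the constant of the outer part.
  set A : ℂ := I * K * κ ^ (2 * ν + 1) / C₁ with hA
  have hA0 : A ≠ 0 := div_ne_zero (mul_ne_zero (mul_ne_zero I_ne_zero hK) (pow_ne_zero _ hκ0)) hC₁0
  refine ⟨ρ.symm.trans (LinearEquiv.smulOfNeZero ℂ _ A hA0), fun Φ => ?_⟩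
  obtain ⟨ϑ, hd, hr, ho, hi⟩ := H (ρ.symm Φ)
  rw [LinearEquiv.apply_symm_apply] at ho
  set D : ℝ := (γ 1 1 : ℝ) / (γ 1 0 : ℝ) with hD
  have hJ : ∀ x : ℝ, ((γ 1 0 : ℤ) : ℝ) * x + ((γ 1 1 : ℤ) : ℝ) = ((γ 1 0 : ℤ) : ℝ) * (x + D) := by
    intro x; rw [hD]; field_simp
  refine ⟨fun τ => C₁⁻¹ * rayIntegral ϑ (Real.pi / 2) (τ + D), fun x hx => ?_, fun α hα => ?_⟩
  · rw [hJ] at hx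
    have h1 := analyticAt_rayIntegral hd hr (right_ne_zero_of_mul hx)
    have h2 : AnalyticAt ℂ (fun τ : ℂ => τ + D) (x : ℂ) := by fun_prop
    refine analyticAt_const.mul (AnalyticAt.fun_comp ?_ h2)
    rw [← ofReal_add]
    exact h1
  · have hjα : (denomQ γ α : ℝ) = ((γ 1 0 : ℤ) : ℝ) * ((α : ℝ) + D) := by
      rw [← hJ, denomQ]; push_cast; ring
    have hαre : ((α : ℂ)).re = (α : ℝ) := by
      rw [show (α : ℂ) = ((α : ℝ) : ℂ) by push_cast; rfl, ofReal_re]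
    have key : ∀ᶠ τ : ℂ in 𝓝[{τ : ℂ | 0 < τ.im}] (α : ℂ), 0 < τ.im →
        rayIntegral ϑ (Real.pi / 2) (τ + D) = outerIntegral ϑ (τ + D) -
          signQ (denomQ γ α) * I * innerIntegral ϑ (τ + D) := by
      have hcont : ContinuousAt (fun τ : ℂ => (τ + D).re) (α : ℂ) := by fun_prop
      refine nhdsWithin_le_nhds ?_
      rcases lt_or_gt_of_ne hα with h | h
      · have h1 : ((α : ℂ) + D).re < 0 := by
          have : (denomQ γ α : ℝ) < 0 := by exact_mod_cast h
          rw [hjα] at this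
          rw [add_re, hαre, ofReal_re]
          by_contra h2
          push Not at h2
          linarith [mul_nonneg hc.le h2]
        filter_upwards [hcont.eventually_lt_const h1] with τ h2 hτ
        have hu : 0 < (τ + D).im := by simpa using hτ
        rw [rayIntegral_of_lt_arg hd hr hu (by linarith [Real.pi_pos]) (by
          by_contra h3
          push Not at h3
          have := Complex.abs_arg_le_pi_div_two_iff.1
            (abs_le.2 ⟨by linarith [arg_pos_of_im_pos hu, Real.pi_pos], h3⟩)
          linarith), signQ, if_neg (by linarith)]
        ring
      · have h1 : 0 < ((α : ℂ) + D).re := by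
          have : 0 < (denomQ γ α : ℝ) := by exact_mod_cast h
          rw [hjα] at this
          rw [add_re, hαre, ofReal_re]
          exact (mul_pos_iff_of_pos_left hc).1 this
        filter_upwards [hcont.eventually_const_lt h1] with τ h2 hτ
        have hu : 0 < (τ + D).im := by simpa using hτ
        rw [rayIntegral_of_arg_lt hd hr hu (by linarith [Real.pi_pos])
          ((le_abs_self _).trans_lt (Complex.abs_arg_lt_pi_div_two_iff.2 (Or.inl h2))),
          signQ, if_pos h]
        ring
    filter_upwards [key, self_mem_nhdsWithin] with τ hτ hτi
    have hτi' : 0 < τ.im := hτi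
    have hu : 0 < (τ + D).im := by simpa using hτi'
    have hu0 : τ + D ≠ 0 := fun h => by rw [h] at hu; simp at hu
    have hs := sqrtDenom_of_pos hγ hα hu
    have hm := moebius_sub_div hγ hu0
    rw [← hD, add_sub_cancel_right] at hs hm
    rw [hτ hτi', ho _ hu, hi _ hu, add_sub_cancel_right, partialTheta_twist, ← hm, hs]
    have h2 : cexp ((-((ν : ℝ) + 1 / 2) : ℝ) * Complex.log (τ + D)) =
        (cexp (Complex.log (τ + D) / 2) ^ (2 * ν + 1))⁻¹ := by
      rw [← Complex.exp_nat_mul, ← Complex.exp_neg]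
      congr 1
      push_cast
      ring
    have h3 := Complex.exp_ne_zero (Complex.log (τ + D) / 2)
    -- The weight ν + 1/2 means an odd power of J_γ^{1/2}, so the sign of the branch survives.
    have h4 : signQ (denomQ γ α) ^ (2 * ν + 1) = signQ (denomQ γ α) := by
      rw [pow_succ, pow_mul, signQ_sq, one_pow, one_mul]
    have h4' := signQ_ne_zero (denomQ γ α)
    have h5 : ((ρ.symm.trans (LinearEquiv.smulOfNeZero ℂ _ A hA0)) Φ : ZMod M → ℂ) =
        A • (ρ.symm Φ : ZMod M → ℂ) := rfl
    have h6 : (signQ (denomQ γ α))⁻¹ = signQ (denomQ γ α) :=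
      inv_eq_of_mul_eq_one_right (by rw [← sq, signQ_sq])
    have h7 : ∀ x : ℂ, x ^ (-(2 * (ν : ℤ) + 1)) = (x ^ (2 * ν + 1))⁻¹ := fun x => by
      rw [zpow_neg]; norm_cast
    rw [h5, zmodTheta_const_mul, h7, mul_pow, mul_pow, h4, h2, mul_inv, h6, hA, ← hκ, mul_inv]
    have h8 : partialTheta ν (fun n => (ρ.symm Φ : ZMod M → ℂ) n) M (moebius γ τ) =
      zmodTheta ν (ρ.symm Φ : ZMod M → ℂ) (moebius γ τ) := rfl
    rw [h8]
    field_simp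

theorem defectHol_neg {e ν : ℕ} {γ : SL(2, ℤ)} (hγ : 0 < γ 1 0) (h : DefectHol M e ν γ) :
    DefectHol M e ν (-γ) := by
  obtain ⟨E, hE⟩ := h
  refine ⟨E.trans (LinearEquiv.smulOfNeZero ℂ _ (I ^ (2 * ν + 1)) (pow_ne_zero _ I_ne_zero)),
    fun Φ => ?_⟩
  obtain ⟨h, hh, hE⟩ := hE Φ
  refine ⟨h, fun x hx => hh x fun h0 => hx ?_, fun α hα => ?_⟩
  · simp only [Matrix.SpecialLinearGroup.coe_neg, Matrix.neg_apply]
    push_cast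
    linear_combination -h0
  · rw [denomQ_neg, neg_ne_zero] at hα
    filter_upwards [hE α hα] with τ hτ
    have h5 : ((E.trans (LinearEquiv.smulOfNeZero ℂ _ (I ^ (2 * ν + 1))
        (pow_ne_zero _ I_ne_zero))) Φ : ZMod M → ℂ) = I ^ (2 * ν + 1) • (E Φ : ZMod M → ℂ) := rfl
    have h7 : ∀ x : ℂ, x ^ (-(2 * (ν : ℤ) + 1)) = (x ^ (2 * ν + 1))⁻¹ := fun x => by
      rw [zpow_neg]; norm_cast
    have h8 : (I : ℂ) ^ (2 * ν + 1) ≠ 0 := pow_ne_zero _ I_ne_zero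
    rw [← hτ, moebius_neg, sqrtDenom_neg hγ hα, h5, zmodTheta_const_mul, h7, h7, mul_pow, mul_inv]
    field_simp

theorem zmodTheta_T_zpow (hM : Even M) (e ν : ℕ) (n : ℤ) (Φ : weilSpace M e) (z : ℂ) :
    zmodTheta ν ((weilT hM e ^ n : weilSpace M e ≃ₗ[ℂ] weilSpace M e) Φ : ZMod M → ℂ) z =
      zmodTheta ν (Φ : ZMod M → ℂ) (z + n) := by
  have hT : ∀ (Φ : weilSpace M e) (z : ℂ), zmodTheta ν (weilT hM e Φ : ZMod M → ℂ) z =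
      zmodTheta ν (Φ : ZMod M → ℂ) (z + 1) := fun Φ z => (zmodTheta_T hM ν Φ z).symm
  induction n using Int.induction_on generalizing Φ z with
  | zero => simp
  | succ n ih =>
    rw [zpow_add_one, LinearEquiv.mul_apply, ih, hT]
    push_cast
    ring_nf
  | pred n ih =>
    have h := ih ((weilT hM e)⁻¹ Φ) z
    have h2 := hT ((weilT hM e)⁻¹ Φ) (z + (-(n : ℤ) : ℤ) - 1)
    rw [sub_add_cancel, ← h] at h2
    rw [zpow_sub_one, LinearEquiv.mul_apply, ← h2, ← LinearEquiv.mul_apply, mul_inv_cancel]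
    push_cast
    ring_nf
    rfl

/-- Here γ is a translation up to sign, the branch is the constant 1 or i, and the defect vanishes.
-/
theorem defectHol_of_eq_zero (hM : Even M) {e ν : ℕ} {γ : SL(2, ℤ)} (hγ : γ 1 0 = 0) :
    DefectHol M e ν γ := by
  have hdet := SL2_det_eq γ
  rw [hγ, mul_zero, sub_zero] at hdet
  obtain ⟨κ, hκ0, hκ⟩ : ∃ κ : ℂ, κ ≠ 0 ∧ ∀ (α : ℚ) (τ : ℂ), sqrtDenom γ α τ = κ := by
    have hJ : ∀ α, denomQ γ α = γ 1 1 := fun α => by rw [denomQ, hγ]; simp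
    have hJc : ∀ τ, denomC γ τ = (γ 1 1 : ℤ) := fun α => by rw [denomC, hγ]; simp
    rcases Int.isUnit_iff.1 (IsUnit.of_mul_eq_one_right _ hdet) with h | h
    · refine ⟨1, one_ne_zero, fun α τ => ?_⟩
      rw [sqrtDenom_eq, sqrtDenomAt, hJ, hJc, h]
      simp
    · refine ⟨I, I_ne_zero, fun α τ => ?_⟩
      rw [sqrtDenom_eq, sqrtDenomAt, hJ, hJc, h, hγ]
      simp
  have hm : ∀ τ, moebius γ τ = τ + ((γ 0 1 * γ 1 1 : ℤ) : ℂ) := by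
    intro τ
    have hd : ((γ 1 1 : ℤ) : ℂ) ≠ 0 := by
      intro h
      have : (γ 1 1 : ℤ) = 0 := by exact_mod_cast h
      rw [this] at hdet
      simp at hdet
    have hd2 : ((γ 1 1 : ℤ) : ℂ) * (γ 1 1 : ℤ) = 1 := by
      rcases Int.isUnit_iff.1 (IsUnit.of_mul_eq_one_right _ hdet) with h | h <;> rw [h] <;> simp
    have hdet' : ((γ 0 0 : ℤ) : ℂ) * (γ 1 1 : ℤ) = 1 := by
      exact_mod_cast congrArg (Int.cast : ℤ → ℂ) hdet
    rw [moebius, hγ]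
    simp only [Int.cast_zero, zero_mul, zero_add]
    rw [div_eq_iff hd]
    push_cast
    have ha : ((γ 0 0 : ℤ) : ℂ) = (γ 1 1 : ℤ) := mul_right_cancel₀ hd (hdet'.trans hd2.symm)
    rw [ha]
    linear_combination -((γ 0 1 : ℤ) : ℂ) * hd2
  have hκ1 : κ ^ (2 * (ν : ℤ) + 1) ≠ 0 := zpow_ne_zero _ hκ0
  refine ⟨(weilT hM e ^ (-(γ 0 1 * γ 1 1))).trans (LinearEquiv.smulOfNeZero ℂ _ _ hκ1),
    fun Φ => ⟨0, fun _ _ => analyticAt_const, fun α _ => Eventually.of_forall fun τ => ?_⟩⟩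
  have h5 : (((weilT hM e ^ (-(γ 0 1 * γ 1 1))).trans (LinearEquiv.smulOfNeZero ℂ _ _ hκ1)) Φ :
      ZMod M → ℂ) = κ ^ (2 * (ν : ℤ) + 1) •
        ((weilT hM e ^ (-(γ 0 1 * γ 1 1)) : weilSpace M e ≃ₗ[ℂ] weilSpace M e) Φ : ZMod M → ℂ) :=
    rfl
  rw [h5, zmodTheta_const_mul, zmodTheta_T_zpow, hm, hκ, zpow_neg, inv_mul_cancel_left₀ hκ1,
    Int.cast_neg, add_neg_cancel_right, sub_self]
  rfl

theorem defectHol (hM : Even M) {e ν : ℕ} (he : ν + e = 1) (γ : SL(2, ℤ)) :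
    DefectHol M e ν γ := by
  rcases lt_trichotomy (γ 1 0) 0 with h | h | h
  · have h' : 0 < (-γ) 1 0 := by
      simp only [Matrix.SpecialLinearGroup.coe_neg, Matrix.neg_apply]
      omega
    have := defectHol_neg h' (defectHol_of_pos (M := M) hM he h')
    rwa [neg_neg] at this
  · exact defectHol_of_eq_zero hM h
  · exact defectHol_of_pos hM he h

end defect

end

/-! ### Defects of the derivatives -/

section

open MeasureTheory

section defectOrder

theorem isOpen_upper : IsOpen {τ : ℂ | 0 < τ.im} := isOpen_lt continuous_const continuous_im

theorem hasDerivAt_denomC (γ : SL(2, ℤ)) (τ : ℂ) : HasDerivAt (denomC γ) ((γ 1 0 : ℤ) : ℂ) τ := by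
  have : HasDerivAt (fun τ : ℂ => ((γ 1 0 : ℤ) : ℂ) * τ + ((γ 1 1 : ℤ) : ℂ))
      ((γ 1 0 : ℤ) : ℂ) τ := by
    simpa using! ((hasDerivAt_id τ).const_mul ((γ 1 0 : ℤ) : ℂ)).add_const ((γ 1 1 : ℤ) : ℂ)
  exact this

theorem hasDerivAt_moebius (γ : SL(2, ℤ)) {τ : ℂ} (h : denomC γ τ ≠ 0) :
    HasDerivAt (moebius γ) ((denomC γ τ ^ 2)⁻¹) τ := by
  have h1 : HasDerivAt (fun τ : ℂ => ((γ 0 0 : ℤ) : ℂ) * τ + ((γ 0 1 : ℤ) : ℂ))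
      ((γ 0 0 : ℤ) : ℂ) τ := by
    simpa using! ((hasDerivAt_id τ).const_mul ((γ 0 0 : ℤ) : ℂ)).add_const ((γ 0 1 : ℤ) : ℂ)
  have hdet : ((γ 0 0 : ℤ) : ℂ) * (γ 1 1 : ℤ) - (γ 0 1 : ℤ) * (γ 1 0 : ℤ) = 1 := by
    exact_mod_cast congrArg (Int.cast : ℤ → ℂ) (SL2_det_eq γ)
  refine (h1.div (hasDerivAt_denomC γ τ) h).congr_deriv ?_
  rw [← one_div]
  congr 1
  rw [denomC]
  linear_combination hdet

theorem sqrtDenomAt_sq {γ : SL(2, ℤ)} {α : ℚ} (hα : denomQ γ α ≠ 0) :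
    sqrtDenomAt γ α ^ 2 = ((denomQ γ α : ℚ) : ℂ) := by
  have h1 : ∀ x : ℝ, 0 ≤ x → ((√x : ℝ) : ℂ) ^ 2 = (x : ℂ) := fun x hx => by
    rw [← ofReal_pow, Real.sq_sqrt hx]
  rw [sqrtDenomAt]
  rcases lt_or_gt_of_ne hα with h | h
  · have h2 : (0 : ℝ) ≤ -(denomQ γ α : ℝ) := by
      have : (denomQ γ α : ℝ) < 0 := by exact_mod_cast h
      linarith
    rw [if_neg (by linarith)]
    split_ifs <;> rw [mul_pow, h1 _ h2] <;> simp
  · rw [if_pos h, h1 _ (by exact_mod_cast h.le)]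
    simp

theorem sqrtDenom_sq {γ : SL(2, ℤ)} {α : ℚ} (hα : denomQ γ α ≠ 0) (τ : ℂ) :
    sqrtDenom γ α τ ^ 2 = denomC γ τ := by
  have h0 : ((denomQ γ α : ℚ) : ℂ) ≠ 0 := by exact_mod_cast hα
  have h1 : ∀ x : ℂ, (x ^ (1 / 2 : ℂ)) ^ 2 = x := fun x => by
    simp
  rw [sqrtDenom_eq, mul_pow, sqrtDenomAt_sq hα, h1]
  field_simp

theorem analyticAt_denomC (γ : SL(2, ℤ)) (τ : ℂ) : AnalyticAt ℂ (denomC γ) τ := by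
  unfold denomC; fun_prop

theorem analyticAt_sqrtDenom {γ : SL(2, ℤ)} {α : ℚ} (hα : denomQ γ α ≠ 0) :
    AnalyticAt ℂ (sqrtDenom γ α) (α : ℂ) := by
  have h0 : ((denomQ γ α : ℚ) : ℂ) ≠ 0 := by exact_mod_cast hα
  have h1 : AnalyticAt ℂ (fun τ => denomC γ τ / ((denomQ γ α : ℚ) : ℂ)) (α : ℂ) :=
    (analyticAt_denomC γ _).div_const
  refine analyticAt_const.mul (h1.cpow analyticAt_const ?_)
  rw [denomC_ratCast, div_self h0]
  exact Complex.one_mem_slitPlane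

theorem sqrtDenom_ne_zero {γ : SL(2, ℤ)} {α : ℚ} (hα : denomQ γ α ≠ 0) {τ : ℂ}
    (h : denomC γ τ ≠ 0) : sqrtDenom γ α τ ≠ 0 := fun h0 => h <| by
  rw [← sqrtDenom_sq hα, h0, zero_pow two_ne_zero]

theorem eventually_denomC_ne_zero {γ : SL(2, ℤ)} {α : ℚ} (hα : denomQ γ α ≠ 0) :
    ∀ᶠ τ in 𝓝 (α : ℂ), denomC γ τ ≠ 0 := by
  refine (analyticAt_denomC γ α).continuousAt.eventually_ne ?_
  rw [denomC_ratCast]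
  exact_mod_cast hα

theorem hasDerivAt_sqrtDenom_zpow {γ : SL(2, ℤ)} {α : ℚ} (hα : denomQ γ α ≠ 0) {τ : ℂ}
    (hτ : DifferentiableAt ℂ (sqrtDenom γ α) τ) (h : denomC γ τ ≠ 0) (n : ℤ) :
    HasDerivAt (fun τ => sqrtDenom γ α τ ^ n)
      ((n : ℂ) / 2 * (((γ 1 0 : ℤ) : ℂ) / denomC γ τ) * sqrtDenom γ α τ ^ n) τ := by
  have hs := sqrtDenom_ne_zero hα h
  have h1 := hτ.hasDerivAt.pow 2
  have h2 : HasDerivAt (fun τ => sqrtDenom γ α τ ^ 2) ((γ 1 0 : ℤ) : ℂ) τ := by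
    rw [show (fun τ => sqrtDenom γ α τ ^ 2) = denomC γ from funext (sqrtDenom_sq hα)]
    exact hasDerivAt_denomC γ τ
  have h3 := h1.unique h2
  have h4 := (hasDerivAt_zpow n (sqrtDenom γ α τ) (Or.inl hs)).comp τ hτ.hasDerivAt
  refine h4.congr_deriv ?_
  rw [zpow_sub_one₀ hs, ← h3, ← sqrtDenom_sq hα]
  field_simp
  push_cast
  ring

theorem HolNearReals.add {γ : SL(2, ℤ)} {f g : ℂ → ℂ} (hf : HolNearReals γ f)
    (hg : HolNearReals γ g) : HolNearReals γ (fun τ => f τ + g τ) :=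
  fun x hx => (hf x hx).add (hg x hx)

theorem HolNearReals.mul {γ : SL(2, ℤ)} {f g : ℂ → ℂ} (hf : HolNearReals γ f)
    (hg : HolNearReals γ g) : HolNearReals γ (fun τ => f τ * g τ) :=
  fun x hx => (hf x hx).mul (hg x hx)

theorem HolNearReals.const (γ : SL(2, ℤ)) (a : ℂ) : HolNearReals γ (fun _ => a) :=
  fun _ _ => analyticAt_const

theorem HolNearReals.deriv {γ : SL(2, ℤ)} {f : ℂ → ℂ} (hf : HolNearReals γ f) :
    HolNearReals γ (deriv f) := fun x hx => (hf x hx).deriv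

theorem HolNearReals.at_rat {γ : SL(2, ℤ)} {f : ℂ → ℂ} (hf : HolNearReals γ f) {α : ℚ}
    (hα : denomQ γ α ≠ 0) : AnalyticAt ℂ f (α : ℂ) := by
  have := hf (α : ℝ) (by rw [denomQ] at hα; exact_mod_cast hα)
  simpa using this

theorem holNearReals_logDeriv (γ : SL(2, ℤ)) :
    HolNearReals γ (fun τ => ((γ 1 0 : ℤ) : ℂ) / denomC γ τ) := fun x hx => by
  refine analyticAt_const.div (analyticAt_denomC γ _) ?_
  rw [denomC]
  exact_mod_cast hx

/-- The upper half-plane is open, so an identity near α within it holds in a neighbourhood of each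
such point and may be differentiated. -/
theorem eventually_nhds_of_upper {α : ℂ} {p : ℂ → Prop} (h : ∀ᶠ τ in 𝓝[{τ : ℂ | 0 < τ.im}] α, p τ) :
    ∀ᶠ τ in 𝓝[{τ : ℂ | 0 < τ.im}] α, ∀ᶠ σ in 𝓝 τ, p σ := by
  filter_upwards [eventually_eventually_nhdsWithin.2 h, self_mem_nhdsWithin] with τ h1 h2
  rwa [isOpen_upper.nhdsWithin_eq h2] at h1

variable {D : ℕ}

/-- The defect of the `k`-th member of a sequence of `D`-tuples of functions is a combination of
the earlier members, with coefficients holomorphic near the reals. -/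
def HasDefects (θ : ℕ → Fin D → ℂ → ℂ) (ε : SL(2, ℤ) → GL (Fin D) ℂ) (κ : ℤ) (k : ℕ) : Prop :=
  ∀ γ : SL(2, ℤ), ∃ (a : ℕ → ℂ → ℂ) (h : Fin D → ℂ → ℂ), (∀ j, HolNearReals γ (a j)) ∧
    (∀ i, HolNearReals γ (h i)) ∧ ∀ α : ℚ, denomQ γ α ≠ 0 → ∀ i,
      ∀ᶠ τ in 𝓝[{τ : ℂ | 0 < τ.im}] (α : ℂ),
        θ k i τ - sqrtDenom γ α τ ^ (-(κ + 4 * (k : ℤ))) *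
          ∑ m, (ε γ : Matrix (Fin D) (Fin D) ℂ) i m * θ k m (moebius γ τ) =
        ∑ j ∈ Finset.range k, a j τ * θ j i τ + h i τ

/-- Differentiate the defect identity. The chain rule factor J_γ^{-2} raises the weight by 2, that
is, the exponent of J_γ^{1/2} by 4. The derivative of the automorphy factor yields q times the
transformed θ_k, which the old identity expresses through θ_k itself and its defect. -/
theorem HasDefects.succ {θ : ℕ → Fin D → ℂ → ℂ} {ε : SL(2, ℤ) → GL (Fin D) ℂ} {κ : ℤ} {k : ℕ}
    {lam : ℂ} (hlam : lam ≠ 0)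
    (hθ : ∀ k i τ, 0 < τ.im → HasDerivAt (θ k i) (lam * θ (k + 1) i τ) τ)
    (H : HasDefects θ ε κ k) : HasDefects θ ε κ (k + 1) := by
  intro γ
  obtain ⟨a, h, ha, hh, H⟩ := H γ
  set q : ℂ → ℂ := fun τ => ((κ : ℂ) + 4 * k) / 2 * (((γ 1 0 : ℤ) : ℂ) / denomC γ τ) with hq
  have hqh : HolNearReals γ q := (HolNearReals.const γ _).mul (holNearReals_logDeriv γ)
  -- `A` collects the derivatives of the coefficients and the terms with q, where j = k is the new
  -- contribution -q θ_k. `B` collects the terms in which θ_j was differentiated, with the index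
  -- shifted by one.
  set A : ℕ → ℂ → ℂ := fun j => if j < k then fun τ => deriv (a j) τ + q τ * a j τ
    else fun τ => -1 * q τ with hA
  set B : ℕ → ℂ → ℂ := fun j => Nat.casesOn j (fun _ => 0) (fun j τ => lam * a j τ) with hB
  refine ⟨fun j τ => lam⁻¹ * (A j τ + B j τ), fun i τ => lam⁻¹ * (deriv (h i) τ + q τ * h i τ),
    fun j => (HolNearReals.const γ _).mul (HolNearReals.add ?_ ?_),
    fun i => (HolNearReals.const γ _).mul ((hh i).deriv.add (hqh.mul (hh i))), fun α hα i => ?_⟩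
  · simp only [hA]
    split_ifs
    · exact (ha j).deriv.add (hqh.mul (ha j))
    · exact (HolNearReals.const γ _).mul hqh
  · cases j with
    | zero => exact HolNearReals.const γ 0
    | succ j => exact (HolNearReals.const γ _).mul (ha j)
  · have hup : ∀ {p : ℂ → Prop}, (∀ᶠ τ in 𝓝 (α : ℂ), p τ) →
        ∀ᶠ τ in 𝓝[{τ : ℂ | 0 < τ.im}] (α : ℂ), p τ := fun h => nhdsWithin_le_nhds h
    have hanalytic : ∀ᶠ τ in 𝓝 (α : ℂ), ∀ j ∈ Finset.range k, AnalyticAt ℂ (a j) τ :=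
      (Finset.range k).eventually_all.2 fun j _ => ((ha j).at_rat hα).eventually_analyticAt
    filter_upwards [eventually_nhds_of_upper (H α hα i), H α hα i, self_mem_nhdsWithin,
      hup hanalytic, hup ((hh i).at_rat hα).eventually_analyticAt,
      hup (analyticAt_sqrtDenom hα).eventually_analyticAt,
      hup (eventually_denomC_ne_zero hα)] with τ h1 h2 hτ h3 h4 h5 h6
    have hs0 := sqrtDenom_ne_zero hα h6
    have d1 := hasDerivAt_sqrtDenom_zpow hα h5.differentiableAt h6 (-(κ + 4 * (k : ℤ)))
    have d2 : HasDerivAt (fun τ => ∑ m, (ε γ : Matrix (Fin D) (Fin D) ℂ) i m *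
        θ k m (moebius γ τ)) (∑ m, (ε γ : Matrix (Fin D) (Fin D) ℂ) i m *
          (lam * θ (k + 1) m (moebius γ τ) * (denomC γ τ ^ 2)⁻¹)) τ :=
      HasDerivAt.fun_sum fun m _ => (((hθ k m _ (moebius_im_pos γ hτ)).comp τ
        (hasDerivAt_moebius γ h6)).const_mul _)
    have d3 := (hθ k i τ hτ).sub (d1.mul d2)
    have d4 : HasDerivAt (fun τ => ∑ j ∈ Finset.range k, a j τ * θ j i τ + h i τ)
        (∑ j ∈ Finset.range k, (deriv (a j) τ * θ j i τ + a j τ * (lam * θ (j + 1) i τ)) +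
          deriv (h i) τ) τ :=
      (HasDerivAt.fun_sum fun j hj => ((h3 j hj).differentiableAt.hasDerivAt.mul
        (hθ j i τ hτ))).add h4.differentiableAt.hasDerivAt
    have d5 := (d4.congr_of_eventuallyEq h1).unique d3
    have e1 : ∑ m, (ε γ : Matrix (Fin D) (Fin D) ℂ) i m *
        (lam * θ (k + 1) m (moebius γ τ) * (denomC γ τ ^ 2)⁻¹) = lam * (denomC γ τ ^ 2)⁻¹ *
        ∑ m, (ε γ : Matrix (Fin D) (Fin D) ℂ) i m * θ (k + 1) m (moebius γ τ) := by
      rw [Finset.mul_sum]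
      exact Finset.sum_congr rfl fun m _ => by ring
    have e2 : sqrtDenom γ α τ ^ (-(κ + 4 * ((k + 1 : ℕ) : ℤ))) =
        sqrtDenom γ α τ ^ (-(κ + 4 * (k : ℤ))) * (denomC γ τ ^ 2)⁻¹ := by
      rw [← sqrtDenom_sq hα, ← pow_mul, ← zpow_natCast, ← zpow_neg, ← zpow_add₀ hs0]
      congr 1
      push_cast
      ring
    have e3 : ∑ j ∈ Finset.range (k + 1), lam⁻¹ * (A j τ + B j τ) * θ j i τ =
        lam⁻¹ * (∑ j ∈ Finset.range k, (deriv (a j) τ * θ j i τ + a j τ * (lam * θ (j + 1) i τ)) +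
          q τ * (∑ j ∈ Finset.range k, a j τ * θ j i τ) - q τ * θ k i τ) := by
      have e4 : ∀ j, lam⁻¹ * (A j τ + B j τ) * θ j i τ =
          lam⁻¹ * (A j τ * θ j i τ) + lam⁻¹ * (B j τ * θ j i τ) := fun j => by ring
      simp only [e4]
      rw [Finset.sum_add_distrib, ← Finset.mul_sum, ← Finset.mul_sum, ← mul_add]
      congr 1
      rw [Finset.sum_range_succ, Finset.sum_range_succ', Finset.sum_add_distrib, Finset.mul_sum]
      have e5 : ∑ j ∈ Finset.range k, A j τ * θ j i τ = ∑ j ∈ Finset.range k,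
          deriv (a j) τ * θ j i τ + ∑ j ∈ Finset.range k, q τ * (a j τ * θ j i τ) := by
        rw [← Finset.sum_add_distrib]
        refine Finset.sum_congr rfl fun j hj => ?_
        rw [hA]
        simp only [if_pos (Finset.mem_range.1 hj)]
        ring
      have e6 : ∑ j ∈ Finset.range k, B (j + 1) τ * θ (j + 1) i τ =
          ∑ j ∈ Finset.range k, a j τ * (lam * θ (j + 1) i τ) :=
        Finset.sum_congr rfl fun j _ => by simp only [hB]; ring
      have e7 : A k τ = -1 * q τ := by simp [hA]
      have e8 : B 0 τ = 0 := rfl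
      rw [e5, e6, e7, e8]
      ring
    rw [e1] at d5
    rw [e2, e3]
    refine mul_left_cancel₀ hlam ?_
    have e9 : (((-(κ + 4 * (k : ℤ)) : ℤ) : ℂ)) = -((κ : ℂ) + 4 * k) := by push_cast; ring
    rw [e9] at d5
    generalize sqrtDenom γ α τ ^ (-(κ + 4 * (k : ℤ))) = x at d5 h2 ⊢
    generalize ∑ m, (ε γ : Matrix (Fin D) (Fin D) ℂ) i m * θ (k + 1) m (moebius γ τ) = y at d5 ⊢
    generalize ∑ m, (ε γ : Matrix (Fin D) (Fin D) ℂ) i m * θ k m (moebius γ τ) = z at d5 h2 ⊢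
    generalize ∑ j ∈ Finset.range k, (deriv (a j) τ * θ j i τ + a j τ * (lam * θ (j + 1) i τ)) = v
      at d5 ⊢
    generalize ∑ j ∈ Finset.range k, a j τ * θ j i τ = v' at d5 h2 ⊢
    have e10 : ∀ w : ℂ, lam * (lam⁻¹ * w) = w := fun w => mul_inv_cancel_left₀ hlam w
    rw [mul_add, e10, e10]
    have e11 : q τ = ((κ : ℂ) + 4 * k) / 2 * (((γ 1 0 : ℤ) : ℂ) / denomC γ τ) := rfl
    rw [neg_div, neg_mul, ← e11] at d5
    linear_combination -d5 + q τ * h2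

end defectOrder

end

/-! ### From identities of functions to identities of formal series -/

section formal

theorem moebius_sub_moebius {γ : SL(2, ℤ)} {τ σ : ℂ} (hτ : denomC γ τ ≠ 0) (hσ : denomC γ σ ≠ 0) :
    moebius γ τ - moebius γ σ = (τ - σ) / (denomC γ τ * denomC γ σ) := by
  have hdet : ((γ 0 0 : ℤ) : ℂ) * (γ 1 1 : ℤ) - (γ 0 1 : ℤ) * (γ 1 0 : ℤ) = 1 := by
    exact_mod_cast congrArg (Int.cast : ℤ → ℂ) (SL2_det_eq γ)
  have h1 : ∀ τ, moebius γ τ =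
      (((γ 0 0 : ℤ) : ℂ) * τ + ((γ 0 1 : ℤ) : ℂ)) / denomC γ τ := fun _ => rfl
  rw [h1, h1, div_sub_div _ _ hτ hσ]
  congr 1
  rw [denomC, denomC]
  linear_combination (τ - σ) * hdet

theorem moebius_ratCast (γ : SL(2, ℤ)) (α : ℚ) : moebius γ α = ((actQ γ α : ℚ) : ℂ) := by
  have := denomC_ratCast γ α
  rw [denomC] at this
  rw [moebius, this, actQ]
  push_cast
  rfl

theorem moebius_im {γ : SL(2, ℤ)} {τ : ℂ} (hτ : 0 < τ.im) :
    (moebius γ τ).im = τ.im / ‖denomC γ τ‖ ^ 2 := by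
  have h := ModularGroup.im_smul_eq_div_normSq γ (⟨τ, hτ⟩ : UpperHalfPlane)
  rw [UpperHalfPlane.im, coe_smul_eq_moebius, ModularGroup.denom_apply, Complex.normSq_eq_norm_sq]
    at h
  exact h

/-- Fractional linear maps send cones at rational points into cones. -/
theorem tendsto_moebius_cone {γ : SL(2, ℤ)} {α : ℚ} (hα : denomQ γ α ≠ 0) {η : ℝ} (hη : 0 < η) :
    Tendsto (fun z : ℂ => moebius γ (α + z) - ((actQ γ α : ℚ) : ℂ)) (𝓝[cone η] 0)
      (𝓝[cone (η / 2)] 0) := by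
  have hα0 : denomC γ α ≠ 0 := by rw [denomC_ratCast]; exact_mod_cast hα
  have hd : Tendsto (fun z : ℂ => denomC γ (α + z)) (𝓝[cone η] 0) (𝓝 (denomC γ α)) := by
    have : ContinuousAt (fun z : ℂ => denomC γ (α + z)) 0 := by
      unfold denomC; fun_prop
    have h2 := this.tendsto
    rw [add_zero] at h2
    exact h2.mono_left nhdsWithin_le_nhds
  have h1 : ∀ᶠ z in 𝓝[cone η] (0 : ℂ), denomC γ (α + z) ≠ 0 := hd.eventually_ne hα0
  have heq : ∀ᶠ z in 𝓝[cone η] (0 : ℂ), moebius γ (α + z) - ((actQ γ α : ℚ) : ℂ) =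
      z / (denomC γ (α + z) * denomC γ α) := by
    filter_upwards [h1] with z hz
    rw [← moebius_ratCast, moebius_sub_moebius hz hα0, add_sub_cancel_left]
  refine tendsto_nhdsWithin_iff.2 ⟨?_, ?_⟩
  · refine Tendsto.congr' (heq.mono fun _ h => h.symm) ?_
    have h2 : Tendsto (fun z : ℂ => z) (𝓝[cone η] 0) (𝓝 0) := nhdsWithin_le_nhds
    have h3 := h2.div (hd.mul_const (denomC γ α)) (mul_ne_zero hα0 hα0)
    rwa [zero_div] at h3
  · have hn : ∀ᶠ z in 𝓝[cone η] (0 : ℂ), ‖denomC γ (α + z)‖ < 2 * ‖denomC γ α‖ := by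
      refine hd.norm.eventually_lt_const ?_
      have := norm_pos_iff.2 hα0
      linarith
    filter_upwards [h1, heq, hn, self_mem_nhdsWithin] with z hz he hn hc
    have hzi := im_pos_of_mem_cone hη hc
    have him : 0 < ((α : ℂ) + z).im := by simpa using hzi
    have hn1 := norm_pos_iff.2 hz
    have hn2 := norm_pos_iff.2 hα0
    refine ⟨by rw [he]; exact div_ne_zero hc.1 (mul_ne_zero hz hα0), ?_⟩
    have h3 : (moebius γ (α + z) - ((actQ γ α : ℚ) : ℂ)).im = z.im / ‖denomC γ (α + z)‖ ^ 2 := by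
      rw [sub_im, moebius_im him]
      simp
    rw [h3, he, norm_div, norm_mul, div_mul_div_comm, div_le_div_iff₀ (by positivity) (by positivity)]
    have h4 := hc.2
    calc η * ‖z‖ * ‖denomC γ (α + z)‖ ^ 2
        = (η * ‖z‖) * (‖denomC γ (α + z)‖ * ‖denomC γ (α + z)‖) := by ring
      _ ≤ z.im * (‖denomC γ (α + z)‖ * (2 * ‖denomC γ α‖)) := by gcongr
      _ = _ := by ring

theorem analyticAt_moebius_sub {γ : SL(2, ℤ)} {α : ℚ} (hα : denomQ γ α ≠ 0) (w : ℂ) :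
    AnalyticAt ℂ (fun τ => moebius γ τ - w) (α : ℂ) := by
  have hα0 : denomC γ α ≠ 0 := by rw [denomC_ratCast]; exact_mod_cast hα
  refine AnalyticAt.sub (AnalyticAt.div ?_ (analyticAt_denomC γ α) hα0) analyticAt_const
  fun_prop

theorem constantCoeff_actSeries (γ : SL(2, ℤ)) (α : ℚ) :
    PowerSeries.constantCoeff (actSeries γ α) = 0 := by
  have h := moebius_ratCast γ α
  rw [moebius] at h
  rw [← PowerSeries.coeff_zero_eq_constantCoeff_apply, actSeries, taylorSeries,
    PowerSeries.coeff_mk]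
  simp [h]

variable {D : ℕ}

theorem tendsto_add_upper (α : ℚ) {η : ℝ} (hη : 0 < η) :
    Tendsto (fun z : ℂ => (α : ℂ) + z) (𝓝[cone η] 0) (𝓝[{τ : ℂ | 0 < τ.im}] (α : ℂ)) := by
  refine tendsto_nhdsWithin_iff.2 ⟨?_, ?_⟩
  · have : ContinuousAt (fun z : ℂ => (α : ℂ) + z) 0 := by fun_prop
    have h := this.tendsto
    rw [add_zero] at h
    exact h.mono_left nhdsWithin_le_nhds
  · filter_upwards [self_mem_nhdsWithin] with z hz
    have := im_pos_of_mem_cone hη hz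
    simpa using this

/-- The formal counterpart of the defect formula. -/
theorem modDefect_eq {θ : ℕ → Fin D → ℂ → ℂ} {ε : SL(2, ℤ) → GL (Fin D) ℂ} {κ : ℤ} {k : ℕ}
    {φ : ℕ → Fin D → ℚ → ℂ⟦X⟧} (hφ : ∀ k i (α : ℚ), ConeExp (θ k i) (α : ℂ) (φ k i α))
    {γ : SL(2, ℤ)} {α : ℚ} (hα : denomQ γ α ≠ 0) {a : ℕ → ℂ → ℂ} {h : ℂ → ℂ} {i : Fin D}
    (ha : ∀ j, HolNearReals γ (a j)) (hh : HolNearReals γ h)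
    (H : ∀ᶠ τ in 𝓝[{τ : ℂ | 0 < τ.im}] (α : ℂ),
        θ k i τ - sqrtDenom γ α τ ^ (-(κ + 4 * (k : ℤ))) *
          ∑ m, (ε γ : Matrix (Fin D) (Fin D) ℂ) i m * θ k m (moebius γ τ) =
        ∑ j ∈ Finset.range k, a j τ * θ j i τ + h τ) :
    modDefect (κ + 4 * (k : ℤ)) ε (φ k) γ i α =
      ∑ j ∈ Finset.range k, taylorSeries (a j) (α : ℂ) * φ j i α + taylorSeries h (α : ℂ) := by
  have := nhdsWithin_cone_neBot (le_refl (1 : ℝ))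
  have hl : 𝓝[cone 1] (0 : ℂ) ≤ 𝓝 0 := nhdsWithin_le_nhds
  have hα0 : denomC γ α ≠ 0 := by rw [denomC_ratCast]; exact_mod_cast hα
  have hs : AnalyticAt ℂ (fun τ => sqrtDenom γ α τ ^ (-(κ + 4 * (k : ℤ)))) (α : ℂ) :=
    (analyticAt_sqrtDenom hα).fun_zpow (sqrtDenom_ne_zero hα hα0)
  have hcomp : ∀ m, HasExp (𝓝[cone 1] 0) (fun z => θ k m (moebius γ (α + z)))
      ((φ k m (actQ γ α)).subst (actSeries γ α)) := by
    intro m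
    -- The map γ carries the cone with η = 1 at α, near its vertex, into the cone with η = 1/2 at
    -- γα.
    have h1 := (hφ k m (actQ γ α) (1 / 2) (by norm_num)).comp
      (u := fun z => moebius γ (α + z) - ((actQ γ α : ℚ) : ℂ)) (b := actSeries γ α) hl
      ((hasExp_taylorSeries (analyticAt_moebius_sub hα _)).mono hl) (constantCoeff_actSeries γ α)
      (tendsto_moebius_cone hα one_pos)
    simpa only [add_sub_cancel] using h1
  have h1 : HasExp (𝓝[cone 1] 0) (fun z => θ k i (α + z) -
      sqrtDenom γ α (α + z) ^ (-(κ + 4 * (k : ℤ))) *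
        ∑ m, (ε γ : Matrix (Fin D) (Fin D) ℂ) i m * θ k m (moebius γ (α + z)))
      (modDefect (κ + 4 * (k : ℤ)) ε (φ k) γ i α) :=
    (hφ k i α 1 one_pos).sub (((hasExp_taylorSeries hs).mono hl).mul hl
      (HasExp.sum hl _ fun m _ => (hcomp m).const_mul hl _))
  have h2 : HasExp (𝓝[cone 1] 0) (fun z => ∑ j ∈ Finset.range k, a j (α + z) * θ j i (α + z) +
      h (α + z)) (∑ j ∈ Finset.range k, taylorSeries (a j) (α : ℂ) * φ j i α +
        taylorSeries h (α : ℂ)) :=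
    (HasExp.sum hl _ fun j _ => ((hasExp_taylorSeries ((ha j).at_rat hα)).mono hl).mul hl
      (hφ j i α 1 one_pos)).add ((hasExp_taylorSeries (hh.at_rat hα)).mono hl)
  exact h1.unique (nhdsWithin_cone_le 1) (h2.congr' (((tendsto_add_upper α one_pos).eventually
    H).mono fun _ h => h.symm))

/-- Strong induction: the k-th defect is a combination of the families φ_j with j < k, of depth j +
1 ≤ k, and a vector of holomorphic functions. That vector is the sum of its components times
constant unit vectors, which have depth 0. -/
theorem isStrongVVQMF_of_hasDefects {θ : ℕ → Fin D → ℂ → ℂ} {ε : SL(2, ℤ) → GL (Fin D) ℂ} {κ : ℤ}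
    {φ : ℕ → Fin D → ℚ → ℂ⟦X⟧} (hφ : ∀ k i (α : ℚ), ConeExp (θ k i) (α : ℂ) (φ k i α))
    (H : ∀ k, HasDefects θ ε κ k) (k : ℕ) :
    IsStrongVVQMF (k + 1) (κ + 4 * (k : ℤ)) ε (φ k) := by
  induction k using Nat.strong_induction_on with
  | _ k ih =>
    rw [IsStrongVVQMF]
    -- The triple t = 0 is for the constant vectors, whose weight is immaterial; t = j + 1 is the
    -- depth of φ_j.
    refine ⟨k + 1, id, fun t => κ + 4 * ((t.val : ℤ) - 1), fun _ => ε, fun γ => ?_⟩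
    obtain ⟨a, h, ha, hh, hd⟩ := H k γ
    refine ⟨D + k, Fin.addCases (fun _ => 0) (fun j => j.succ),
      Fin.addCases h (fun j => a j.val),
      Fin.addCases (fun i i' _ => PowerSeries.C (if i' = i then 1 else 0)) (fun j => φ j.val),
      fun t => ?_, fun t => ?_, fun i α hα => ?_⟩
    · induction t using Fin.addCases with
      | left i => simpa only [Fin.addCases_left] using hh i
      | right j => simpa only [Fin.addCases_right] using ha j
    · induction t using Fin.addCases with
      | left i =>
        simp only [Fin.addCases_left, id]
        change IsStrongVVQMF 0 _ _ _
        rw [IsStrongVVQMF]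
        exact ⟨fun i' => if i' = i then 1 else 0, fun _ _ => rfl⟩
      | right j =>
        simp only [Fin.addCases_right, id]
        have := ih j.val j.isLt
        have hw : κ + 4 * (((j.succ : Fin (k + 1)).val : ℤ) - 1) = κ + 4 * (j.val : ℤ) := by
          simp
        rw [hw]
        exact this
    · rw [modDefect_eq hφ hα ha (hh i) (hd α hα i), Fin.sum_univ_add, add_comm]
      simp only [Fin.addCases_left, Fin.addCases_right]
      congr 1
      · simp
      · exact Finset.sum_range fun j => taylorSeries (a j) (α : ℂ) * φ j i α

end formal

/-! ### The vector-valued form attached to a basis -/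

section vector

open MeasureTheory ZMod
open scoped Matrix

variable {M : ℕ} [NeZero M]

theorem zmodTheta_sum (ν : ℕ) {ι : Type*} (s : Finset ι) (c : ι → ℂ) (F : ι → ZMod M → ℂ) {τ : ℂ}
    (hτ : 0 < τ.im) :
    zmodTheta ν (∑ m ∈ s, c m • F m) τ = ∑ m ∈ s, c m * zmodTheta ν (F m) τ := by
  have hsum : ∀ m, Summable fun n : ℕ+ => thetaTerm ν (fun n => F m n) M n τ := fun m => by
    obtain ⟨C, hC, hf⟩ := exists_norm_le_zmod (F m)
    exact (summable_norm_thetaTerm hC hf (NeZero.pos M) ν hτ).of_norm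
  simp only [zmodTheta, partialTheta_eq_tsum, ← tsum_mul_left]
  rw [← Summable.tsum_finsetSum fun m _ => (hsum m).mul_left _]
  refine tsum_congr fun n => ?_
  simp only [thetaTerm, Finset.sum_apply, Pi.smul_apply, smul_eq_mul, Finset.mul_sum,
    Finset.sum_mul]
  exact Finset.sum_congr rfl fun m _ => by ring

theorem hasDerivAt_zmodTheta (ν : ℕ) (Φ : ZMod M → ℂ) {τ : ℂ} (hτ : 0 < τ.im) :
    HasDerivAt (zmodTheta ν Φ) (I * Real.pi / M * zmodTheta (ν + 2) Φ τ) τ := by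
  obtain ⟨C, hC, hf⟩ := exists_norm_le_zmod Φ
  exact hasDerivAt_partialTheta hC hf (NeZero.pos M) ν hτ

theorem differentiableOn_zmodTheta (ν : ℕ) (Φ : ZMod M → ℂ) :
    DifferentiableOn ℂ (zmodTheta ν Φ) {τ | 0 < τ.im} :=
  fun _ hτ => (hasDerivAt_zmodTheta ν Φ hτ).differentiableAt.differentiableWithinAt

theorem theta_factor_ne_zero : (I * Real.pi / M : ℂ) ≠ 0 :=
  div_ne_zero (mul_ne_zero I_ne_zero (by exact_mod_cast Real.pi_ne_zero)) (NeZero.ne _)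

theorem exists_coneExp_zmodTheta_add (hM : Even M) {e ν : ℕ} (he : ν + e = 1)
    (Φ : weilSpace M e) (α : ℚ) (k : ℕ) :
    ∃ a, ConeExp (zmodTheta (ν + 2 * k) (Φ : ZMod M → ℂ)) α a := by
  induction k with
  | zero => exact exists_coneExp_zmodTheta hM he Φ α
  | succ k ih =>
    obtain ⟨a, ha⟩ := ih
    have hα : (α : ℂ).im = 0 := by simp
    have h1 := ha.deriv hα (differentiableOn_zmodTheta _ _)
    refine ⟨PowerSeries.C (I * Real.pi / M)⁻¹ * PowerSeries.derivative ℂ a, fun η hη => ?_⟩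
    refine ((h1 η hη).const_mul nhdsWithin_le_nhds (I * Real.pi / M)⁻¹).congr' ?_
    filter_upwards [self_mem_nhdsWithin] with z hz
    have hz' : 0 < ((α : ℂ) + z).im := by simpa using im_pos_of_mem_cone hη hz
    rw [(hasDerivAt_zmodTheta _ _ hz').deriv, inv_mul_cancel_left₀ theta_factor_ne_zero]
    rfl

/-- Partial theta series with coefficients in `weilSpace` are components of vector-valued strong
quantum modular forms. -/
theorem exists_isStrongVVQMFOnUHP (hM : Even M) {e ν : ℕ} (he : ν + e = 1) (k : ℕ)
    {Φ : ZMod M → ℂ} (hΦ : Φ ∈ weilSpace M e) :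
    ∃ (D : ℕ) (F : Fin D → ℂ → ℂ) (i : Fin D), F i = zmodTheta (ν + 2 * k) Φ ∧
      IsStrongVVQMFOnUHP (k + 1) (2 * ((ν + 2 * k : ℕ) : ℤ) + 1) F := by
  -- The zero function belongs to no basis and is treated as a vector of length 1.
  rcases eq_or_ne Φ 0 with rfl | hΦ0
  · have hzero : ∀ τ, zmodTheta (ν + 2 * k) (0 : ZMod M → ℂ) τ = 0 := fun τ => by
      simp [zmodTheta, partialTheta]
    have hexp : ∀ (_ : ℕ) (_ : Fin 1) (α : ℚ), ConeExp (fun _ => (0 : ℂ)) (α : ℂ) 0 :=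
      fun _ _ α η hη => HasExp.of_isBigO_pow fun N => isBigO_zero _ _
    refine ⟨1, fun _ => zmodTheta (ν + 2 * k) 0, 0, rfl, fun _ => differentiableOn_zmodTheta _ _,
      fun _ _ => 0, fun _ => 1, fun i α => ?_, ?_⟩
    · rw [funext hzero]
      exact (hexp 0 0 α).hasNontangentialExpansion
    · have h1 := isStrongVVQMF_of_hasDefects (κ := 2 * (ν : ℤ) + 1) (ε := fun _ => 1) hexp
        (fun k γ => ⟨fun _ _ => 0, fun _ _ => 0, fun _ => HolNearReals.const γ 0,
          fun _ => HolNearReals.const γ 0, fun α hα i => Eventually.of_forall fun τ => by simp⟩) k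
      convert h1 using 1
      push_cast
      ring
  · set v : weilSpace M e := ⟨Φ, hΦ⟩ with hv
    have hv0 : v ≠ 0 := fun h => hΦ0 (congrArg Subtype.val h)
    have hli : LinearIndepOn ℂ id ({v} : Set (weilSpace M e)) := by
      rw [linearIndepOn_singleton_iff]
      exact hv0
    set b₀ := Module.Basis.extend hli
    have : Fintype (hli.extend (Set.subset_univ _)) := FiniteDimensional.fintypeBasisIndex b₀
    set eqv := Fintype.equivFin (hli.extend (Set.subset_univ _))
    set D := Fintype.card (hli.extend (Set.subset_univ _))
    set b : Module.Basis (Fin D) ℂ (weilSpace M e) := b₀.reindex eqv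
    obtain ⟨i₀, hi₀⟩ : ∃ i, b i = v := by
      refine ⟨eqv ⟨v, hli.subset_extend _ (Set.mem_singleton v)⟩, ?_⟩
      rw [Module.Basis.reindex_apply, Equiv.symm_apply_apply, Module.Basis.extend_apply_self]
    choose E hE using defectHol (M := M) hM he
    choose φ hφ using fun (k : ℕ) (i : Fin D) (α : ℚ) =>
      exists_coneExp_zmodTheta_add hM he (b i) α k
    -- The transpose appears because the multiplier expresses the image of b_i through the b_m with
    -- i as row index.
    set ε : SL(2, ℤ) → GL (Fin D) ℂ := fun γ =>
      ⟨(LinearMap.toMatrix b b (E γ).toLinearMap)ᵀ,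
        (LinearMap.toMatrix b b (E γ).symm.toLinearMap)ᵀ,
        by rw [← Matrix.transpose_mul, ← LinearMap.toMatrix_comp b b b]; simp,
        by rw [← Matrix.transpose_mul, ← LinearMap.toMatrix_comp b b b]; simp⟩ with hε
    have hεE : ∀ γ i, ((E γ (b i) : weilSpace M e) : ZMod M → ℂ) =
        ∑ m, (ε γ : Matrix (Fin D) (Fin D) ℂ) i m • (b m : ZMod M → ℂ) := by
      intro γ i
      have h1 := congrArg (Submodule.subtype _) (b.sum_repr (E γ (b i)))
      rw [map_sum] at h1
      refine h1.symm.trans (Finset.sum_congr rfl fun m _ => ?_)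
      simp [hε, LinearMap.toMatrix_apply]
    have hdef : ∀ k, HasDefects (fun k i => zmodTheta (ν + 2 * k) (b i : ZMod M → ℂ)) ε
        (2 * (ν : ℤ) + 1) k := by
      intro k
      induction k with
      | zero =>
        intro γ
        choose h hh hd using fun i => hE γ (b i)
        refine ⟨fun _ _ => 0, h, fun _ => HolNearReals.const γ 0, hh, fun α hα i => ?_⟩
        filter_upwards [hd i α hα, self_mem_nhdsWithin] with τ hτ hτi
        rw [hεE, zmodTheta_sum _ _ _ _ (moebius_im_pos γ hτi)] at hτ
        simpa using hτ
      | succ k ih =>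
        exact ih.succ theta_factor_ne_zero fun k i τ hτ => hasDerivAt_zmodTheta _ _ hτ
    refine ⟨D, fun i => zmodTheta (ν + 2 * k) (b i : ZMod M → ℂ), i₀,
      congrArg (fun w : weilSpace M e => zmodTheta (ν + 2 * k) (w : ZMod M → ℂ)) hi₀,
      fun i => differentiableOn_zmodTheta _ _, φ k, ε,
      fun i α => (hφ k i α).hasNontangentialExpansion, ?_⟩
    have h1 := isStrongVVQMF_of_hasDefects hφ hdef k
    convert h1 using 1
    push_cast
    ring

end vector

/-! ### Generalized Hikami functions as functions on `ZMod (2P)` -/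

section hikami

variable {r : ℕ} {p : Fin r → ℕ}

theorem genHikami_of_not_mem {J : Finset (Fin r)} {l : Fin r → ℤ} {n : ℤ}
    (h : n ∉ hikamiSet p l) : genHikami p J l n = 0 := by
  rw [genHikami, dif_neg h]

theorem genHikami_of_modEq (hcop : Pairwise fun i j => (p i).Coprime (p j)) {J : Finset (Fin r)}
    {l : Fin r → ℤ} (hJ : ∀ j ∈ J, ¬ (p j : ℤ) ∣ l j) {n n' : ℤ}
    (h : n ≡ n' [ZMOD 2 * (bigP p : ℤ)]) : genHikami p J l n = genHikami p J l n' := by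
  by_cases hn : n ∈ hikamiSet p l
  · obtain ⟨e, he⟩ := hn
    rw [prod_sign_eq p hcop J l hJ n e he, prod_sign_eq p hcop J l hJ n' e (h.symm.trans he)]
  · have hn' : n' ∉ hikamiSet p l := fun ⟨e, he⟩ => hn ⟨e, h.trans he⟩
    rw [genHikami_of_not_mem hn, genHikami_of_not_mem hn']

/-- Transformation of a generalized Hikami function under an involution that acts on signs. -/
theorem genHikami_map (hcop : Pairwise fun i j => (p i).Coprime (p j)) {J : Finset (Fin r)}
    {l : Fin r → ℤ} (hJ : ∀ j ∈ J, ¬ (p j : ℤ) ∣ l j) (f : ℤ → ℤ)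
    (T : (Fin r → ℤˣ) → Fin r → ℤˣ) (c : ℂ)
    (hf : ∀ n e, n ≡ hikamiN p l e [ZMOD 2 * (bigP p : ℤ)] →
      f n ≡ hikamiN p l (T e) [ZMOD 2 * (bigP p : ℤ)])
    (hff : ∀ n, f (f n) ≡ n [ZMOD 2 * (bigP p : ℤ)])
    (hT : ∀ e, ∏ j ∈ J, (((T e j : ℤˣ) : ℤ) : ℂ) = c * ∏ j ∈ J, (((e j : ℤˣ) : ℤ) : ℂ)) (n : ℤ) :
    genHikami p J l (f n) = c * genHikami p J l n := by
  by_cases hn : n ∈ hikamiSet p l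
  · obtain ⟨e, he⟩ := hn
    rw [prod_sign_eq p hcop J l hJ n e he, prod_sign_eq p hcop J l hJ _ _ (hf n e he), hT]
  · have hn' : f n ∉ hikamiSet p l := fun ⟨e, he⟩ => hn ⟨T e, (hff n).symm.trans (hf _ e he)⟩
    rw [genHikami_of_not_mem hn, genHikami_of_not_mem hn', mul_zero]

/-- Changing all signs sends N(ε) to 2P - N(ε). -/
theorem genHikami_neg (hcop : Pairwise fun i j => (p i).Coprime (p j)) {J : Finset (Fin r)}
    {l : Fin r → ℤ} (hJ : ∀ j ∈ J, ¬ (p j : ℤ) ∣ l j) (n : ℤ) :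
    genHikami p J l (-n) = (-1) ^ J.card * genHikami p J l n := by
  refine genHikami_map hcop hJ (fun n => -n) (fun e => -e) _ (fun n e he => ?_)
    (fun n => by simp) (fun e => ?_) n
  · have h1 : hikamiN p l (-e) = -hikamiN p l e + 2 * (bigP p : ℤ) * 1 := by
      simp only [hikamiN, Pi.neg_apply, Units.val_neg, neg_mul, Finset.sum_neg_distrib]
      ring
    rw [h1]
    exact he.neg.trans (Int.modEq_add_fac_self).symm
  · simp [Finset.prod_neg]

theorem bigP_eq (p : Fin r → ℕ) (j : Fin r) : bigP p = p j * phat p j := by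
  simp [bigP, phat, Finset.mul_prod_erase]

theorem coprime_phat (hcop : Pairwise fun i j => (p i).Coprime (p j)) (j : Fin r) :
    (p j).Coprime (phat p j) :=
  Nat.Coprime.prod_right fun i hi => hcop (Finset.ne_of_mem_erase hi).symm

theorem hikamiN_update (p : Fin r → ℕ) (l : Fin r → ℤ) (e : Fin r → ℤˣ) (j : Fin r) :
    hikamiN p l (Function.update e j (-e j)) =
      hikamiN p l e - 2 * (e j : ℤ) * l j * (phat p j : ℤ) := by
  rw [hikamiN, hikamiN, ← Finset.add_sum_erase _ _ (Finset.mem_univ j),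
    ← Finset.add_sum_erase _ (fun i => (e i : ℤ) * l i * (phat p i : ℤ)) (Finset.mem_univ j)]
  have : ∑ i ∈ Finset.univ.erase j,
      ((Function.update e j (-e j) i : ℤˣ) : ℤ) * l i * (phat p i : ℤ) =
      ∑ i ∈ Finset.univ.erase j, (e i : ℤ) * l i * (phat p i : ℤ) :=
    Finset.sum_congr rfl fun i hi => by rw [Function.update_of_ne (Finset.ne_of_mem_erase hi)]
  rw [this, Function.update_self]
  push_cast
  ring

theorem dvd_hikamiN_sub (p : Fin r → ℕ) (l : Fin r → ℤ) (e : Fin r → ℤˣ) (j : Fin r) :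
    (p j : ℤ) ∣ hikamiN p l e - (e j : ℤ) * l j * (phat p j : ℤ) := by
  rw [hikamiN, ← Finset.add_sum_erase _ _ (Finset.mem_univ j)]
  have h1 : (p j : ℤ) ∣ (bigP p : ℤ) := ⟨phat p j, by rw [bigP_eq p j]; push_cast; ring⟩
  have h2 : (p j : ℤ) ∣ ∑ i ∈ Finset.univ.erase j, (e i : ℤ) * l i * (phat p i : ℤ) := by
    refine Finset.dvd_sum fun i hi => Dvd.dvd.mul_left ?_ _
    exact_mod_cast Finset.dvd_prod_of_mem p
      (Finset.mem_erase.2 ⟨(Finset.ne_of_mem_erase hi).symm, Finset.mem_univ _⟩)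
  rw [show ∀ a b c : ℤ, a + (b + c) - b = a + c by intros; ring]
  exact dvd_add h1 h2

/-- A unit that flips the sign at `j`. -/
theorem exists_sign_flip (hcop : Pairwise fun i j => (p i).Coprime (p j)) {j : Fin r}
    (hj : Odd (p j)) : ∃ w : ℤ, 4 * (bigP p : ℤ) ∣ w ^ 2 - 1 ∧ (p j : ℤ) ∣ w + 1 ∧
      2 * (phat p j : ℤ) ∣ w - 1 := by
  have h4 : IsCoprime (p j : ℤ) (4 * (phat p j : ℤ)) := by
    have : (p j).Coprime (4 * phat p j) :=
      Nat.Coprime.mul_right (Nat.Coprime.pow_right 2 (Nat.coprime_two_right.2 hj))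
        (coprime_phat hcop j)
    have h := Nat.isCoprime_iff_coprime.2 this
    push_cast at h
    exact h
  -- With 1 = x p_j + 4y(P/p_j) the unit is the difference of the two summands. The factor 4,
  -- available since p_j is odd, gives w² ≡ 1 modulo 4P rather than 2P, as the exponent n²/(4P)
  -- requires.
  obtain ⟨x, y, hxy⟩ := h4
  set a := (p j : ℤ)
  set b := (phat p j : ℤ)
  have hP : (bigP p : ℤ) = a * b := by rw [bigP_eq p j]; push_cast; rfl
  refine ⟨x * a - y * (4 * b), ?_, ⟨2 * x, by linear_combination -hxy⟩,
    ⟨-(4 * y), by linear_combination hxy⟩⟩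
  rw [hP]
  refine ⟨-4 * x * y, ?_⟩
  linear_combination (x * a + y * (4 * b) + 1) * hxy

/-- Multiplication by w acts on N(ε) as the flip of ε_j, as is seen modulo p_j and modulo 2P/p_j
separately. Modulo p_j only the j-th summand survives and w is -1; modulo 2P/p_j the flip changes
nothing and w is 1. -/
theorem genHikami_flip (hcop : Pairwise fun i j => (p i).Coprime (p j)) {J : Finset (Fin r)}
    {l : Fin r → ℤ} (hJ : ∀ j ∈ J, ¬ (p j : ℤ) ∣ l j) {j : Fin r} (hjJ : j ∈ J)
    (hj : Odd (p j)) {w : ℤ} (hw : 4 * (bigP p : ℤ) ∣ w ^ 2 - 1) (hw1 : (p j : ℤ) ∣ w + 1)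
    (hw2 : 2 * (phat p j : ℤ) ∣ w - 1) (n : ℤ) :
    genHikami p J l (w * n) = -1 * genHikami p J l n := by
  refine genHikami_map hcop hJ (fun n => w * n) (fun e => Function.update e j (-e j)) _
    (fun n e he => ?_) (fun n => ?_) (fun e => ?_) n
  · refine (he.mul_left w).trans ?_
    have h4 : IsCoprime (p j : ℤ) (2 * (phat p j : ℤ)) := by
      have : (p j).Coprime (2 * phat p j) :=
        Nat.Coprime.mul_right (Nat.coprime_two_right.2 hj) (coprime_phat hcop j)
      have h := Nat.isCoprime_iff_coprime.2 this
      push_cast at h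
      exact h
    have hP : 2 * (bigP p : ℤ) = p j * (2 * phat p j) := by rw [bigP_eq p j]; push_cast; ring
    rw [hP]
    refine (Int.modEq_iff_dvd.2 (h4.mul_dvd ?_ ?_))
    · rw [hikamiN_update]
      obtain ⟨a, ha⟩ := dvd_hikamiN_sub p l e j
      obtain ⟨b, hb⟩ := hw1
      refine ⟨2 * a - b * hikamiN p l e, ?_⟩
      linear_combination 2 * ha - hikamiN p l e * hb
    · rw [hikamiN_update]
      obtain ⟨b, hb⟩ := hw2
      refine ⟨-((e j : ℤ) * l j) - b * hikamiN p l e, ?_⟩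
      linear_combination -hikamiN p l e * hb
  · refine Int.modEq_iff_dvd.2 ?_
    obtain ⟨b, hb⟩ := hw
    exact ⟨-2 * b * n, by linear_combination -n * hb⟩
  · rw [← Finset.mul_prod_erase _ _ hjJ, ← Finset.mul_prod_erase J (fun i => ((e i : ℤ) : ℂ)) hjJ,
      Function.update_self]
    have : ∏ i ∈ J.erase j, (((Function.update e j (-e j) i : ℤˣ) : ℤ) : ℂ) =
        ∏ i ∈ J.erase j, ((e i : ℤ) : ℂ) :=
      Finset.prod_congr rfl fun i hi => by rw [Function.update_of_ne (Finset.ne_of_mem_erase hi)]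
    rw [this]
    push_cast
    ring

theorem quadChar_mul_of_sq {M : ℕ} [NeZero M] (hM : Even M) {w : ℤ} (hw : 2 * (M : ℤ) ∣ w ^ 2 - 1)
    (n : ZMod M) : quadChar M ((w : ZMod M) * n) = quadChar M n := by
  have hMc : (M : ℂ) ≠ 0 := NeZero.ne _
  obtain ⟨n, rfl⟩ := ZMod.intCast_surjective n
  obtain ⟨b, hb⟩ := hw
  have hb' : (w : ℂ) ^ 2 - 1 = 2 * M * b := by exact_mod_cast congrArg (Int.cast : ℤ → ℂ) hb
  rw [← Int.cast_mul, quadChar_intCast hM, quadChar_intCast hM,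
    Complex.exp_eq_exp_iff_exists_int]
  refine ⟨b * n ^ 2, ?_⟩
  push_cast
  field_simp
  linear_combination (n : ℂ) ^ 2 * hb'

/-- Elements of `hikamiSpace` as functions on `ZMod (2P)`. -/
theorem exists_mem_weilSpace [NeZero (2 * bigP p)]
    (hcop : Pairwise fun i j => (p i).Coprime (p j))
    (hodd : ∀ j : Fin r, (j : ℕ) ≠ 0 → Odd (p j)) {s e : ℕ} (hs : s + 2 ≤ r)
    (hpar : e + s ≡ r [MOD 2]) {g : ℤ → ℂ} (hg : g ∈ hikamiSpace p s) :
    ∃ Φ ∈ weilSpace (2 * bigP p) e, ∀ n : ℤ, g n = Φ n := by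
  have hM : Even (2 * bigP p) := even_two_mul _
  induction hg using Submodule.span_induction with
  | zero => exact ⟨0, Submodule.zero_mem _, fun n => rfl⟩
  | add f g _ _ hf hg =>
    obtain ⟨Φ, hΦ, h⟩ := hf
    obtain ⟨Ψ, hΨ, h'⟩ := hg
    exact ⟨Φ + Ψ, Submodule.add_mem _ hΦ hΨ, fun n => by simp [h, h']⟩
  | smul a f _ hf =>
    obtain ⟨Φ, hΦ, h⟩ := hf
    exact ⟨a • Φ, Submodule.smul_mem _ _ hΦ, fun n => by simp [h]⟩
  | mem g hg =>
    obtain ⟨J, l, hcard, hmod, -, hJ, rfl⟩ := hg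
    have hval : ∀ n : ℤ, genHikami p J l n =
        genHikami p J l ((((n : ℤ) : ZMod (2 * bigP p)).val : ℕ) : ℤ) := fun n => by
      refine genHikami_of_modEq hcop hJ ?_
      rw [ZMod.val_intCast]
      push_cast
      exact (Int.mod_modEq _ _).symm
    set Φ : ZMod (2 * bigP p) → ℂ := fun x => genHikami p J l ((x.val : ℕ) : ℤ) with hΦ
    have hΦn : ∀ n : ℤ, Φ n = genHikami p J l n := fun n => (hval n).symm
    refine ⟨Φ, Submodule.subset_span ⟨fun x => ?_, ?_⟩, fun n => (hΦn n).symm⟩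
    · obtain ⟨n, rfl⟩ := ZMod.intCast_surjective x
      rw [← Int.cast_neg, hΦn, hΦn, genHikami_neg hcop hJ]
      congr 1
      have h1 : J.card ≡ e [MOD 2] := Nat.ModEq.add_right_cancel' s (hmod.trans hpar.symm)
      rw [neg_one_pow_eq_pow_mod_two, h1, ← neg_one_pow_eq_pow_mod_two]
    -- As |J| ≥ r - s ≥ 2, the set J contains an index other than the first, and there p_j is odd.
    · obtain ⟨j, hjJ, hj0⟩ : ∃ j ∈ J, (j : ℕ) ≠ 0 := by
        obtain ⟨a, ha, b, hb, hab⟩ := Finset.one_lt_card.1 (by omega : 1 < J.card)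
        by_cases h : (a : ℕ) = 0
        · exact ⟨b, hb, fun h' => hab (Fin.ext (h.trans h'.symm))⟩
        · exact ⟨a, ha, h⟩
      obtain ⟨w, hw, hw1, hw2⟩ := exists_sign_flip hcop (hodd j hj0)
      have hww : (w : ZMod (2 * bigP p)) * w = 1 := by
        have h1 : ((2 * bigP p : ℕ) : ℤ) ∣ w * w - 1 := by
          have h0 : ((2 * bigP p : ℕ) : ℤ) ∣ 4 * (bigP p : ℤ) := ⟨2, by push_cast; ring⟩
          exact h0.trans (by rwa [← sq])
        have h2 := (ZMod.intCast_zmod_eq_zero_iff_dvd (w * w - 1) (2 * bigP p)).2 h1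
        push_cast at h2
        exact sub_eq_zero.1 h2
      refine ⟨⟨w, w, hww, hww⟩, fun x => quadChar_mul_of_sq hM ?_ x, fun x => ?_⟩
      · refine (dvd_of_eq ?_).trans hw
        push_cast
        ring
      · obtain ⟨n, rfl⟩ := ZMod.intCast_surjective x
        simp only
        rw [← Int.cast_mul, hΦn, hΦn, genHikami_flip hcop hJ hjJ (hodd j hj0) hw hw1 hw2,
          neg_one_mul]

end hikami

end SeifertQMF

end

theorem mainTheorem9 (r : ℕ) (hr : 3 ≤ r) (p : Fin r → ℕ) (hpos : ∀ j, 0 < p j)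
    (hcop : Pairwise fun i j => (p i).Coprime (p j))
    (hodd : ∀ j : Fin r, (j : ℕ) ≠ 0 → Odd (p j))
    (s ν : ℕ) (hle : ν + s ≤ r - 3) (hpar : ν + s ≡ r - 3 [MOD 2])
    (g : ℤ → ℂ) (hg : g ∈ SeifertQMF.hikamiSpace p s) :
    ∃ (D : ℕ) (Φ : Fin D → ℂ → ℂ) (i : Fin D),
      Φ i = SeifertQMF.partialTheta ν g (2 * SeifertQMF.bigP p) ∧
      SeifertQMF.IsStrongVVQMFOnUHP (ν / 2 + 1) (2 * (ν : ℤ) + 1) Φ := by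
  have hP : 0 < SeifertQMF.bigP p := Finset.prod_pos fun j _ => hpos j
  have : NeZero (2 * SeifertQMF.bigP p) := ⟨by omega⟩
  -- The parity e = 1 - (ν mod 2) is opposite to that of ν and agrees with that of |J|. The
  -- remaining 2⌊ν/2⌋ of the exponent comes from derivatives.
  have hpar' : 1 - ν % 2 + s ≡ r [MOD 2] := by
    rw [Nat.ModEq] at hpar ⊢
    omega
  obtain ⟨Φ, hΦ, h⟩ := SeifertQMF.exists_mem_weilSpace hcop hodd (by omega) hpar' hg
  obtain ⟨D, F, i, hF, hQ⟩ := SeifertQMF.exists_isStrongVVQMFOnUHP (even_two_mul _)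
    (by omega : ν % 2 + (1 - ν % 2) = 1) (ν / 2) hΦ
  rw [Nat.mod_add_div] at hF hQ
  refine ⟨D, F, i, hF.trans ?_, hQ⟩
  rw [funext h]
  rfl
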